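/- Let $-\infty<a<b<\infty$ and let $J$ be a measurable space. To each $j\in J$ let there be given an integer $N_j\ge 2$, affine maps $S^{(j)}_i(x)=r^{(j)}_i x+c^{(j)}_i$, $i=1,\dots,N_j$, with $r_i^{(j)}\in(0,1)$ and $$a=S^{(j)}_1(a)<S^{(j)}_1(b)\le S^{(j)}_2(a)<S^{(j)}_2(b)\le\dots\le S^{(j)}_{N_j}(a)<S^{(j)}_{N_j}(b)=b,$$ and weights $m^{(j)}_1,\dots,m^{(j)}_{N_j}>0$ with $\sum_i m^{(j)}_i=1$, where $N_j$, $r_i^{(j)}$, $m_i^{(j)}$ depend measurably on $j$. Assume (C1) $\sup_j N_j<\infty$; (C2) $0<\inf_{j,i} m_i^{(j)}\le\sup_{j,i} m_i^{(j)}<1$; (C3) $0<\inf_{j,i} r_i^{(j)}\le\sup_{j,i} r_i^{(j)}<1$. Let $\mathbb P$ be a probability distribution on $J$ and $V\ge 1$ an integer. An environment $E$ assigns to each type $v\in\{1,\dots,V\}$ an index $j_v^E\in J$ and types $\tau^E_{v,i}\in\{1,\dots,V\}$, $1\le i\le N_{j_v^E}$. A type $\tau^\emptyset$ and a sequence $(E^k)_{k\ge1}$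 of environments define a $V$-variable tree $I$: the ancestor $\emptyset$ (generation $0$) has type $\tau^\emptyset$; an individual $\mathbf i$ of generation $n$ and type $v$ carries the index $j_v^{E^{n+1}}$ (also denoted by $\mathbf i$), has $N_{j_v^{E^{n+1}}}$ children, and its $i$-th child has type $\tau^{E^{n+1}}_{v,i}$. Let $I$ be random: $\tau^\emptyset$ is uniform on $\{1,\dots,V\}$, the $E^k$ are i.i.d. and independent of $\tau^\emptyset$, and in each environment the indices are chosen independently with law $\mathbb P$ and the types independently and uniformly on $\{1,\dots,V\}$, independently of the indices. Let $\mathbb P_V$ denote the resulting probability measure and $\mathbb E_V$ its expectation. For an individual $\mathbf i=(i_1,\dots,i_n)$ of generation $|\mathbf i|=n$ put $m_{\mathbf i}=m^{(\emptyset)}_{i_1}m^{((i_1))}_{i_2}\cdots m^{((i_1,\dots,i_{n-1}))}_{i_n}$, define $r_{\mathbf i}$ in the same way, and put $S_{\mathbf i}=S^{(\emptyset)}_{i_1}\circ\dots\circ S^{((i_1,\dots,i_{n-1}))}_{i_n}$. The $V$-variable Cantor measure $\mu^{(I)}$ is the weak limit, as $n\to\infty$, of the probability measures $\sum_{|\mathbf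 i|=n}m_{\mathbf i}\,\mu_0\circ S_{\mathbf i}^{-1}$, where $\mu_0$ is the normalised Lebesgue measure on $[a,b]$. For a finite non-atomic Borel measure $\mu$ on $[a,b]$ the Krein–Feller operator $\frac{d}{d\mu}\frac{d}{dx}$ sends $f$ to $g\in L_2(\mu)$ if $f$ is $C^1$ on $[a,b]$ and $f'(x)=f'(a)+\int_a^x g\,d\mu$ for all $x\in[a,b]$. Let $N_D^{\mu}(t)$ and $N_N^{\mu}(t)$ be the numbers of eigenvalues $\le t$, counted with multiplicities, of $-\frac{d}{d\mu}\frac{d}{dx}$ with Dirichlet conditions $f(a)=f(b)=0$ and with Neumann conditions $f'(a)=f'(b)=0$, respectively. Write $N_D^{(I)},N_N^{(I)}$ for $\mu=\mu^{(I)}$. Let $n(1)$ be the smallest $n\ge1$ such that $E^n$ is a neck, that is, all the types $\tau^{E^n}_{v,i}$ are equal. Then $n(1)<\infty$ almost surely, and $$f(x)=\mathbb E_V\log\sum_{|\mathbf i|=n(1)}(m_{\mathbf i}r_{\mathbf i})^x$$ is the expectation of an integrable random variable for every $x>0$. There is a unique $\gamma>0$ with $f(\gamma)=0$, and almost surely the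 measure $\mu^{(I)}$ exists and $$\lim_{t\to\infty}\frac{\log N^{(I)}_D(t)}{\log t}=\gamma\qquad\text{and}\qquad\lim_{t\to\infty}\frac{\log N^{(I)}_N(t)}{\log t}=\gamma.$$ -/

import Mathlib

open MeasureTheory Set Filter Topology
open scoped ENNReal

noncomputable section

namespace VCantor

/-! ### The Krein-Feller operator `d/dμ d/dx` on `[a,b]` and its eigenvalue counting functions -/

/-- For a finite non-atomic Borel measure `μ` on `[a,b]`: `f` belongs to the domain of
`d/dμ d/dx` and `d/dμ d/dx f = g` in `L²(μ)`: `f` is `C¹` on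
`[a,b]` (with one-sided derivatives at the end points), `g` is square integrable with respect to
`μ`, and `f'(x) = f'(a) + ∫_a^x g dμ` for all `x ∈ [a,b]`. -/
def KreinFeller (a b : ℝ) (μ : Measure ℝ) (f g : ℝ → ℝ) : Prop :=
  ContDiffOn ℝ 1 f (Icc a b) ∧ MemLp g 2 μ ∧
    ∀ x ∈ Icc a b, derivWithin f (Icc a b) x =
      derivWithin f (Icc a b) a + ∫ y in a..x, g y ∂μ

/-- Dirichlet boundary conditions. -/
def DirichletBC (a b : ℝ) (f : ℝ → ℝ) : Prop := f a = 0 ∧ f b = 0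

/-- Neumann boundary conditions. -/
def NeumannBC (a b : ℝ) (f : ℝ → ℝ) : Prop :=
  derivWithin f (Icc a b) a = 0 ∧ derivWithin f (Icc a b) b = 0

/-- `φ ∈ L²(μ)` solves `-(d/dμ d/dx) φ = lam φ` with boundary condition `BC`: it is the class of
some `f` in the domain of the operator that satisfies the boundary condition and whose image under
`d/dμ d/dx` is `-lam f`. -/
def SolvesEigen (a b : ℝ) (BC : (ℝ → ℝ) → Prop) (μ : Measure ℝ) (lam : ℝ) (φ : Lp ℝ 2 μ) : Prop :=
  ∃ f g : ℝ → ℝ, KreinFeller a b μ f g ∧ BC f ∧ φ =ᵐ[μ] f ∧ g =ᵐ[μ] fun y => -(lam * f y)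

/-- The number of eigenvalues `≤ t` of `-(d/dμ d/dx)` with boundary condition `BC`, counted with
multiplicities. Since eigenvectors of distinct eigenvalues are linearly independent, this number,
the sum of the dimensions of the eigenspaces for eigenvalues `≤ t`, is the dimension of the linear
span of all eigenvectors for eigenvalues `≤ t`. -/
def eigenCount (a b : ℝ) (BC : (ℝ → ℝ) → Prop) (μ : Measure ℝ) (t : ℝ) : ℕ :=
  Module.finrank ℝ (Submodule.span ℝ {φ : Lp ℝ 2 μ | ∃ lam ≤ t, SolvesEigen a b BC μ lam φ})

/-- The Dirichlet eigenvalue counting function. -/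
def countD (a b : ℝ) (μ : Measure ℝ) (t : ℝ) : ℕ := eigenCount a b (DirichletBC a b) μ t

/-- The Neumann eigenvalue counting function. -/
def countN (a b : ℝ) (μ : Measure ℝ) (t : ℝ) : ℕ := eigenCount a b (NeumannBC a b) μ t

/-! ### Families of weighted iterated function systems -/

/-- To each `j : J` a list of `N j ≥ 2` maps `x ↦ r j i * x + c j i`, `i = 0, …, N j - 1`, of
`[a,b]` into itself, ordered from left to right with non-overlapping images, the first one fixing
`a` and the last one fixing `b`, together with positive weights `m j i` of sum `1`.
Values of `r`, `c`, `m` at indices `i ≥ N j` have no meaning and are never used. -/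
structure IFSFamily (J : Type*) (a b : ℝ) where
  N : J → ℕ
  r : J → ℕ → ℝ
  c : J → ℕ → ℝ
  m : J → ℕ → ℝ
  a_lt_b : a < b
  two_le_N : ∀ j, 2 ≤ N j
  r_mem : ∀ j, ∀ i < N j, r j i ∈ Ioo (0 : ℝ) 1
  first_left : ∀ j, r j 0 * a + c j 0 = a
  last_right : ∀ j, r j (N j - 1) * b + c j (N j - 1) = b
  ordered : ∀ j i, i + 1 < N j → r j i * b + c j i ≤ r j (i + 1) * a + c j (i + 1)
  m_pos : ∀ j, ∀ i < N j, 0 < m j i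
  m_sum : ∀ j, ∑ i ∈ Finset.range (N j), m j i = 1

/-- An environment: to each type `v` an index `(E v).1 ∈ J` and a sequence of types `(E v).2`.
Only the first `N (E v).1` entries of the sequence are used. -/
abbrev Env (J : Type*) (V : ℕ) : Type _ := Fin V → J × (ℕ → Fin V)

/-- The data of a `V`-variable tree: the type of the ancestor and the sequence of environments;
entry `k` of the sequence is the environment `E^{k+1}`, which splits the individuals of
generation `k` and gives types to those of generation `k + 1`. -/
abbrev VTree (J : Type*) (V : ℕ) : Type _ := Fin V × (ℕ → Env J V)

section Tree

variable {J : Type*} {V : ℕ}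

/-- The index in `J` of the ancestor. -/
def VTree.index (ω : VTree J V) : J := (ω.2 0 ω.1).1

/-- The subtree rooted at the `i`-th child of the ancestor. -/
def VTree.sub (ω : VTree J V) (i : ℕ) : VTree J V := ((ω.2 0 ω.1).2 i, fun k => ω.2 (k + 1))

/-- The product `s_{i₁}^{(∅)} s_{i₂}^{((i₁))} ⋯ s_{iₙ}^{((i₁,…,iₙ₋₁))}` along the individual
`(i₁,…,iₙ)` of the tree. -/
def prodAlong (s : J → ℕ → ℝ) : VTree J V → List ℕ → ℝ
  | _, [] => 1
  | ω, i :: w => s ω.index i * prodAlong s (ω.sub i) w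

variable {a b : ℝ} (F : IFSFamily J a b)

/-- The map `S_{i₁}^{(∅)} ∘ ⋯ ∘ S_{iₙ}^{((i₁,…,iₙ₋₁))}`. -/
def mapAlong : VTree J V → List ℕ → ℝ → ℝ
  | _, [], x => x
  | ω, i :: w, x => F.r ω.index i * mapAlong (ω.sub i) w x + F.c ω.index i

/-- The `n`-th generation of the tree, its individuals being words `(i₁,…,iₙ)`. -/
def generation : VTree J V → ℕ → Finset (List ℕ)
  | _, 0 => {[]}
  | ω, n + 1 => (Finset.range (F.N ω.index)).biUnion fun i =>
      (generation (ω.sub i) n).map ⟨List.cons i, List.cons_injective⟩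

theorem sum_generation_succ {M : Type*} [AddCommMonoid M] (ω : VTree J V) (n : ℕ)
    (h : List ℕ → M) :
    ∑ w ∈ generation F ω (n + 1), h w =
      ∑ i ∈ Finset.range (F.N ω.index), ∑ w ∈ generation F (ω.sub i) n, h (i :: w) := by
  rw [generation, Finset.sum_biUnion]
  · simp
  · intro i _ k _ hik
    rw [Function.onFun, Finset.disjoint_left]
    intro w hw hw'
    simp only [Finset.mem_map, Function.Embedding.coeFn_mk] at hw hw'
    obtain ⟨u, -, rfl⟩ := hw
    obtain ⟨u', -, h'⟩ := hw'
    simp only [List.cons.injEq] at h'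
    exact hik h'.1.symm

theorem prodAlong_m_nonneg (n : ℕ) : ∀ (ω : VTree J V), ∀ w ∈ generation F ω n,
    0 ≤ prodAlong F.m ω w := by
  induction n with
  | zero => intro ω w hw; simp [generation] at hw; simp [hw, prodAlong]
  | succ n ih =>
    intro ω w hw
    simp only [generation, Finset.mem_biUnion, Finset.mem_map, Function.Embedding.coeFn_mk,
      Finset.mem_range] at hw
    obtain ⟨i, hi, u, hu, rfl⟩ := hw
    exact mul_nonneg (F.m_pos _ i hi).le (ih _ u hu)

theorem sum_prodAlong_m (n : ℕ) : ∀ ω : VTree J V,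
    ∑ w ∈ generation F ω n, prodAlong F.m ω w = 1 := by
  induction n with
  | zero => intro ω; simp [generation, prodAlong]
  | succ n ih =>
    intro ω
    rw [sum_generation_succ]
    simp only [prodAlong, ← Finset.mul_sum, ih, mul_one]
    exact F.m_sum _

theorem measurable_mapAlong (w : List ℕ) : ∀ ω : VTree J V, Measurable (mapAlong F ω w) := by
  induction w with
  | nil => intro ω; exact measurable_id
  | cons i w ih => intro ω; exact ((ih (ω.sub i)).const_mul _).add_const _

/-! ### `V`-variable Cantor measures -/

/-- The normalised Lebesgue measure on `[a,b]`. -/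
def unifInterval (a b : ℝ) : Measure ℝ := (ENNReal.ofReal (b - a))⁻¹ • volume.restrict (Icc a b)

/-- The approximating measure `μₙ = ∑_{i ∈ Iₙ} m_i μ₀ ∘ S_i⁻¹`. -/
def approxMeasure (ω : VTree J V) (n : ℕ) : Measure ℝ :=
  ∑ w ∈ generation F ω n,
    ENNReal.ofReal (prodAlong F.m ω w) • (unifInterval a b).map (mapAlong F ω w)

theorem isProbabilityMeasure_approx (ω : VTree J V) (n : ℕ) :
    IsProbabilityMeasure (approxMeasure F ω n) := by
  have h0 : unifInterval a b univ = 1 := by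
    have := F.a_lt_b
    simp only [unifInterval, Measure.smul_apply, Measure.restrict_apply_univ, Real.volume_Icc,
      smul_eq_mul]
    exact ENNReal.inv_mul_cancel (by simp [this]) ENNReal.ofReal_ne_top
  refine ⟨?_⟩
  have h1 : ∀ w, (unifInterval a b).map (mapAlong F ω w) univ = 1 := fun w => by
    rw [Measure.map_apply (measurable_mapAlong F w ω) MeasurableSet.univ, preimage_univ, h0]
  simp only [approxMeasure, Measure.finsetSum_apply, Measure.smul_apply, h1, smul_eq_mul, mul_one]
  rw [← ENNReal.ofReal_sum_of_nonneg (prodAlong_m_nonneg F n ω), sum_prodAlong_m]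
  simp

/-- `μₙ` as a Borel probability measure. -/
def approxProb (ω : VTree J V) (n : ℕ) : ProbabilityMeasure ℝ :=
  ⟨approxMeasure F ω n, isProbabilityMeasure_approx F ω n⟩

/-- `μ` is the `V`-variable Cantor measure of the tree `ω`: the weak limit of the `μₙ`. -/
def IsCantorMeasure (ω : VTree J V) (μ : ProbabilityMeasure ℝ) : Prop :=
  Tendsto (approxProb F ω) atTop (𝓝 μ)

/-! ### Necks -/

/-- An environment is a neck if all the types that it assigns are equal. -/
def IsNeck (E : Env J V) : Prop := ∃ u : Fin V, ∀ v, ∀ i < F.N (E v).1, (E v).2 i = u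

/-- `n ≥ 1` is a neck of the tree if the environment `E^n` is a neck. -/
def IsNeckLevel (ω : VTree J V) (n : ℕ) : Prop := ∃ k, n = k + 1 ∧ IsNeck F (ω.2 k)

/-- The first neck level `n(1)`. -/
def firstNeck (ω : VTree J V) : ℕ := sInf {n | IsNeckLevel F ω n}

/-- `log ∑_{|i| = n(1)} (m_i r_i)^x`. -/
def logNeckSum (x : ℝ) (ω : VTree J V) : ℝ :=
  Real.log (∑ w ∈ generation F ω (firstNeck F ω), (prodAlong F.m ω w * prodAlong F.r ω w) ^ x)

end Tree

/-! ### Random `V`-variable trees -/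

/-- The uniform distribution on the set of types. -/
def unifType (V : ℕ) [NeZero V] : Measure (Fin V) := (PMF.uniformOfFintype (Fin V)).toMeasure

instance (V : ℕ) [NeZero V] : IsProbabilityMeasure (unifType V) := by
  unfold unifType; infer_instance

section Law

variable {J : Type*} [MeasurableSpace J] (P : Measure J) [IsProbabilityMeasure P]
  (V : ℕ) [NeZero V]

/-- The law of an environment: all indices are chosen according to `P`, all types uniformly, and
all choices are independent. -/
def envLaw : Measure (Env J V) :=
  Measure.pi fun _ => P.prod (Measure.infinitePi fun _ : ℕ => unifType V)

instance : IsProbabilityMeasure (envLaw P V) := by unfold envLaw; infer_instance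

/-- The law of a random `V`-variable tree: the type of the ancestor is uniform, the environments
are i.i.d. with law `envLaw P V` and independent of it. -/
def treeLaw : Measure (VTree J V) :=
  (unifType V).prod (Measure.infinitePi fun _ : ℕ => envLaw P V)

instance : IsProbabilityMeasure (treeLaw P V) := by unfold treeLaw; infer_instance

end Law

end VCantor

end

/-! The problem is reduced to sums over cuts of the tree. The cell of an individual w has length r_w
(b - a) and mass m_w, so `weight`, the number m_w r_w, is mass times length up to a constant, and
the cells of a cut `A` have disjoint interiors. If t (b - a) m_w r_w < 1 on `A`, a combination of
eigenfunctions for eigenvalues at most t that vanishes at the left end point of every cell is zero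
in L²(μ), so at most |A| eigenfunctions are independent (`IsCut.eigenCount_le`). If t m_w r_w
exceeds a suitable constant on `A`, every cell carries a trapezoid whose energy is less than t times
its squared L²(μ) norm, so there are at least |A| eigenvalues, up to one in the Neumann case
(`IsCut.le_count`). Since a child has at least lo ^ 2 times the weight of its parent, there are cuts
whose weights are all comparable with 1/t (`exists_isCut`).

The step from test functions to eigenvalues uses a compact positive operator. The kernel min(x, y) -
a is the Gram kernel of a Hilbert space valued function; after a correction for the boundary
condition, the eigenvectors of the associated `featureOp` with eigenvalue θ > 0 give eigenfunctions
with eigenvalue 1/θ, and the Hilbert space norm of a test vector is its energy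
(`finrank_le_eigenCount`).

It remains to see when the sums of (m_w r_w)^x over cuts are bounded above or bounded away from
zero. All subtrees rooted at a neck are equal, so `levelSum` factorises at necks, and its logarithm
at the k-th neck is a sum of values of `logNeckSum` along the iterates of `regen`. The tree above
the first neck has the law of the whole tree and is independent of the block below
(`treeLaw_inter_regen`), so by the strong law the growth rate per neck is the expectation f(x). The
gaps between necks are o(k), hence the factors lost between necks are harmless. If f(x) < 0, level
sums are bounded, and so are cut sums at every larger exponent (`IsCut.sum_rpow_le_of_levelSum_le`).
If f(x) > 0, cut sums are bounded below (`IsCut.one_le_sum_rpow`). Finally f is continuous and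
strictly decreasing and changes sign (`exists_exponent`). -/

noncomputable section

namespace VCantor

/-! ### Compact positive operators and feature maps -/

section Spectral

variable {H : Type*} [NormedAddCommGroup H] [InnerProductSpace ℝ H]

open Module.End in
/-- A compact positive operator without eigenvalues above `θ` has norm at most `θ`. -/
theorem norm_le_of_forall_hasEigenvalue_le [CompleteSpace H] {S : H →L[ℝ] H} (hS : IsCompactOperator S)
    (hsym : S.IsSymmetric) (hpos : ∀ x, 0 ≤ inner ℝ (S x) x) {θ : ℝ} (hθ : 0 ≤ θ)
    (h : ∀ κ, HasEigenvalue (S : Module.End ℝ H) κ → κ ≤ θ) : ‖S‖ ≤ θ := by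
  by_contra! hlt
  have hS0 : ‖S‖ ≠ 0 := (hθ.trans_lt hlt).ne'
  have hnt : Nontrivial H := by
    by_contra hn
    rw [not_nontrivial_iff_subsingleton] at hn
    exact hS0 (by simp [Subsingleton.elim S 0])
  rcases hS.hasEigenvalue_or_mem_resolventSet hS0 with he | hr
  · exact absurd (h _ he) (not_le.2 hlt)
  -- If the norm belonged to the resolvent set, all Rayleigh quotients would stay below it by some
  -- `ε`, although it is the supremum of their absolute values.
  · obtain ⟨ε, hε, hle⟩ := S.rayleighQuotient_le_of_norm_mem_resolventSet (𝕜 := ℝ) hr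
    have hn := S.norm_eq_iSup_rayleighQuotient hsym
    have : (⨆ x, |S.rayleighQuotient x|) ≤ ‖S‖ - ε := by
      refine ciSup_le fun x => ?_
      rw [abs_of_nonneg]
      · exact hle x
      · exact div_nonneg (hpos x) (sq_nonneg _)
    linarith

open Module.End in
/-- A vector orthogonal to all eigenvectors with eigenvalue `≥ θ` has Rayleigh quotient at most
`θ`. -/
theorem inner_apply_le_of_orthogonal [CompleteSpace H] {T : H →L[ℝ] H} (hT : IsCompactOperator T)
    (hsym : T.IsSymmetric) (hpos : ∀ x, 0 ≤ inner ℝ (T x) x) {θ : ℝ} (hθ : 0 ≤ θ) {u : H}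
    (hu : ∀ (κ : ℝ) (h : H), θ ≤ κ → T h = κ • h → inner ℝ h u = 0) :
    inner ℝ (T u) u ≤ θ * ‖u‖ ^ 2 := by
  -- The span of the eigenvectors to be avoided is invariant, so by symmetry `T` restricts to its
  -- orthogonal complement, where no eigenvalue exceeds `θ`.
  set W : Submodule ℝ H := Submodule.span ℝ {h : H | ∃ κ, θ ≤ κ ∧ T h = κ • h} with hW
  have hmem : ∀ v : H, v ∈ Wᗮ ↔ ∀ (κ : ℝ) (h : H), θ ≤ κ → T h = κ • h → inner ℝ h v = 0 := by
    intro v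
    rw [hW, Submodule.mem_orthogonal]
    constructor
    · intro hv κ h hκ hh
      exact hv h (Submodule.subset_span ⟨κ, hκ, hh⟩)
    · intro hv w hw
      induction hw using Submodule.span_induction with
      | mem x hx => obtain ⟨κ, hκ, hx⟩ := hx; exact hv κ x hκ hx
      | zero => simp
      | add x y _ _ hx hy => rw [inner_add_left, hx, hy, add_zero]
      | smul c x _ hx => rw [inner_smul_left, hx, mul_zero]
  have hinv : ∀ v ∈ Wᗮ, T v ∈ Wᗮ := by
    intro v hv
    rw [hmem] at hv ⊢
    intro κ h hκ hh
    have := hsym h v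
    simp only [ContinuousLinearMap.coe_coe] at this
    rw [← this, hh, inner_smul_left, hv κ h hκ hh, mul_zero]
  let S : Wᗮ →L[ℝ] Wᗮ := T.restrict hinv
  have hSapp : ∀ v : Wᗮ, ((S v : Wᗮ) : H) = T v := fun v => rfl
  have hSc : IsCompactOperator S := hT.restrict' hinv
  have hSs : S.IsSymmetric := fun x y => hsym x y
  have hSn : ‖S‖ ≤ θ := by
    refine norm_le_of_forall_hasEigenvalue_le hSc hSs (fun x => hpos x) hθ fun κ hκ => ?_
    by_contra! hlt
    obtain ⟨v, hv⟩ := hκ.exists_hasEigenvector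
    have h1 : S v = κ • v := hv.apply_eq_smul
    have h2 : T v = κ • (v : H) := by rw [← hSapp, h1]; rfl
    have h3 := (hmem v).1 v.2 κ v hlt.le h2
    exact hv.2 (by simpa using h3)
  have huW : u ∈ Wᗮ := (hmem u).2 hu
  have h1 : inner ℝ (T u) u = inner ℝ (S ⟨u, huW⟩) (⟨u, huW⟩ : Wᗮ) := rfl
  rw [h1]
  calc inner ℝ (S ⟨u, huW⟩) (⟨u, huW⟩ : Wᗮ) ≤ ‖S ⟨u, huW⟩‖ * ‖(⟨u, huW⟩ : Wᗮ)‖ :=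
        real_inner_le_norm _ _
    _ ≤ (θ * ‖(⟨u, huW⟩ : Wᗮ)‖) * ‖(⟨u, huW⟩ : Wᗮ)‖ := by
        gcongr
        exact S.le_of_opNorm_le hSn _
    _ = θ * ‖u‖ ^ 2 := by rw [Submodule.coe_norm]; ring

/-- The operator `h ↦ ∫ ⟪κ x, h⟫ κ x dμ(x)` of a feature map `κ`. -/
def featureOp (κ : ℝ → H) (μ : Measure ℝ) : H →L[ℝ] H :=
  ∫ x, InnerProductSpace.rankOne ℝ (κ x) (κ x) ∂μ

variable {κ : ℝ → H} {μ : Measure ℝ} [IsProbabilityMeasure μ]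

theorem integrable_of_continuous_bounded {E : Type*} [NormedAddCommGroup E]
    [SecondCountableTopology E] {f : ℝ → E}
    (hf : Continuous f) {C : ℝ} (hC : ∀ x, ‖f x‖ ≤ C) : Integrable f μ := by
  borelize E
  exact Integrable.of_bound hf.aestronglyMeasurable C (.of_forall hC)

theorem integrable_rankOne (hκ : Continuous κ) {C : ℝ} (hC : ∀ x, ‖κ x‖ ≤ C) :
    Integrable (fun x => InnerProductSpace.rankOne ℝ (κ x) (κ x)) μ := by
  have hcont : Continuous fun x => InnerProductSpace.rankOne ℝ (κ x) (κ x) := by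
    have h1 : Continuous fun x => (InnerProductSpace.rankOne ℝ (κ x) : H →L⋆[ℝ] H →L[ℝ] H) :=
      (InnerProductSpace.rankOne ℝ).continuous.comp hκ
    exact h1.clm_apply hκ
  refine Integrable.of_bound hcont.aestronglyMeasurable (C * C) (.of_forall fun x => ?_)
  rw [InnerProductSpace.norm_rankOne]
  exact mul_le_mul (hC x) (hC x) (norm_nonneg _) ((norm_nonneg _).trans (hC x))

theorem featureOp_apply (hκ : Continuous κ) {C : ℝ} (hC : ∀ x, ‖κ x‖ ≤ C) (h : H) :
    featureOp κ μ h = ∫ x, inner ℝ (κ x) h • κ x ∂μ := by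
  rw [featureOp, ContinuousLinearMap.integral_apply (integrable_rankOne hκ hC)]
  rfl

theorem inner_featureOp [CompleteSpace H] (hκ : Continuous κ) {C : ℝ} (hC : ∀ x, ‖κ x‖ ≤ C) (h g : H) :
    inner ℝ (featureOp κ μ h) g = ∫ x, inner ℝ (κ x) h * inner ℝ (κ x) g ∂μ := by
  have hi : Integrable (fun x => inner ℝ (κ x) h • κ x) μ := by
    have := (integrable_rankOne (μ := μ) hκ hC).apply_continuousLinearMap h
    exact this
  rw [featureOp_apply hκ hC, real_inner_comm, ← integral_inner hi]
  congr with x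
  rw [inner_smul_right, real_inner_comm g]

theorem featureOp_isSymmetric [CompleteSpace H] (hκ : Continuous κ) {C : ℝ} (hC : ∀ x, ‖κ x‖ ≤ C) :
    (featureOp κ μ).IsSymmetric := by
  intro x y
  simp only [ContinuousLinearMap.coe_coe]
  rw [inner_featureOp hκ hC, real_inner_comm, inner_featureOp hκ hC]
  simp_rw [mul_comm]

theorem featureOp_nonneg [CompleteSpace H] (hκ : Continuous κ) {C : ℝ} (hC : ∀ x, ‖κ x‖ ≤ C) (h : H) :
    0 ≤ inner ℝ (featureOp κ μ h) h := by
  rw [inner_featureOp hκ hC]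
  exact integral_nonneg fun x => mul_self_nonneg _

/-- The operator is an average of rank-one operators, and the compact operators form a closed convex
set. -/
theorem featureOp_isCompact [CompleteSpace H] (hκ : Continuous κ) {C : ℝ} (hC : ∀ x, ‖κ x‖ ≤ C) :
    IsCompactOperator (featureOp κ μ) := by
  have hconv : Convex ℝ {f : H →L[ℝ] H | IsCompactOperator f} :=
    (compactOperator (RingHom.id ℝ) H H).convex
  refine hconv.integral_mem isClosed_setOfPred_isCompactOperator
    (.of_forall fun x => ?_) (integrable_rankOne hκ hC)
  rw [Set.mem_ofPred_eq, InnerProductSpace.rankOne_def']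
  have h1 : IsCompactOperator (ContinuousLinearMap.toSpanSingleton ℝ (κ x)) :=
    isCompactOperator_of_locallyCompactSpace_rng _
  exact h1.comp_clm _

end Spectral

end VCantor
end

noncomputable section

namespace VCantor

/-! ### Integration by parts and the upper bound for eigenvalue counts -/

section UpperBound

variable {a b : ℝ}

theorem continuousOn_derivWithin_Icc (hab : a < b) {f : ℝ → ℝ} (hf : ContDiffOn ℝ 1 f (Icc a b)) :
    ContinuousOn (derivWithin f (Icc a b)) (Icc a b) :=
  hf.continuousOn_derivWithin (uniqueDiffOn_Icc hab) le_rfl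

theorem integral_derivWithin_Icc {f : ℝ → ℝ} (hab : a < b)
    (hf : ContDiffOn ℝ 1 f (Icc a b)) {x y : ℝ} (hx : a ≤ x) (hxy : x ≤ y) (hy : y ≤ b) :
    ∫ z in x..y, derivWithin f (Icc a b) z = f y - f x := by
  have hsub : Icc x y ⊆ Icc a b := Icc_subset_Icc hx hy
  refine intervalIntegral.integral_eq_sub_of_hasDerivAt_of_le hxy (hf.continuousOn.mono hsub) ?_ ?_
  · intro z hz
    have hz' : Icc a b ∈ 𝓝 z := Icc_mem_nhds (hx.trans_lt hz.1) (hz.2.trans_le hy)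
    have := (hf.differentiableOn one_ne_zero z (hsub (Ioo_subset_Icc_self hz))).hasDerivWithinAt
    exact this.hasDerivAt hz'
  · refine ContinuousOn.intervalIntegrable ?_
    rw [uIcc_of_le hxy]
    exact (continuousOn_derivWithin_Icc hab hf).mono hsub

theorem sq_integral_le_mul_integral_sq {h : ℝ → ℝ} {x y : ℝ} (hxy : x ≤ y)
    (hh : ContinuousOn h (Icc x y)) :
    (∫ z in x..y, h z) ^ 2 ≤ (y - x) * ∫ z in x..y, h z ^ 2 := by
  rcases hxy.eq_or_lt with rfl | hlt
  · simp
  have hi : IntervalIntegrable h volume x y := by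
    apply ContinuousOn.intervalIntegrable; rwa [uIcc_of_le hxy]
  have hi2 : IntervalIntegrable (fun z => h z ^ 2) volume x y := by
    apply ContinuousOn.intervalIntegrable; rw [uIcc_of_le hxy]; exact hh.pow 2
  -- `c` is the mean of `h`; expanding the integral of `(h z - c) ^ 2` gives the Cauchy–Schwarz
  -- inequality.
  set c := (∫ z in x..y, h z) / (y - x)
  have h0 : 0 ≤ ∫ z in x..y, (h z - c) ^ 2 :=
    intervalIntegral.integral_nonneg hxy fun z _ => sq_nonneg _
  have h1 : ∫ z in x..y, (h z - c) ^ 2 =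
      (∫ z in x..y, h z ^ 2) - 2 * c * (∫ z in x..y, h z) + (y - x) * c ^ 2 := by
    have : ∀ z, (h z - c) ^ 2 = h z ^ 2 - 2 * c * h z + c ^ 2 := fun z => by ring
    simp_rw [this]
    rw [intervalIntegral.integral_add (hi2.sub (hi.const_mul _)) (by simp),
      intervalIntegral.integral_sub hi2 (hi.const_mul _), intervalIntegral.integral_const_mul]
    simp
  rw [h1] at h0
  have hc : (∫ z in x..y, h z) = c * (y - x) := by
    simp only [c]; field_simp [(sub_pos.2 hlt).ne']
  rw [hc] at h0 ⊢
  have hpos := sub_pos.2 hlt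
  nlinarith

/-- Integration by parts for the Krein-Feller operator. -/
theorem KreinFeller.integral_mul_eq {μ : Measure ℝ} [IsFiniteMeasure μ] (hab : a < b)
    (hμ : μ (Icc a b)ᶜ = 0) (hμa : μ {a} = 0) {f₁ g₁ f₂ : ℝ → ℝ} (h₁ : KreinFeller a b μ f₁ g₁)
    (h₂ : ContDiffOn ℝ 1 f₂ (Icc a b)) :
    ∫ x in a..b, derivWithin f₁ (Icc a b) x * derivWithin f₂ (Icc a b) x =
      derivWithin f₁ (Icc a b) b * f₂ b - derivWithin f₁ (Icc a b) a * f₂ a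
        - ∫ y, g₁ y * f₂ y ∂μ := by
  obtain ⟨hf₁, hg₁, hF⟩ := h₁
  set D₁ := derivWithin f₁ (Icc a b)
  set D₂ := derivWithin f₂ (Icc a b)
  have hgi : Integrable g₁ μ := hg₁.integrable (by norm_num)
  have hc₂ : ContinuousOn D₂ (Icc a b) := continuousOn_derivWithin_Icc hab h₂
  have hD₂ : IntegrableOn D₂ (Ioc a b) volume :=
    (hc₂.integrableOn_Icc).mono_set Ioc_subset_Icc_self
  have hD₂' : IntervalIntegrable D₂ volume a b :=
    (intervalIntegrable_iff_integrableOn_Ioc_of_le hab.le).2 hD₂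
  -- Interval integrals run over `Ioc`, so the point `a` must carry no mass.
  have haeIoc : ∀ᵐ y ∂μ, y ∈ Ioc a b := by
    have h1 : ∀ᵐ y ∂μ, y ∈ Icc a b := by
      rw [ae_iff]; exact hμ
    have h2 : ∀ᵐ y ∂μ, y ≠ a := by
      rw [ae_iff]; simpa using hμa
    filter_upwards [h1, h2] with y hy1 hy2
    exact ⟨lt_of_le_of_ne hy1.1 (Ne.symm hy2), hy1.2⟩
  -- Inserting the primitive of `g₁` for `D₁` gives a double integral over a < y ≤ x ≤ b with
  -- integrand `K`; Fubini allows integrating `D₂` first.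
  let K : ℝ → ℝ → ℝ := fun x y => (Ioc a x).indicator g₁ y * D₂ x
  have hKint : Integrable (Function.uncurry K) ((volume.restrict (Ioc a b)).prod μ) := by
    have h1 : Integrable (fun z : ℝ × ℝ => D₂ z.1 * g₁ z.2) ((volume.restrict (Ioc a b)).prod μ) :=
      hD₂.mul_prod hgi
    have hm : MeasurableSet {z : ℝ × ℝ | a < z.2 ∧ z.2 ≤ z.1} :=
      (measurableSet_lt measurable_const measurable_snd).inter
        (measurableSet_le measurable_snd measurable_fst)
    refine (h1.indicator hm).congr (.of_forall fun z => ?_)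
    simp only [K, Function.uncurry, indicator, mem_ofPred_eq, mem_Ioc]
    split_ifs <;> ring
  have hmain : ∫ x in Ioc a b, (∫ y, K x y ∂μ) = ∫ y, g₁ y * (f₂ b - f₂ y) ∂μ := by
    rw [integral_integral_swap hKint]
    refine integral_congr_ae ?_
    filter_upwards [haeIoc] with y hy
    have h1 : ∀ x ∈ Ioc a b, K x y = (Icc y b).indicator (fun x => g₁ y * D₂ x) x := by
      intro x hx
      simp only [K, indicator]
      by_cases hyx : y ≤ x
      · rw [if_pos ⟨hy.1, hyx⟩, if_pos ⟨hyx, hx.2⟩]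
      · rw [if_neg (fun h => hyx h.2), if_neg (fun h => hyx h.1)]; ring
    rw [setIntegral_congr_fun measurableSet_Ioc h1, setIntegral_indicator measurableSet_Icc]
    have h2 : Ioc a b ∩ Icc y b = Icc y b :=
      inter_eq_right.2 fun x hx => ⟨hy.1.trans_le hx.1, hx.2⟩
    rw [h2, integral_Icc_eq_integral_Ioc, ← intervalIntegral.integral_of_le hy.2,
      intervalIntegral.integral_const_mul, integral_derivWithin_Icc hab h₂ hy.1.le hy.2 le_rfl]
  have hDx : ∀ x ∈ Ioc a b, D₁ x * D₂ x = D₁ a * D₂ x + ∫ y, K x y ∂μ := by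
    intro x hx
    rw [hF x ⟨hx.1.le, hx.2⟩, add_mul, intervalIntegral.integral_of_le hx.1.le]
    simp only [K]
    rw [integral_mul_const, integral_indicator measurableSet_Ioc]
  have hb := hF b ⟨hab.le, le_rfl⟩
  have hgb : ∫ y in a..b, g₁ y ∂μ = ∫ y, g₁ y ∂μ := by
    rw [intervalIntegral.integral_of_le hab.le, Measure.restrict_eq_self_of_ae_mem haeIoc]
  rw [intervalIntegral.integral_of_le hab.le, setIntegral_congr_fun measurableSet_Ioc hDx,
    integral_add (hD₂.const_mul _) (show Integrable (fun x => ∫ y, K x y ∂μ) _ from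
      hKint.integral_prod_left), hmain, integral_const_mul,
    ← intervalIntegral.integral_of_le hab.le, integral_derivWithin_Icc hab h₂ le_rfl hab.le le_rfl,
    hb, hgb]
  have hg₁f : Integrable (fun y => g₁ y * f₂ y) μ := by
    obtain ⟨C, hC⟩ := isCompact_Icc.exists_bound_of_continuousOn h₂.continuousOn
    have hm : AEStronglyMeasurable f₂ μ := by
      have := h₂.continuousOn.aestronglyMeasurable (μ := μ) measurableSet_Icc
      rwa [Measure.restrict_eq_self_of_ae_mem (haeIoc.mono fun y hy => Ioc_subset_Icc_self hy)]
        at this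
    exact hgi.mul_bdd hm (haeIoc.mono fun y hy => hC y (Ioc_subset_Icc_self hy))
  have : ∫ y, g₁ y * (f₂ b - f₂ y) ∂μ = (∫ y, g₁ y ∂μ) * f₂ b - ∫ y, g₁ y * f₂ y ∂μ := by
    simp_rw [mul_sub]
    rw [integral_sub (hgi.mul_const _) hg₁f, integral_mul_const]
  rw [this]
  ring

/-- If vectors of distinct labels `lam k ≤ t` are orthogonal, the quadratic form with weights
`lam k` is bounded by `t` times the norm. -/
theorem sum_mul_inner_le_of_orthogonal {H ι : Type*} [NormedAddCommGroup H] [InnerProductSpace ℝ H]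
    [Fintype ι] (v : ι → H) (lam c : ι → ℝ) {t : ℝ} (ht : ∀ k, lam k ≤ t)
    (horth : ∀ k l, lam k ≠ lam l → inner ℝ (v k) (v l) = 0) :
    ∑ k, ∑ l, c k * c l * (lam k * inner ℝ (v k) (v l)) ≤
      t * ∑ k, ∑ l, c k * c l * inner ℝ (v k) (v l) := by
  -- This squared norm is the difference of the two sides: the product of the roots is `t - lam k`
  -- when the labels agree, and the inner product vanishes when they do not.
  have h0 : 0 ≤ inner ℝ (∑ k, (c k * √(t - lam k)) • v k) (∑ k, (c k * √(t - lam k)) • v k) :=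
    real_inner_self_nonneg
  simp only [sum_inner, inner_sum, inner_smul_left, inner_smul_right] at h0
  rw [Finset.mul_sum, ← sub_nonneg, ← Finset.sum_sub_distrib]
  refine h0.trans_eq (Finset.sum_congr rfl fun k _ => ?_)
  rw [Finset.mul_sum, Finset.mul_sum, ← Finset.sum_sub_distrib]
  refine Finset.sum_congr rfl fun l _ => ?_
  simp only [conj_trivial]
  by_cases h : lam k = lam l
  · have : √(t - lam k) * √(t - lam l) = t - lam k := by
      rw [← h, Real.mul_self_sqrt (sub_nonneg.2 (ht k))]
    rw [show inner ℝ (v l) (v k) = inner ℝ (v k) (v l) from real_inner_comm _ _]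
    linear_combination (c k * c l * inner ℝ (v k) (v l)) * this
  · rw [show inner ℝ (v l) (v k) = inner ℝ (v k) (v l) from real_inner_comm _ _, horth k l h]; simp

/-- Integration by parts without boundary terms. As the energy pairing is symmetric, it makes
eigenvectors with different eigenvalues orthogonal. -/
theorem SolvesEigen.integral_derivWithin_mul {μ : Measure ℝ} [IsFiniteMeasure μ] (hab : a < b)
    (hμ : μ (Icc a b)ᶜ = 0) (hμa : μ {a} = 0) {f₁ g₁ f₂ : ℝ → ℝ} (h₁ : KreinFeller a b μ f₁ g₁)
    (h₂ : ContDiffOn ℝ 1 f₂ (Icc a b)) (hbd : derivWithin f₁ (Icc a b) b * f₂ b -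
      derivWithin f₁ (Icc a b) a * f₂ a = 0) {lam : ℝ} (hg : g₁ =ᵐ[μ] fun y => -(lam * f₁ y))
    {φ₁ φ₂ : Lp ℝ 2 μ} (hφ₁ : φ₁ =ᵐ[μ] f₁) (hφ₂ : φ₂ =ᵐ[μ] f₂) :
    ∫ x in a..b, derivWithin f₁ (Icc a b) x * derivWithin f₂ (Icc a b) x =
      lam * inner ℝ φ₁ φ₂ := by
  rw [h₁.integral_mul_eq hab hμ hμa h₂, hbd, L2.inner_def, zero_sub, ← integral_neg,
    ← integral_const_mul]
  refine integral_congr_ae ?_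
  filter_upwards [hg, hφ₁, hφ₂] with y h1 h2 h3
  rw [h1, h2, h3]
  simp only [RCLike.inner_apply, conj_trivial]
  ring

theorem derivWithin_sum_smul (hab : a < b) {n : ℕ} {f : Fin n → ℝ → ℝ} (c : Fin n → ℝ)
    (hf : ∀ k, ContDiffOn ℝ 1 (f k) (Icc a b)) {x : ℝ} (hx : x ∈ Icc a b) :
    derivWithin (fun x => ∑ k, c k * f k x) (Icc a b) x =
      ∑ k, c k * derivWithin (f k) (Icc a b) x := by
  have hu := (uniqueDiffOn_Icc hab) x hx
  refine HasDerivWithinAt.derivWithin ?_ hu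
  refine HasDerivWithinAt.fun_sum fun k _ => ?_
  exact (((hf k).differentiableOn one_ne_zero x hx).hasDerivWithinAt).const_mul _

/-- The mass-length bound on a cell on which the function vanishes at the left end point. -/
theorem integral_sq_le_of_eq_zero (hab : a < b) {F : ℝ → ℝ} (hF : ContDiffOn ℝ 1 F (Icc a b))
    {p q : ℝ} (hp : a ≤ p) (hpq : p ≤ q) (hq : q ≤ b) (hFp : F p = 0) {ν : Measure ℝ}
    [IsFiniteMeasure ν] (hν : ν (Icc p q)ᶜ = 0) :
    Integrable (fun x => F x ^ 2) ν ∧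
    ∫ x, F x ^ 2 ∂ν ≤
      (q - p) * ν.real univ * ∫ x in Ioo p q, derivWithin F (Icc a b) x ^ 2 := by
  have hsub : Icc p q ⊆ Icc a b := Icc_subset_Icc hp hq
  have hD := (continuousOn_derivWithin_Icc hab hF).mono hsub
  have hae : ∀ᵐ x ∂ν, x ∈ Icc p q := by rw [ae_iff]; exact hν
  set I := ∫ x in Ioo p q, derivWithin F (Icc a b) x ^ 2
  have hI2 : IntegrableOn (fun x => derivWithin F (Icc a b) x ^ 2) (Icc p q) :=
    (hD.pow 2).integrableOn_Icc
  -- As `F` vanishes at `p`, it is the integral of its derivative from there; Cauchy–Schwarz gives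
  -- length times energy.
  have hbound : ∀ x ∈ Icc p q, F x ^ 2 ≤ (q - p) * I := by
    intro x hx
    have h1 : F x = ∫ z in p..x, derivWithin F (Icc a b) z := by
      rw [integral_derivWithin_Icc hab hF hp hx.1 (hx.2.trans hq), hFp, sub_zero]
    rw [h1]
    refine (sq_integral_le_mul_integral_sq hx.1 (hD.mono (Icc_subset_Icc_right hx.2))).trans ?_
    have h2 : ∫ z in p..x, derivWithin F (Icc a b) z ^ 2 ≤ I := by
      rw [intervalIntegral.integral_of_le hx.1]
      simp only [I]
      rw [← integral_Ioc_eq_integral_Ioo]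
      exact setIntegral_mono_set (hI2.mono_set Ioc_subset_Icc_self)
        (.of_forall fun z => sq_nonneg _) (Ioc_subset_Ioc_right hx.2).eventuallyLE
    have h3 : 0 ≤ ∫ z in p..x, derivWithin F (Icc a b) z ^ 2 :=
      intervalIntegral.integral_nonneg hx.1 fun z _ => sq_nonneg _
    exact mul_le_mul (by linarith [hx.2]) h2 h3 (by linarith)
  have hint : Integrable (fun x => F x ^ 2) ν := by
    refine Integrable.of_bound ?_ ((q - p) * I) ?_
    · have := ((hF.continuousOn.mono hsub).pow 2).aestronglyMeasurable (μ := ν) measurableSet_Icc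
      rwa [Measure.restrict_eq_self_of_ae_mem hae] at this
    · filter_upwards [hae] with x hx
      rw [Real.norm_of_nonneg (sq_nonneg _)]
      exact hbound x hx
  refine ⟨hint, ?_⟩
  calc ∫ x, F x ^ 2 ∂ν ≤ ∫ _, (q - p) * I ∂ν :=
        integral_mono_ae hint (integrable_const _) (hae.mono hbound)
    _ = (q - p) * ν.real univ * I := by rw [integral_const, smul_eq_mul]; ring

/-- A boundary condition for which the boundary terms in the integration by parts vanish. -/
def IsSymmetricBC (a b : ℝ) (BC : (ℝ → ℝ) → Prop) : Prop :=
  ∀ f₁ f₂, BC f₁ → BC f₂ →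
    derivWithin f₁ (Icc a b) b * f₂ b - derivWithin f₁ (Icc a b) a * f₂ a = 0

theorem isSymmetricBC_dirichlet : IsSymmetricBC a b (DirichletBC a b) :=
  fun _ _ _ h₂ => by rw [h₂.1, h₂.2]; ring

theorem isSymmetricBC_neumann : IsSymmetricBC a b (NeumannBC a b) :=
  fun _ _ h₁ _ => by rw [h₁.1, h₁.2]; ring

/-- With more independent eigenvectors than cells, a nontrivial combination `F` vanishes at the left
end point of every cell. Orthogonality bounds its energy by t ‖F‖², and `integral_sq_le_of_eq_zero`
bounds t ‖F‖² by a sum of cell energies with coefficients below one. Hence all cell energies vanish,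
and with them `F` in L²(μ), against independence. -/
theorem card_le_of_linearIndependent_eigen {μ : Measure ℝ} [IsFiniteMeasure μ] (hab : a < b)
    (hμ : μ (Icc a b)ᶜ = 0) (hμa : μ {a} = 0) {BC : (ℝ → ℝ) → Prop} (hBC : IsSymmetricBC a b BC)
    {ι : Type*} [Fintype ι] {p q : ι → ℝ} (hp : ∀ i, a ≤ p i) (hpq : ∀ i, p i ≤ q i)
    (hq : ∀ i, q i ≤ b) (hdisj : Pairwise fun i j => Disjoint (Ioo (p i) (q i)) (Ioo (p j) (q j)))
    {ν : ι → Measure ℝ} [∀ i, IsFiniteMeasure (ν i)] (hν : ∀ i, ν i (Icc (p i) (q i))ᶜ = 0)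
    (hsum : μ = ∑ i, ν i) {t : ℝ} (ht : 0 < t) (hcell : ∀ i, (q i - p i) * (ν i).real univ * t < 1)
    {n : ℕ} {φ : Fin n → Lp ℝ 2 μ} (hφ : ∀ k, ∃ lam ≤ t, SolvesEigen a b BC μ lam (φ k))
    (hli : LinearIndependent ℝ φ) : n ≤ Fintype.card ι := by
  by_contra! hlt
  choose lam hlam f g hKF hf hφf hg using hφ
  have hfC : ∀ k, ContDiffOn ℝ 1 (f k) (Icc a b) := fun k => (hKF k).1
  let T : (Fin n → ℝ) →ₗ[ℝ] (ι → ℝ) :=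
    { toFun := fun c i => ∑ k, c k * f k (p i)
      map_add' := fun c d => by ext i; simp [add_mul, Finset.sum_add_distrib]
      map_smul' := fun r c => by ext i; simp [mul_assoc, Finset.mul_sum] }
  have hker : LinearMap.ker T ≠ ⊥ := LinearMap.ker_ne_bot_of_finrank_lt (by simpa using hlt)
  obtain ⟨c, hcT, hc0⟩ := (Submodule.ne_bot_iff _).1 hker
  let F : ℝ → ℝ := fun x => ∑ k, c k * f k x
  have hFp : ∀ i, F (p i) = 0 := fun i => congrFun (LinearMap.mem_ker.1 hcT) i
  have hFC : ContDiffOn ℝ 1 F (Icc a b) :=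
    ContDiffOn.sum fun k _ => contDiffOn_const.mul (hfC k)
  set G : Fin n → Fin n → ℝ := fun k l => inner ℝ (φ k) (φ l)
  have hE : ∀ k l, ∫ x in a..b, derivWithin (f k) (Icc a b) x * derivWithin (f l) (Icc a b) x =
      lam k * G k l := fun k l =>
    SolvesEigen.integral_derivWithin_mul hab hμ hμa (hKF k) (hfC l) (hBC _ _ (hf k) (hf l)) (hg k)
      (hφf k) (hφf l)
  have horth : ∀ k l, lam k ≠ lam l → G k l = 0 := by
    intro k l hkl
    have h1 := hE k l
    have h2 := hE l k
    simp_rw [mul_comm (derivWithin (f l) _ _)] at h2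
    have h3 : G l k = G k l := real_inner_comm _ _
    rw [h1, h3] at h2
    have : (lam k - lam l) * G k l = 0 := by linarith
    exact (mul_eq_zero.1 this).resolve_left (sub_ne_zero.2 hkl)
  -- the energy of `F`
  have hDci : ∀ k l, IntervalIntegrable
      (fun x => derivWithin (f k) (Icc a b) x * derivWithin (f l) (Icc a b) x) volume a b := by
    intro k l
    apply ContinuousOn.intervalIntegrable
    rw [uIcc_of_le hab.le]
    exact (continuousOn_derivWithin_Icc hab (hfC k)).mul (continuousOn_derivWithin_Icc hab (hfC l))
  have henergy : ∫ x in a..b, derivWithin F (Icc a b) x ^ 2 =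
      ∑ k, ∑ l, c k * c l * (lam k * G k l) := by
    have h1 : ∀ x ∈ uIcc a b, derivWithin F (Icc a b) x ^ 2 = ∑ k, ∑ l, c k * c l *
        (derivWithin (f k) (Icc a b) x * derivWithin (f l) (Icc a b) x) := by
      intro x hx
      rw [uIcc_of_le hab.le] at hx
      rw [derivWithin_sum_smul hab c hfC hx, sq, Finset.sum_mul_sum]
      exact Finset.sum_congr rfl fun k _ => Finset.sum_congr rfl fun l _ => by ring
    rw [intervalIntegral.integral_congr h1, intervalIntegral.integral_finsetSum]
    · refine Finset.sum_congr rfl fun k _ => ?_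
      rw [intervalIntegral.integral_finsetSum]
      · refine Finset.sum_congr rfl fun l _ => ?_
        rw [intervalIntegral.integral_const_mul, hE]
      · exact fun l _ => (hDci k l).const_mul _
    · intro k _
      have := IntervalIntegrable.sum Finset.univ fun l (_ : l ∈ Finset.univ) =>
        (hDci k l).const_mul (c k * c l)
      exact this.congr (fun x _ => by simp [Finset.sum_apply])
  -- the norm of `F`
  have hnorm : ‖∑ k, c k • φ k‖ ^ 2 = ∑ k, ∑ l, c k * c l * G k l := by
    rw [← real_inner_self_eq_norm_sq, sum_inner]
    refine Finset.sum_congr rfl fun k _ => ?_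
    rw [inner_sum]
    refine Finset.sum_congr rfl fun l _ => ?_
    rw [inner_smul_left, inner_smul_right]
    simp only [conj_trivial, G]; ring
  have hΦF : ((∑ k, c k • φ k : Lp ℝ 2 μ) : ℝ → ℝ) =ᵐ[μ] F := by
    have h1 : ∀ s : Finset (Fin n), ((∑ k ∈ s, c k • φ k : Lp ℝ 2 μ) : ℝ → ℝ) =ᵐ[μ]
        fun x => ∑ k ∈ s, c k * f k x := by
      intro s
      induction s using Finset.induction_on with
      | empty =>
        simp only [Finset.sum_empty]
        exact Lp.coeFn_zero ℝ 2 μ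
      | insert k s hk ih =>
        rw [Finset.sum_insert hk]
        filter_upwards [Lp.coeFn_add (c k • φ k) (∑ k ∈ s, c k • φ k), Lp.coeFn_smul (c k) (φ k),
          hφf k, ih] with x h1 h2 h3 h4
        rw [h1, Pi.add_apply, h2, Pi.smul_apply, h3, h4, Finset.sum_insert hk, smul_eq_mul]
    exact h1 Finset.univ
  have hnorm2 : ‖∑ k, c k • φ k‖ ^ 2 = ∫ x, F x ^ 2 ∂μ := by
    rw [← real_inner_self_eq_norm_sq, L2.inner_def]
    refine integral_congr_ae ?_
    filter_upwards [hΦF] with x hx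
    rw [hx]; simp [sq]
  have hupper : ∫ x in a..b, derivWithin F (Icc a b) x ^ 2 ≤ t * ∫ x, F x ^ 2 ∂μ := by
    rw [henergy, ← hnorm2, hnorm]
    exact sum_mul_inner_le_of_orthogonal φ lam c hlam horth
  set D : ι → ℝ := fun i => ∫ x in Ioo (p i) (q i), derivWithin F (Icc a b) x ^ 2
  have hcells := fun i => integral_sq_le_of_eq_zero hab hFC (hp i) (hpq i) (hq i) (hFp i) (hν i)
  have hD0 : ∀ i, 0 ≤ D i := fun i => integral_nonneg fun x => sq_nonneg _
  have hFsum : ∫ x, F x ^ 2 ∂μ ≤ ∑ i, (q i - p i) * (ν i).real univ * D i := by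
    rw [hsum, integral_finsetSum_measure fun i _ => (hcells i).1]
    exact Finset.sum_le_sum fun i _ => (hcells i).2
  have hDint : IntegrableOn (fun x => derivWithin F (Icc a b) x ^ 2) (Icc a b) :=
    ((continuousOn_derivWithin_Icc hab hFC).pow 2).integrableOn_Icc
  have hIoo : ∀ i, Ioo (p i) (q i) ⊆ Icc a b := fun i =>
    Ioo_subset_Icc_self.trans (Icc_subset_Icc (hp i) (hq i))
  have hDsum : ∑ i, D i ≤ ∫ x in a..b, derivWithin F (Icc a b) x ^ 2 := by
    simp only [D]
    rw [← integral_iUnion_fintype (fun i => measurableSet_Ioo) hdisj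
      (fun i => hDint.mono_set (hIoo i)), intervalIntegral.integral_of_le hab.le,
      ← integral_Icc_eq_integral_Ioc]
    exact setIntegral_mono_set hDint (.of_forall fun x => sq_nonneg _)
      (iUnion_subset hIoo).eventuallyLE
  have hD00 : ∀ i, D i = 0 := by
    have h1 : ∑ i, (1 - (q i - p i) * (ν i).real univ * t) * D i ≤ 0 := by
      have : ∑ i, (1 - (q i - p i) * (ν i).real univ * t) * D i =
          ∑ i, D i - t * ∑ i, (q i - p i) * (ν i).real univ * D i := by
        rw [Finset.mul_sum, ← Finset.sum_sub_distrib]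
        exact Finset.sum_congr rfl fun i _ => by ring
      rw [this]
      nlinarith
    have h2 : ∀ i ∈ Finset.univ, 0 ≤ (1 - (q i - p i) * (ν i).real univ * t) * D i := fun i _ =>
      mul_nonneg (sub_nonneg.2 (hcell i).le) (hD0 i)
    have h3 := (Finset.sum_eq_zero_iff_of_nonneg h2).1 (le_antisymm h1 (Finset.sum_nonneg h2))
    intro i
    exact (mul_eq_zero.1 (h3 i (Finset.mem_univ i))).resolve_left (sub_pos.2 (hcell i)).ne'
  have hF0 : ‖∑ k, c k • φ k‖ ^ 2 ≤ 0 := by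
    rw [hnorm2]; simpa [hD00] using hFsum
  have hzero : ∑ k, c k • φ k = 0 := by
    rw [← norm_eq_zero]; exact pow_eq_zero_iff two_ne_zero |>.1 (le_antisymm hF0 (sq_nonneg _))
  exact hc0 (funext fun k => Fintype.linearIndependent_iff.1 hli c hzero k)

/-- **Upper bound for the eigenvalue counting function.** -/
theorem eigenCount_le_card {μ : Measure ℝ} [IsFiniteMeasure μ] (hab : a < b)
    (hμ : μ (Icc a b)ᶜ = 0) (hμa : μ {a} = 0) {BC : (ℝ → ℝ) → Prop} (hBC : IsSymmetricBC a b BC)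
    {ι : Type*} [Fintype ι] {p q : ι → ℝ} (hp : ∀ i, a ≤ p i) (hpq : ∀ i, p i ≤ q i)
    (hq : ∀ i, q i ≤ b) (hdisj : Pairwise fun i j => Disjoint (Ioo (p i) (q i)) (Ioo (p j) (q j)))
    {ν : ι → Measure ℝ} [∀ i, IsFiniteMeasure (ν i)] (hν : ∀ i, ν i (Icc (p i) (q i))ᶜ = 0)
    (hsum : μ = ∑ i, ν i) {t : ℝ} (ht : 0 < t)
    (hcell : ∀ i, (q i - p i) * (ν i).real univ * t < 1) :
    FiniteDimensional ℝ
      (Submodule.span ℝ {φ : Lp ℝ 2 μ | ∃ lam ≤ t, SolvesEigen a b BC μ lam φ}) ∧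
    eigenCount a b BC μ t ≤ Fintype.card ι := by
  -- `B` is a basis of the span made of eigenvectors, so the previous count applies to its finite
  -- subsets.
  obtain ⟨B, hBs, hspan, hli⟩ :=
    exists_linearIndependent ℝ {φ : Lp ℝ 2 μ | ∃ lam ≤ t, SolvesEigen a b BC μ lam φ}
  have hcard : ∀ s : Finset (Lp ℝ 2 μ), (s : Set _) ⊆ B → s.card ≤ Fintype.card ι := by
    intro s hs
    let e := s.equivFin.symm
    refine card_le_of_linearIndependent_eigen hab hμ hμa hBC hp hpq hq hdisj hν hsum ht hcell
      (φ := fun k => (e k : Lp ℝ 2 μ)) (fun k => hBs (hs (e k).2)) ?_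
    exact hli.comp (fun k : Fin s.card => (⟨(e k : Lp ℝ 2 μ), hs (e k).2⟩ : B))
      (fun k l hkl => e.injective (Subtype.ext (Subtype.mk_eq_mk.1 hkl)))
  have hfin : B.Finite := by
    by_contra hinf
    obtain ⟨s, hs, hc⟩ := (show B.Infinite from hinf).exists_subset_card_eq (Fintype.card ι + 1)
    have := hcard s hs
    omega
  rw [eigenCount, ← hspan]
  have := hfin.fintype
  refine ⟨FiniteDimensional.span_of_finite ℝ hfin, ?_⟩
  refine (finrank_span_le_card B).trans ?_
  exact hcard B.toFinset (by simp)

end UpperBound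
end VCantor
end

noncomputable section

namespace VCantor

/-! ### Feature maps into L²(μ) and the lower bound for eigenvalue counts -/

section LowerBound

variable {H : Type*} [NormedAddCommGroup H] [InnerProductSpace ℝ H]

theorem memLp_inner {κ : ℝ → H} (hκ : Continuous κ) {C : ℝ} (hC : ∀ x, ‖κ x‖ ≤ C) (μ : Measure ℝ)
    [IsFiniteMeasure μ] (h : H) : MemLp (fun x => inner ℝ (κ x) h) 2 μ :=
  MemLp.of_bound (hκ.inner continuous_const).aestronglyMeasurable (C * ‖h‖)
    (.of_forall fun x => (norm_inner_le_norm _ _).trans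
      (mul_le_mul_of_nonneg_right (hC x) (norm_nonneg _)))

/-- The map that sends `h` to the class of `x ↦ ⟪κ x, h⟫` in `L²(μ)`. -/
def featureMap {κ : ℝ → H} (hκ : Continuous κ) {C : ℝ} (hC : ∀ x, ‖κ x‖ ≤ C) (μ : Measure ℝ)
    [IsFiniteMeasure μ] : H →ₗ[ℝ] Lp ℝ 2 μ :=
  { toFun := fun h => (memLp_inner hκ hC μ h).toLp
    map_add' := fun h g => by
      rw [← MemLp.toLp_add]
      congr 1
      ext x
      exact inner_add_right _ _ _
    map_smul' := fun c h => by
      rw [RingHom.id_apply, ← MemLp.toLp_const_smul]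
      congr 1
      ext x
      exact inner_smul_right _ _ _ }

theorem featureMap_coeFn {κ : ℝ → H} (hκ : Continuous κ) {C : ℝ} (hC : ∀ x, ‖κ x‖ ≤ C)
    (μ : Measure ℝ) [IsFiniteMeasure μ] (h : H) :
    featureMap hκ hC μ h =ᵐ[μ] fun x => inner ℝ (κ x) h :=
  MemLp.coeFn_toLp (memLp_inner hκ hC μ h)

/-- With `inner_featureOp` this says that `featureOp` is the feature map followed by its adjoint, so
orthogonality in L²(μ) can be tested in `H`. -/
theorem inner_featureMap {κ : ℝ → H} (hκ : Continuous κ) {C : ℝ} (hC : ∀ x, ‖κ x‖ ≤ C)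
    (μ : Measure ℝ) [IsFiniteMeasure μ] (h g : H) :
    inner ℝ (featureMap hκ hC μ h) (featureMap hκ hC μ g) =
      ∫ x, inner ℝ (κ x) h * inner ℝ (κ x) g ∂μ := by
  rw [L2.inner_def]
  refine integral_congr_ae ?_
  filter_upwards [featureMap_coeFn hκ hC μ h, featureMap_coeFn hκ hC μ g] with x h1 h2
  rw [h1, h2]
  simp [mul_comm]

/-- **Lower bound for the eigenvalue counting function**: a space of test functions with Rayleigh
quotients below `t`. -/
theorem finrank_le_eigenCount [CompleteSpace H] {a b : ℝ} {BC : (ℝ → ℝ) → Prop} {μ : Measure ℝ}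
    [IsProbabilityMeasure μ] {κ : ℝ → H} (hκ : Continuous κ) {C : ℝ} (hC : ∀ x, ‖κ x‖ ≤ C)
    (hsol : ∀ θ : ℝ, 0 < θ → ∀ h : H, featureOp κ μ h = θ • h →
      SolvesEigen a b BC μ θ⁻¹ (featureMap hκ hC μ h)) {t : ℝ} (ht : 0 < t)
    [FiniteDimensional ℝ
      (Submodule.span ℝ {φ : Lp ℝ 2 μ | ∃ lam ≤ t, SolvesEigen a b BC μ lam φ})]
    (U : Submodule ℝ H) [FiniteDimensional ℝ U]
    (hU : ∀ u ∈ U, u ≠ 0 → ‖u‖ ^ 2 < t * ∫ x, inner ℝ (κ x) u * inner ℝ (κ x) u ∂μ) :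
    Module.finrank ℝ U ≤ eigenCount a b BC μ t := by
  by_contra! hlt
  rw [eigenCount] at hlt
  set S := Submodule.span ℝ {φ : Lp ℝ 2 μ | ∃ lam ≤ t, SolvesEigen a b BC μ lam φ} with hS
  -- If `U` had larger dimension than `S`, some nonzero `u` in `U` would have an image orthogonal to
  -- `S`. Then `u` is orthogonal in `H` to all eigenvectors of `featureOp` with eigenvalue at least
  -- `t⁻¹`, and its Rayleigh quotient contradicts `hU`.
  let Ψ : U →ₗ[ℝ] S :=
    (S.orthogonalProjectionOnto : Lp ℝ 2 μ →ₗ[ℝ] S) ∘ₗ featureMap hκ hC μ ∘ₗ U.subtype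
  obtain ⟨⟨u, huU⟩, huΨ, hu0⟩ :=
    (Submodule.ne_bot_iff _).1 (LinearMap.ker_ne_bot_of_finrank_lt (f := Ψ) hlt)
  have hu0' : u ≠ 0 := fun h => hu0 (Subtype.ext h)
  have hperp : featureMap hκ hC μ u ∈ Sᗮ :=
    Submodule.orthogonalProjectionOnto_eq_zero_iff.1 (LinearMap.mem_ker.1 huΨ)
  have hle := inner_apply_le_of_orthogonal (featureOp_isCompact (μ := μ) hκ hC)
    (featureOp_isSymmetric hκ hC) (featureOp_nonneg hκ hC) (inv_pos.2 ht).le (u := u) (by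
      intro θ h hθ hh
      have hθ0 : 0 < θ := (inv_pos.2 ht).trans_le hθ
      have h1 : featureMap hκ hC μ h ∈ S :=
        Submodule.subset_span ⟨θ⁻¹, inv_le_of_inv_le₀ ht hθ, hsol θ hθ0 h hh⟩
      have h2 := hperp _ h1
      rw [inner_featureMap, ← inner_featureOp hκ hC, hh, inner_smul_left] at h2
      exact (mul_eq_zero.1 h2).resolve_left hθ0.ne')
  rw [inner_featureOp hκ hC] at hle
  have := hU u huU hu0'
  rw [inv_mul_eq_div, le_div_iff₀ ht] at hle
  linarith

variable {a b : ℝ} {μ : Measure ℝ} [IsProbabilityMeasure μ]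

/-- Fubini for the kernel `min x y - a`. -/
theorem integral_min_sub_mul [NullSingletonClass μ] (hμ : μ (Icc a b)ᶜ = 0) {f : ℝ → ℝ}
    (hf : Integrable f μ) {x : ℝ} (hx : x ∈ Icc a b) :
    ∫ y, (min x y - a) * f y ∂μ =
      ∫ z in a..x, ((∫ y, f y ∂μ) - ∫ y in a..z, f y ∂μ) := by
  have haeIcc : ∀ᵐ y ∂μ, y ∈ Icc a b := by rw [ae_iff]; exact hμ
  have hae : ∀ᵐ y ∂μ, y ∈ Ioc a b := by
    filter_upwards [haeIcc, measure_eq_zero_iff_ae_notMem.1 (measure_singleton (μ := μ) a)]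
      with y h1 h2
    exact ⟨lt_of_le_of_ne h1.1 fun h => h2 (by simp [h]), h1.2⟩
  -- The factor `min x y - a` is the length of the set of all `z` in `Ioc a x` with `z < y`.
  let K : ℝ → ℝ → ℝ := fun z y => (Ioi z).indicator f y
  have hKint : Integrable (Function.uncurry K) ((volume.restrict (Ioc a x)).prod μ) := by
    have h1 : Integrable (fun z : ℝ × ℝ => (1 : ℝ) * f z.2)
        ((volume.restrict (Ioc a x)).prod μ) :=
      (integrable_const (1 : ℝ)).mul_prod hf
    refine (h1.indicator (measurableSet_lt measurable_fst measurable_snd)).congr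
      (.of_forall fun z => ?_)
    simp only [K, Function.uncurry, indicator, mem_ofPred_eq, mem_Ioi, one_mul]
  have h1 : ∀ z ∈ Ioc a x, (∫ y, f y ∂μ) - ∫ y in a..z, f y ∂μ = ∫ y, K z y ∂μ := by
    intro z hz
    simp only [K]
    rw [integral_indicator measurableSet_Ioi, intervalIntegral.integral_of_le hz.1.le,
      sub_eq_iff_eq_add, ← setIntegral_union]
    · refine (setIntegral_eq_integral_of_ae_compl_eq_zero ?_).symm
      filter_upwards [hae] with y hy hy'
      refine absurd ?_ hy'
      by_cases h : y ≤ z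
      · exact Or.inr ⟨hy.1, h⟩
      · exact Or.inl (not_le.1 h)
    · exact Set.disjoint_left.2 fun y h h' => absurd h'.2 (not_le.2 h)
    · exact measurableSet_Ioc
    · exact hf.integrableOn
    · exact hf.integrableOn
  rw [intervalIntegral.integral_of_le hx.1, setIntegral_congr_fun measurableSet_Ioc h1,
    integral_integral_swap hKint]
  refine integral_congr_ae ?_
  filter_upwards [hae] with y hy
  have h2 : ∀ z, K z y = (Iio y).indicator (fun _ => f y) z := by
    intro z; simp only [K, indicator, mem_Ioi, mem_Iio]
  simp_rw [h2]
  rw [setIntegral_indicator measurableSet_Iio, setIntegral_const, smul_eq_mul]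
  congr 1
  have h3 : (Ioc a x ∩ Iio y : Set ℝ) =ᵐ[volume] Ioc a (min x y) := by
    have : (Iio y : Set ℝ) =ᵐ[volume] Iic y := Iio_ae_eq_Iic
    rw [← Ioc_inter_Iic]
    exact (ae_eq_refl _).inter this
  rw [measureReal_congr h3, Real.volume_real_Ioc_of_le (le_min hx.1 hy.1.le)]

/-- Solutions of the integral equation with kernel `min x y - a`, up to affine functions, solve the
eigenvalue equation. -/
theorem exists_kreinFeller_of_integral_eq [NullSingletonClass μ] (hab : a < b) (hμ : μ (Icc a b)ᶜ = 0) {f : ℝ → ℝ}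
    (hf : Integrable f μ) {θ C C' : ℝ} (hθ : 0 < θ)
    (heq : ∀ x ∈ Icc a b, θ * f x = (∫ y, (min x y - a) * f y ∂μ) - C * (x - a) + C') :
    ∃ F g : ℝ → ℝ, KreinFeller a b μ F g ∧ (∀ x ∈ Icc a b, F x = f x) ∧
      (∀ y, g y = -(θ⁻¹ * F y)) ∧
      (∀ x ∈ Icc a b, derivWithin F (Icc a b) x =
        θ⁻¹ * ((∫ y, f y ∂μ) - (∫ y in a..x, f y ∂μ) - C)) := by
  have haeIcc : ∀ᵐ y ∂μ, y ∈ Icc a b := by rw [ae_iff]; exact hμ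
  -- By Fubini the primitive of `B` is the integral against the kernel, so the right-hand side of
  -- `heq` extends to a `C¹` function on the line.
  let B : ℝ → ℝ := fun z => (∫ y, f y ∂μ) - ∫ y in a..z, f y ∂μ
  have hB : Continuous B := continuous_const.sub (hf.continuous_primitive a)
  let F : ℝ → ℝ := fun x => θ⁻¹ * ((∫ z in a..x, B z) - C * (x - a) + C')
  have hFd : ∀ x, HasDerivAt F (θ⁻¹ * (B x - C)) x := by
    intro x
    have h1 : HasDerivAt (fun x => ∫ z in a..x, B z) (B x) x :=
      intervalIntegral.integral_hasDerivAt_right (hB.intervalIntegrable _ _)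
        (hB.stronglyMeasurableAtFilter _ _) hB.continuousAt
    have h2 : HasDerivAt (fun x => C * (x - a)) C x := by
      simpa using ((hasDerivAt_id x).sub_const a).const_mul C
    exact ((h1.sub h2).add_const C').const_mul θ⁻¹
  have hFf : ∀ x ∈ Icc a b, F x = f x := by
    intro x hx
    simp only [F, B]
    rw [← integral_min_sub_mul hμ hf hx, ← heq x hx, inv_mul_cancel_left₀ hθ.ne']
  have hFC : ContDiff ℝ 1 F := by
    rw [contDiff_one_iff_deriv]
    refine ⟨fun x => (hFd x).differentiableAt, ?_⟩
    have : deriv F = fun x => θ⁻¹ * (B x - C) := funext fun x => (hFd x).deriv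
    rw [this]
    exact continuous_const.mul (hB.sub continuous_const)
  have hdW : ∀ x ∈ Icc a b, derivWithin F (Icc a b) x = θ⁻¹ * (B x - C) := fun x hx =>
    (hFd x).hasDerivWithinAt.derivWithin ((uniqueDiffOn_Icc hab) x hx)
  refine ⟨F, fun y => -(θ⁻¹ * F y), ⟨hFC.contDiffOn, ?_, ?_⟩, hFf, fun y => rfl, hdW⟩
  · obtain ⟨M, hM⟩ := isCompact_Icc.exists_bound_of_continuousOn
      (hFC.continuous.continuousOn (s := Icc a b))
    refine MemLp.of_bound
      ((continuous_const.mul hFC.continuous).neg).aestronglyMeasurable (θ⁻¹ * M) ?_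
    filter_upwards [haeIcc] with y hy
    rw [norm_neg, norm_mul, Real.norm_of_nonneg (inv_pos.2 hθ).le]
    exact mul_le_mul_of_nonneg_left (hM y hy) (inv_pos.2 hθ).le
  · intro x hx
    rw [hdW x hx, hdW a (left_mem_Icc.2 hab.le)]
    have h1 : ∫ y in a..x, -(θ⁻¹ * F y) ∂μ = -(θ⁻¹ * ∫ y in a..x, f y ∂μ) := by
      rw [intervalIntegral.integral_neg, intervalIntegral.integral_const_mul]
      congr 2
      refine intervalIntegral.integral_congr fun y hy => ?_
      rw [uIcc_of_le hx.1] at hy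
      exact hFf y ⟨hy.1, hy.2.trans hx.2⟩
    rw [h1]
    simp only [B, intervalIntegral.integral_same]
    ring

/-- A Hilbert space valued function with the covariance of Brownian motion started at `a` and
stopped at `b`. -/
def IsBrownianKernel (a b : ℝ) (k : ℝ → H) : Prop :=
  ∀ x y, inner ℝ (k x) (k y) = min (max a (min b x)) (max a (min b y)) - a

theorem IsBrownianKernel.inner_eq {k : ℝ → H} (hk : IsBrownianKernel a b k) {x y : ℝ}
    (hx : x ∈ Icc a b) (hy : y ∈ Icc a b) : inner ℝ (k x) (k y) = min x y - a := by
  rw [hk, min_eq_right hx.2, min_eq_right hy.2, max_eq_right hx.1, max_eq_right hy.1]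

/-- The norm of an increment is expressed by the covariance, which is continuous in its arguments.
-/
theorem IsBrownianKernel.continuous {k : ℝ → H} (hk : IsBrownianKernel a b k) : Continuous k := by
  rw [continuous_iff_continuousAt]
  intro x
  rw [ContinuousAt, tendsto_iff_norm_sub_tendsto_zero]
  have h1 : ∀ y, ‖k y - k x‖ = √(inner ℝ (k y) (k y) - 2 * inner ℝ (k y) (k x)
      + inner ℝ (k x) (k x)) := by
    intro y
    rw [real_inner_self_eq_norm_sq, real_inner_self_eq_norm_sq, ← norm_sub_sq_real,
      Real.sqrt_sq (norm_nonneg _)]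
  simp_rw [h1, hk _ _]
  have h2 : Continuous fun y : ℝ => √(min (max a (min b y)) (max a (min b y)) - a -
      2 * (min (max a (min b y)) (max a (min b x)) - a)
      + (min (max a (min b x)) (max a (min b x)) - a)) := by fun_prop
  have h3 := h2.tendsto x
  simp only [min_self] at h3 ⊢
  convert h3 using 2
  symm
  rw [Real.sqrt_eq_zero']
  linarith

theorem IsBrownianKernel.norm_le {k : ℝ → H} (hk : IsBrownianKernel a b k) (hab : a < b) (x : ℝ) :
    ‖k x‖ ≤ √(b - a) := by
  apply Real.le_sqrt_of_sq_le
  rw [← real_inner_self_eq_norm_sq, hk, min_self]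
  have : max a (min b x) ≤ b := max_le hab.le (min_le_left _ _)
  linarith

/-- Indicators of intervals starting at `a` have these inner products, because the intersection of
two such intervals is the shorter one. -/
theorem exists_isBrownianKernel (a b : ℝ) :
    ∃ k : ℝ → Lp ℝ 2 (volume : Measure ℝ), IsBrownianKernel a b k := by
  refine ⟨fun x => indicatorConstLp 2 (measurableSet_Ioc (a := a) (b := max a (min b x)))
    measure_Ioc_lt_top.ne (1 : ℝ), fun x y => ?_⟩
  rw [L2.inner_indicatorConstLp_one_indicatorConstLp_one _ _ measure_Ioc_lt_top.ne
    measure_Ioc_lt_top.ne]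
  have h : Ioc a (max a (min b x)) ∩ Ioc a (max a (min b y)) =
      Ioc a (min (max a (min b x)) (max a (min b y))) := by
    rw [Ioc_inter_Ioc, max_self]
  rw [h, Real.volume_real_Ioc_of_le (le_min (le_max_left _ _) (le_max_left _ _))]
  simp

/-- The trapezoidal test function which is `1` on `[p', q']` and `0` outside `[p, q]`, as an element
of the Hilbert space. -/
def trapezoid (k : ℝ → H) (p p' q' q : ℝ) : H :=
  (p' - p)⁻¹ • (k p' - k p) - (q - q')⁻¹ • (k q - k q')

/-! ### Trapezoidal test functions -/

section Trapezoid

variable {k : ℝ → H} {p p' q' q : ℝ}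

/-- Pairing with `k x` evaluates at `x`: the vector represents the piecewise linear function on the
right. -/
theorem inner_trapezoid (hk : IsBrownianKernel a b k) (hp : a ≤ p) (hpp : p < p') (hpq : p' ≤ q')
    (hqq : q' < q) (hq : q ≤ b) {x : ℝ} (hx : x ∈ Icc a b) :
    inner ℝ (k x) (trapezoid k p p' q' q) =
      (p' - p)⁻¹ * (min x p' - min x p) - (q - q')⁻¹ * (min x q - min x q') := by
  rw [trapezoid, inner_sub_right, inner_smul_right, inner_smul_right, inner_sub_right,
    inner_sub_right, hk.inner_eq hx ⟨by linarith, by linarith⟩,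
    hk.inner_eq hx ⟨by linarith, by linarith⟩, hk.inner_eq hx ⟨by linarith, by linarith⟩,
    hk.inner_eq hx ⟨by linarith, by linarith⟩]
  ring

theorem inner_trapezoid_eq_zero (hk : IsBrownianKernel a b k) (hp : a ≤ p) (hpp : p < p')
    (hpq : p' ≤ q') (hqq : q' < q) (hq : q ≤ b) {x : ℝ} (hx : x ∈ Icc a b) (hx' : x ∉ Ioo p q) :
    inner ℝ (k x) (trapezoid k p p' q' q) = 0 := by
  rw [inner_trapezoid hk hp hpp hpq hqq hq hx]
  by_cases h : x ≤ p
  · rw [min_eq_left h, min_eq_left (by linarith), min_eq_left (by linarith),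
      min_eq_left (by linarith)]
    ring
  · have h2 : q ≤ x := not_lt.1 fun h2 => hx' ⟨not_le.1 h, h2⟩
    rw [min_eq_right (by linarith), min_eq_right (by linarith), min_eq_right (by linarith),
      min_eq_right (by linarith), inv_mul_cancel₀ (sub_pos.2 hpp).ne',
      inv_mul_cancel₀ (sub_pos.2 hqq).ne', sub_self]

theorem inner_trapezoid_eq_one (hk : IsBrownianKernel a b k) (hp : a ≤ p) (hpp : p < p')
    (hpq : p' ≤ q') (hqq : q' < q) (hq : q ≤ b) {x : ℝ} (hx : x ∈ Icc p' q') :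
    inner ℝ (k x) (trapezoid k p p' q' q) = 1 := by
  rw [inner_trapezoid hk hp hpp hpq hqq hq ⟨by linarith [hx.1], by linarith [hx.2]⟩,
    min_eq_right hx.1, min_eq_right (hpp.le.trans hx.1), min_eq_left (hx.2.trans hqq.le),
    min_eq_left hx.2, inv_mul_cancel₀ (sub_pos.2 hpp).ne']
  ring

/-- This is the energy of the function: a flank of width d has slope of modulus 1/d. It is computed
from the values 1 and 0 at the corners, as the vector is a combination of `k` at these points. -/
theorem norm_sq_trapezoid (hk : IsBrownianKernel a b k) (hp : a ≤ p) (hpp : p < p')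
    (hpq : p' ≤ q') (hqq : q' < q) (hq : q ≤ b) :
    ‖trapezoid k p p' q' q‖ ^ 2 = (p' - p)⁻¹ + (q - q')⁻¹ := by
  rw [← real_inner_self_eq_norm_sq]
  conv_lhs => arg 2; rw [trapezoid]
  rw [inner_sub_left, inner_smul_left, inner_smul_left, inner_sub_left, inner_sub_left,
    inner_trapezoid_eq_one hk hp hpp hpq hqq hq (left_mem_Icc.2 hpq),
    inner_trapezoid_eq_one hk hp hpp hpq hqq hq (right_mem_Icc.2 hpq),
    inner_trapezoid_eq_zero hk hp hpp hpq hqq hq ⟨hp, by linarith⟩ (fun h => lt_irrefl _ h.1),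
    inner_trapezoid_eq_zero hk hp hpp hpq hqq hq ⟨by linarith, hq⟩ (fun h => lt_irrefl _ h.2)]
  simp

/-- One trapezoid is a combination of values of `k` at points where the other one vanishes. -/
theorem inner_trapezoid_trapezoid (hk : IsBrownianKernel a b k) (hp : a ≤ p) (hpp : p < p')
    (hpq : p' ≤ q') (hqq : q' < q) (hq : q ≤ b) {r r' s' s : ℝ} (hr : a ≤ r) (hrr : r < r')
    (hrs : r' ≤ s') (hss : s' < s) (hs : s ≤ b) (hd : Disjoint (Ioo p q) (Ioo r s)) :
    inner ℝ (trapezoid k r r' s' s) (trapezoid k p p' q' q) = 0 := by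
  have hsep : s ≤ p ∨ q ≤ r := by
    rw [Ioo_disjoint_Ioo] at hd
    rcases min_le_iff.1 hd with h | h <;> rcases le_max_iff.1 h with h | h
    · linarith
    · exact Or.inr h
    · exact Or.inl h
    · linarith
  have hz : ∀ x ∈ Icc r s, inner ℝ (k x) (trapezoid k p p' q' q) = 0 := fun x hx =>
    inner_trapezoid_eq_zero hk hp hpp hpq hqq hq ⟨hr.trans hx.1, hx.2.trans hs⟩ fun h => by
      rcases hsep with h' | h'
      · linarith [hx.2, h.1]
      · linarith [hx.1, h.2]
  conv_lhs => arg 2; rw [trapezoid]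
  rw [inner_sub_left, inner_smul_left, inner_smul_left, inner_sub_left, inner_sub_left,
    hz _ ⟨by linarith, by linarith⟩, hz _ ⟨by linarith, by linarith⟩,
    hz _ ⟨by linarith, by linarith⟩, hz _ ⟨by linarith, by linarith⟩]
  simp

end Trapezoid

/-- The linear combinations of trapezoids in disjoint intervals. -/
theorem exists_testSpace (hμ : μ (Icc a b)ᶜ = 0) {k : ℝ → H} (hk : IsBrownianKernel a b k)
    {ι : Type*} [Fintype ι] {p p' q' q : ι → ℝ} (hp : ∀ i, a ≤ p i)
    (hpp : ∀ i, p i < p' i) (hpq : ∀ i, p' i ≤ q' i) (hqq : ∀ i, q' i < q i) (hq : ∀ i, q i ≤ b)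
    (hdisj : Pairwise fun i j => Disjoint (Ioo (p i) (q i)) (Ioo (p j) (q j))) {t : ℝ} (ht : 0 < t)
    (hE : ∀ i, (p' i - p i)⁻¹ + (q i - q' i)⁻¹ < t * μ.real (Icc (p' i) (q' i))) :
    ∃ U : Submodule ℝ H, FiniteDimensional ℝ U ∧ Module.finrank ℝ U = Fintype.card ι ∧
      (∀ u ∈ U, inner ℝ (k a) u = 0 ∧ inner ℝ (k b) u = 0) ∧
      ∀ u ∈ U, u ≠ 0 → ‖u‖ ^ 2 < t * ∫ x, inner ℝ (k x) u * inner ℝ (k x) u ∂μ := by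
  classical
  have hae : ∀ᵐ x ∂μ, x ∈ Icc a b := by rw [ae_iff]; exact hμ
  let h : ι → H := fun i => trapezoid k (p i) (p' i) (q' i) (q i)
  have hnorm : ∀ i, ‖h i‖ ^ 2 = (p' i - p i)⁻¹ + (q i - q' i)⁻¹ := fun i =>
    norm_sq_trapezoid hk (hp i) (hpp i) (hpq i) (hqq i) (hq i)
  have hpos : ∀ i, 0 < ‖h i‖ ^ 2 := fun i => by
    rw [hnorm i]
    exact add_pos (inv_pos.2 (sub_pos.2 (hpp i))) (inv_pos.2 (sub_pos.2 (hqq i)))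
  have horth : ∀ i j, i ≠ j → inner ℝ (h i) (h j) = 0 := fun i j hij =>
    inner_trapezoid_trapezoid hk (hp j) (hpp j) (hpq j) (hqq j) (hq j) (hp i) (hpp i) (hpq i)
      (hqq i) (hq i) (hdisj hij.symm)
  have hli : LinearIndependent ℝ h := linearIndependent_of_ne_zero_of_inner_eq_zero
    (fun i hi => by have := hpos i; simp [hi] at this) (fun i j hij => horth i j hij)
  refine ⟨Submodule.span ℝ (range h), FiniteDimensional.span_of_finite ℝ (finite_range h),
    finrank_span_eq_card hli, ?_, ?_⟩
  · intro u hu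
    induction hu using Submodule.span_induction with
    | mem x hx =>
      obtain ⟨i, rfl⟩ := hx
      have hpi := hp i; have hppi := hpp i; have hpqi := hpq i; have hqqi := hqq i
      have hqi := hq i
      exact ⟨inner_trapezoid_eq_zero hk hpi hppi hpqi hqqi hqi ⟨le_rfl, by linarith⟩
          (fun h => by linarith [h.1]),
        inner_trapezoid_eq_zero hk hpi hppi hpqi hqqi hqi ⟨by linarith, le_rfl⟩
          (fun h => by linarith [h.2])⟩
    | zero => simp
    | add x y _ _ hx hy => simp [inner_add_right, hx, hy]
    | smul c x _ hx => simp [inner_smul_right, hx]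
  · intro u hu hu0
    obtain ⟨c, rfl⟩ := (Submodule.mem_span_range_iff_exists_fun ℝ).1 hu
    have hnormsum : ‖∑ i, c i • h i‖ ^ 2 = ∑ i, c i ^ 2 * ‖h i‖ ^ 2 := by
      rw [← real_inner_self_eq_norm_sq, sum_inner]
      refine Finset.sum_congr rfl fun i _ => ?_
      rw [inner_sum, Finset.sum_eq_single i]
      · rw [inner_smul_left, inner_smul_right, real_inner_self_eq_norm_sq]; simp; ring
      · intro j _ hji
        rw [inner_smul_left, inner_smul_right, horth i j hji.symm]; simp
      · simp
    set v : ℝ → ℝ := fun x => inner ℝ (k x) (∑ i, c i • h i) with hv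
    have hvsum : ∀ x, v x = ∑ i, c i * inner ℝ (k x) (h i) := fun x => by
      simp only [hv, inner_sum, inner_smul_right]
    -- A point lies on at most one plateau, where all other trapezoids vanish; off the plateaus
    -- nonnegativity of the square is enough.
    have hpt : ∀ x ∈ Icc a b,
        ∑ i, (Icc (p' i) (q' i)).indicator (fun _ => c i ^ 2) x ≤ v x * v x := by
      intro x hx
      by_cases hex : ∃ i, x ∈ Icc (p' i) (q' i)
      · obtain ⟨i, hi⟩ := hex
        have hxi : x ∈ Ioo (p i) (q i) := ⟨(hpp i).trans_le hi.1, hi.2.trans_lt (hqq i)⟩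
        have hother : ∀ j, j ≠ i → x ∉ Ioo (p j) (q j) := fun j hj hxj =>
          Set.disjoint_left.1 (hdisj hj) hxj hxi
        have h1 : v x = c i := by
          rw [hvsum, Finset.sum_eq_single i]
          · rw [inner_trapezoid_eq_one hk (hp i) (hpp i) (hpq i) (hqq i) (hq i) hi, mul_one]
          · intro j _ hj
            rw [inner_trapezoid_eq_zero hk (hp j) (hpp j) (hpq j) (hqq j) (hq j) hx (hother j hj),
              mul_zero]
          · simp
        rw [h1, Finset.sum_eq_single i]
        · rw [indicator_of_mem hi, sq]
        · intro j _ hj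
          refine indicator_of_notMem (fun hxj => hother j hj ?_) _
          exact ⟨(hpp j).trans_le hxj.1, hxj.2.trans_lt (hqq j)⟩
        · simp
      · push Not at hex
        rw [Finset.sum_eq_zero fun i _ => indicator_of_notMem (hex i) _]
        exact mul_self_nonneg _
    have hint : ∀ i ∈ Finset.univ,
        Integrable ((Icc (p' i) (q' i)).indicator fun _ => c i ^ 2) μ :=
      fun i _ => (integrable_const _).indicator measurableSet_Icc
    have hvc : Continuous v := hk.continuous.inner continuous_const
    have hvint : Integrable (fun x => v x * v x) μ := by
      obtain ⟨M, hM⟩ := isCompact_Icc.exists_bound_of_continuousOn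
        ((hvc.mul hvc).continuousOn (s := Icc a b))
      exact Integrable.of_bound (hvc.mul hvc).aestronglyMeasurable M (hae.mono hM)
    have hlow : ∑ i, c i ^ 2 * μ.real (Icc (p' i) (q' i)) ≤ ∫ x, v x * v x ∂μ := by
      have h1 : ∫ x, ∑ i, (Icc (p' i) (q' i)).indicator (fun _ => c i ^ 2) x ∂μ =
          ∑ i, c i ^ 2 * μ.real (Icc (p' i) (q' i)) := by
        rw [integral_finsetSum _ hint]
        refine Finset.sum_congr rfl fun i _ => ?_
        rw [integral_indicator measurableSet_Icc, setIntegral_const, smul_eq_mul, mul_comm]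
      rw [← h1]
      exact integral_mono_ae (integrable_finsetSum _ hint) hvint (hae.mono hpt)
    have hc : ∃ i, c i ≠ 0 := by
      by_contra! hc
      exact hu0 (by simp [hc])
    obtain ⟨i₀, hi₀⟩ := hc
    rw [hnormsum]
    refine lt_of_lt_of_le ?_ (mul_le_mul_of_nonneg_left hlow ht.le)
    rw [Finset.mul_sum]
    refine Finset.sum_lt_sum (fun i _ => ?_) ⟨i₀, Finset.mem_univ _, ?_⟩
    · rw [hnorm i, mul_left_comm]
      exact mul_le_mul_of_nonneg_left (hE i).le (sq_nonneg _)
    · rw [hnorm i₀, mul_left_comm]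
      exact mul_lt_mul_of_pos_left (hE i₀) (by positivity)

variable {ι : Type*} [Fintype ι] {p p' q' q : ι → ℝ} {t : ℝ}

/-- **Lower bound for the Dirichlet eigenvalue counting function.** -/
theorem card_le_countD [NullSingletonClass μ] (hab : a < b) (hμ : μ (Icc a b)ᶜ = 0) (hp : ∀ i, a ≤ p i)
    (hpp : ∀ i, p i < p' i) (hpq : ∀ i, p' i ≤ q' i) (hqq : ∀ i, q' i < q i) (hq : ∀ i, q i ≤ b)
    (hdisj : Pairwise fun i j => Disjoint (Ioo (p i) (q i)) (Ioo (p j) (q j))) (ht : 0 < t)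
    (hE : ∀ i, (p' i - p i)⁻¹ + (q i - q' i)⁻¹ < t * μ.real (Icc (p' i) (q' i)))
    [FiniteDimensional ℝ (Submodule.span ℝ
      {φ : Lp ℝ 2 μ | ∃ lam ≤ t, SolvesEigen a b (DirichletBC a b) μ lam φ})] :
    Fintype.card ι ≤ countD a b μ t := by
  have hae : ∀ᵐ x ∂μ, x ∈ Icc a b := by rw [ae_iff]; exact hμ
  obtain ⟨k, hk⟩ := exists_isBrownianKernel a b
  obtain ⟨U, _, hcard, hUab, hU⟩ := exists_testSpace hμ hk hp hpp hpq hqq hq hdisj ht hE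
  have hL : 0 < b - a := sub_pos.2 hab
  let π : ℝ → ℝ := fun x => (max a (min b x) - a) / (b - a)
  have hπ : ∀ x ∈ Icc a b, π x = (x - a) / (b - a) := fun x hx => by
    simp only [π]; rw [min_eq_right hx.2, max_eq_right hx.1]
  -- On `Icc a b` this removes the component along `k b`: Brownian motion becomes the Brownian
  -- bridge, whose covariance is the Green function of the Dirichlet problem.
  let κ : ℝ → Lp ℝ 2 (volume : Measure ℝ) := fun x => k x - π x • k b
  have hπc : Continuous π := by simp only [π]; fun_prop
  have hκ : Continuous κ := hk.continuous.sub (hπc.smul continuous_const)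
  have hC : ∀ x, ‖κ x‖ ≤ √(b - a) + 1 * √(b - a) := by
    intro x
    refine (norm_sub_le _ _).trans (add_le_add (hk.norm_le hab x) ?_)
    rw [norm_smul]
    refine mul_le_mul ?_ (hk.norm_le hab b) (norm_nonneg _) zero_le_one
    have h1 : max a (min b x) ≤ b := max_le hab.le (min_le_left _ _)
    have h2 : a ≤ max a (min b x) := le_max_left _ _
    rw [Real.norm_of_nonneg (div_nonneg (sub_nonneg.2 h2) hL.le), div_le_one hL]
    linarith
  have hka : k a = 0 := by
    have := hk.inner_eq (left_mem_Icc.2 hab.le) (left_mem_Icc.2 hab.le)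
    rwa [min_self, sub_self, inner_self_eq_zero] at this
  rw [← hcard]
  refine finrank_le_eigenCount hκ hC ?_ ht U ?_
  · intro θ hθ h hh
    set f : ℝ → ℝ := fun x => inner ℝ (κ x) h with hf
    have hfi : Integrable f μ := integrable_of_continuous_bounded (hκ.inner continuous_const)
      (fun x => (norm_inner_le_norm _ _).trans
        (mul_le_mul_of_nonneg_right (hC x) (norm_nonneg h)))
    have hmin : ∀ x ∈ Icc a b, Integrable (fun y => (min x y - a) * f y) μ := by
      intro x hx
      refine hfi.bdd_mul (c := b - a)
        ((continuous_const.min continuous_id).sub continuous_const).aestronglyMeasurable ?_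
      filter_upwards [hae] with y hy
      rw [Real.norm_of_nonneg (sub_nonneg.2 (le_min hx.1 hy.1))]
      simp only [sub_le_sub_iff_right]
      exact (min_le_right _ _).trans hy.2
    have hidi : Integrable (fun y => (y - a) * f y) μ := by
      refine (hmin b (right_mem_Icc.2 hab.le)).congr ?_
      filter_upwards [hae] with y hy
      rw [min_eq_right hy.2]
    have heq : ∀ x ∈ Icc a b, θ * f x =
        (∫ y, (min x y - a) * f y ∂μ) - ((∫ y, (y - a) * f y ∂μ) / (b - a)) * (x - a) + 0 := by
      intro x hx
      have h1 : θ * f x = ∫ y, f y * inner ℝ (κ x) (κ y) ∂μ := by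
        rw [hf, ← inner_smul_right, ← hh, real_inner_comm, inner_featureOp hκ hC]
        simp_rw [real_inner_comm (κ x)]
      rw [h1]
      have h2 : ∀ y ∈ Icc a b, f y * inner ℝ (κ x) (κ y) =
          (min x y - a) * f y - (x - a) / (b - a) * ((y - a) * f y) := by
        intro y hy
        have hb : b ∈ Icc a b := right_mem_Icc.2 hab.le
        simp only [κ, inner_sub_left, inner_sub_right, inner_smul_left, inner_smul_right,
          conj_trivial]
        rw [hk.inner_eq hx hy, hk.inner_eq hx hb, hk.inner_eq hb hy, hk.inner_eq hb hb, min_self,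
          min_eq_left hx.2, min_eq_right hy.2, hπ x hx, hπ y hy]
        field_simp
        ring
      rw [integral_congr_ae (hae.mono h2), integral_sub (hmin x hx) (hidi.const_mul _),
        integral_const_mul]
      ring
    obtain ⟨F, g, hFg, hFf, hg, -⟩ := exists_kreinFeller_of_integral_eq hab hμ hfi hθ heq
    refine ⟨F, g, hFg, ⟨?_, ?_⟩, ?_, .of_forall hg⟩
    · have ha : a ∈ Icc a b := left_mem_Icc.2 hab.le
      rw [hFf a ha]
      simp only [hf, κ]
      rw [hπ a ha, hka]; simp
    · have hb : b ∈ Icc a b := right_mem_Icc.2 hab.le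
      rw [hFf b hb]
      simp only [hf, κ]
      rw [hπ b hb, div_self hL.ne']; simp
    · filter_upwards [featureMap_coeFn hκ hC μ h, hae] with x h1 h2
      rw [h1, hFf x h2]
  · intro u hu hu0
    -- Test vectors are orthogonal to `k b`, so they represent the same function with `κ` as with
    -- `k`.
    have h1 : ∀ x, inner ℝ (κ x) u = inner ℝ (k x) u := fun x => by
      simp only [κ, inner_sub_left, inner_smul_left, (hUab u hu).2]; simp
    simp_rw [h1]
    exact hU u hu hu0

/-- **Lower bound for the Neumann eigenvalue counting function.** -/
theorem card_le_countN [NullSingletonClass μ] (hab : a < b) (hμ : μ (Icc a b)ᶜ = 0) (hp : ∀ i, a ≤ p i)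
    (hpp : ∀ i, p i < p' i) (hpq : ∀ i, p' i ≤ q' i) (hqq : ∀ i, q' i < q i) (hq : ∀ i, q i ≤ b)
    (hdisj : Pairwise fun i j => Disjoint (Ioo (p i) (q i)) (Ioo (p j) (q j))) (ht : 0 < t)
    (hE : ∀ i, (p' i - p i)⁻¹ + (q i - q' i)⁻¹ < t * μ.real (Icc (p' i) (q' i)))
    [FiniteDimensional ℝ (Submodule.span ℝ
      {φ : Lp ℝ 2 μ | ∃ lam ≤ t, SolvesEigen a b (NeumannBC a b) μ lam φ})] :
    Fintype.card ι ≤ countN a b μ t + 1 := by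
  have hae : ∀ᵐ x ∂μ, x ∈ Icc a b := by rw [ae_iff]; exact hμ
  have haeIoc : ∀ᵐ y ∂μ, y ∈ Ioc a b := by
    filter_upwards [hae, measure_eq_zero_iff_ae_notMem.1 (measure_singleton (μ := μ) a)]
      with y h1 h2
    exact ⟨lt_of_le_of_ne h1.1 fun h => h2 (by simp [h]), h1.2⟩
  obtain ⟨k, hk⟩ := exists_isBrownianKernel a b
  obtain ⟨U, _, hcard, hUab, hU⟩ := exists_testSpace hμ hk hp hpp hpq hqq hq hdisj ht hE
  have hki : Integrable k μ :=
    Integrable.of_bound hk.continuous.aestronglyMeasurable _ (.of_forall fun x => hk.norm_le hab x)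
  set K : Lp ℝ 2 (volume : Measure ℝ) := ∫ y, k y ∂μ with hK
  -- Centring makes all represented functions have mean zero, which yields the Neumann condition at
  -- `a`; at `b` it holds because no linear term occurs in the integral equation.
  let κ : ℝ → Lp ℝ 2 (volume : Measure ℝ) := fun x => k x - K
  have hκ : Continuous κ := hk.continuous.sub continuous_const
  have hC : ∀ x, ‖κ x‖ ≤ √(b - a) + ‖K‖ := fun x =>
    (norm_sub_le _ _).trans (add_le_add (hk.norm_le hab x) le_rfl)
  have hκi : Integrable κ μ := hki.sub (integrable_const _)
  have hκ0 : ∫ y, κ y ∂μ = 0 := by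
    simp only [κ]
    rw [integral_sub hki (integrable_const _), integral_const]; simp [hK]
  -- Only vectors orthogonal to `K` represent the same function before and after centring. This
  -- costs at most one dimension and causes the `+ 1`.
  let U' : Submodule ℝ U := LinearMap.ker ((innerSL ℝ K : _ →ₗ[ℝ] ℝ) ∘ₗ U.subtype)
  have hU' : Fintype.card ι ≤ Module.finrank ℝ (U'.map U.subtype) + 1 := by
    have h1 := LinearMap.finrank_range_add_finrank_ker ((innerSL ℝ K : _ →ₗ[ℝ] ℝ) ∘ₗ U.subtype)
    have h2 : Module.finrank ℝ (LinearMap.range ((innerSL ℝ K : _ →ₗ[ℝ] ℝ) ∘ₗ U.subtype)) ≤ 1 :=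
      (Submodule.finrank_le _).trans_eq (Module.finrank_self ℝ)
    have h3 : Module.finrank ℝ (U'.map U.subtype) = Module.finrank ℝ U' :=
      (Submodule.equivMapOfInjective U.subtype U.injective_subtype U').finrank_eq.symm
    rw [h3, ← hcard, ← h1]
    simp only [U']
    omega
  refine hU'.trans (Nat.add_le_add_right ?_ 1)
  refine finrank_le_eigenCount hκ hC ?_ ht _ ?_
  · intro θ hθ h hh
    set f : ℝ → ℝ := fun x => inner ℝ (κ x) h with hf
    have hfi : Integrable f μ := integrable_of_continuous_bounded (hκ.inner continuous_const)
      (fun x => (norm_inner_le_norm _ _).trans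
        (mul_le_mul_of_nonneg_right (hC x) (norm_nonneg h)))
    have hf0 : ∫ y, f y ∂μ = 0 := by
      simp only [hf]
      simp_rw [real_inner_comm h]
      rw [integral_inner hκi, hκ0, inner_zero_right]
    have heq : ∀ x ∈ Icc a b, θ * f x =
        (∫ y, (min x y - a) * f y ∂μ) - 0 * (x - a) + -(∫ y, f y * inner ℝ K (κ y) ∂μ) := by
      intro x hx
      have h1 : θ * f x = ∫ y, f y * inner ℝ (κ x) (κ y) ∂μ := by
        rw [hf, ← inner_smul_right, ← hh, real_inner_comm, inner_featureOp hκ hC]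
        simp_rw [real_inner_comm (κ x)]
      have hb : ∀ z, Integrable (fun y => f y * inner ℝ z (κ y)) μ := fun z =>
        hfi.mul_bdd (c := ‖z‖ * (√(b - a) + ‖K‖))
          (continuous_const.inner hκ).aestronglyMeasurable
          (.of_forall fun y => (norm_inner_le_norm _ _).trans
            (mul_le_mul_of_nonneg_left (hC y) (norm_nonneg _)))
      have hb' : Integrable (fun y => f y * inner ℝ (k x) (k y)) μ :=
        hfi.mul_bdd (c := ‖k x‖ * √(b - a))
          (continuous_const.inner hk.continuous).aestronglyMeasurable
          (.of_forall fun y => (norm_inner_le_norm _ _).trans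
            (mul_le_mul_of_nonneg_left (hk.norm_le hab y) (norm_nonneg _)))
      have h2 : ∀ y, f y * inner ℝ (κ x) (κ y) =
          f y * inner ℝ (k x) (k y) - inner ℝ (k x) K * f y - f y * inner ℝ K (κ y) := by
        intro y
        simp only [κ, inner_sub_left, inner_sub_right]
        ring
      simp_rw [h1, h2]
      have hbf : Integrable (fun y => f y * inner ℝ (k x) (k y) - inner ℝ (k x) K * f y) μ :=
        hb'.sub (hfi.const_mul _)
      rw [integral_sub hbf (hb K), integral_sub hb' (hfi.const_mul _),
        integral_const_mul, hf0]
      have h3 : ∫ y, f y * inner ℝ (k x) (k y) ∂μ = ∫ y, (min x y - a) * f y ∂μ := by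
        refine integral_congr_ae ?_
        filter_upwards [hae] with y hy
        rw [hk.inner_eq hx hy, mul_comm]
      rw [h3]; ring
    obtain ⟨F, g, hFg, hFf, hg, hdF⟩ := exists_kreinFeller_of_integral_eq hab hμ hfi hθ heq
    refine ⟨F, g, hFg, ⟨?_, ?_⟩, ?_, .of_forall hg⟩
    · rw [hdF a (left_mem_Icc.2 hab.le), hf0]; simp
    · rw [hdF b (right_mem_Icc.2 hab.le), intervalIntegral.integral_of_le hab.le,
        Measure.restrict_eq_self_of_ae_mem haeIoc]
      simp
    · filter_upwards [featureMap_coeFn hκ hC μ h, hae] with x h1 h2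
      rw [h1, hFf x h2]
  · rintro u ⟨⟨v, hv⟩, hvU', rfl⟩ hu0
    have hK0 : inner ℝ K v = 0 := hvU'
    have h1 : ∀ x, inner ℝ (κ x) v = inner ℝ (k x) v := fun x => by
      simp only [κ, inner_sub_left, hK0, sub_zero]
    simp only [Submodule.subtype_apply, h1]
    exact hU v hv hu0

end LowerBound
end VCantor
end

noncomputable section

namespace VCantor

/-! ### Weights, level sums and cuts of a tree -/

section TreeSums

variable {J : Type*} {V : ℕ} {a b : ℝ} (F : IFSFamily J a b)

/-- Uniform bounds for the data of the family. -/
structure IFSFamily.Bounds (F : IFSFamily J a b) (M : ℕ) (lo hi : ℝ) : Prop where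
  lo_pos : 0 < lo
  hi_lt : hi < 1
  N_le : ∀ j, F.N j ≤ M
  lo_le_m : ∀ j, ∀ i < F.N j, lo ≤ F.m j i
  m_le_hi : ∀ j, ∀ i < F.N j, F.m j i ≤ hi
  lo_le_r : ∀ j, ∀ i < F.N j, lo ≤ F.r j i
  r_le_hi : ∀ j, ∀ i < F.N j, F.r j i ≤ hi

/-- The number `m_w r_w`. -/
def weight (ω : VTree J V) (w : List ℕ) : ℝ := prodAlong F.m ω w * prodAlong F.r ω w

@[simp] theorem weight_nil (ω : VTree J V) : weight F ω [] = 1 := by simp [weight, prodAlong]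

theorem weight_cons (ω : VTree J V) (i : ℕ) (w : List ℕ) :
    weight F ω (i :: w) = F.m ω.index i * F.r ω.index i * weight F (ω.sub i) w := by
  simp only [weight, prodAlong]; ring

/-- The subtree rooted at an individual. -/
def subAlong : VTree J V → List ℕ → VTree J V
  | ω, [] => ω
  | ω, i :: w => subAlong (ω.sub i) w

theorem subAlong_snd (w : List ℕ) : ∀ ω : VTree J V,
    (subAlong ω w).2 = fun k => ω.2 (k + w.length) := by
  induction w with
  | nil => intro ω; rfl
  | cons i w ih =>
    intro ω
    rw [subAlong, ih]
    funext k
    simp only [VTree.sub, List.length_cons]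
    congr 1

theorem mem_generation_succ {ω : VTree J V} {n : ℕ} {w : List ℕ} :
    w ∈ generation F ω (n + 1) ↔
      ∃ i < F.N ω.index, ∃ u ∈ generation F (ω.sub i) n, i :: u = w := by
  simp [generation]

theorem IFSFamily.mul_pos (j : J) {i : ℕ} (hi : i < F.N j) : 0 < F.m j i * F.r j i :=
  _root_.mul_pos (F.m_pos j i hi) (F.r_mem j i hi).1

theorem weight_pos {n : ℕ} : ∀ {ω : VTree J V} {w : List ℕ},
    w ∈ generation F ω n → 0 < weight F ω w := by
  induction n with
  | zero => intro ω w hw; simp [generation] at hw; simp [hw]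
  | succ n ih =>
    intro ω w hw
    obtain ⟨i, hi, u, hu, rfl⟩ := (mem_generation_succ F).1 hw
    rw [weight_cons]
    exact _root_.mul_pos (F.mul_pos _ hi) (ih hu)

/-- The sum of `(m_w r_w)^x` over the `n`-th generation. -/
def levelSum (x : ℝ) (n : ℕ) (ω : VTree J V) : ℝ :=
  ∑ w ∈ generation F ω n, weight F ω w ^ x

@[simp] theorem levelSum_zero (x : ℝ) (ω : VTree J V) : levelSum F x 0 ω = 1 := by
  simp [levelSum, generation]

theorem levelSum_succ (x : ℝ) (n : ℕ) (ω : VTree J V) :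
    levelSum F x (n + 1) ω = ∑ i ∈ Finset.range (F.N ω.index),
      (F.m ω.index i * F.r ω.index i) ^ x * levelSum F x n (ω.sub i) := by
  rw [levelSum, sum_generation_succ]
  refine Finset.sum_congr rfl fun i hi => ?_
  rw [levelSum, Finset.mul_sum]
  refine Finset.sum_congr rfl fun w hw => ?_
  rw [weight_cons, Real.mul_rpow (F.mul_pos _ (Finset.mem_range.1 hi)).le (weight_pos F hw).le]

theorem levelSum_pos (x : ℝ) (n : ℕ) : ∀ ω : VTree J V, 0 < levelSum F x n ω := by
  induction n with
  | zero => intro ω; simp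
  | succ n ih =>
    intro ω
    rw [levelSum_succ]
    refine Finset.sum_pos (fun i hi => ?_)
      ⟨0, Finset.mem_range.2 (zero_lt_two.trans_le (F.two_le_N _))⟩
    exact _root_.mul_pos (Real.rpow_pos_of_pos (F.mul_pos _ (Finset.mem_range.1 hi)) _) (ih _)

theorem levelSum_add (x : ℝ) (p n : ℕ) : ∀ ω : VTree J V, levelSum F x (p + n) ω =
    ∑ w ∈ generation F ω p, weight F ω w ^ x * levelSum F x n (subAlong ω w) := by
  induction p with
  | zero => intro ω; simp [generation, subAlong]
  | succ p ih =>
    intro ω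
    rw [add_right_comm, levelSum_succ, sum_generation_succ]
    refine Finset.sum_congr rfl fun i hi => ?_
    rw [ih, Finset.mul_sum]
    refine Finset.sum_congr rfl fun w hw => ?_
    rw [weight_cons, Real.mul_rpow (F.mul_pos _ (Finset.mem_range.1 hi)).le (weight_pos F hw).le,
      subAlong, mul_assoc]

section Bounds

variable {F} {M : ℕ} {lo hi : ℝ} (hF : F.Bounds M lo hi)
include hF

theorem IFSFamily.Bounds.lo_le_hi (ω : VTree J V) : lo ≤ hi :=
  (hF.lo_le_m ω.index 0 (zero_lt_two.trans_le (F.two_le_N _))).trans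
    (hF.m_le_hi ω.index 0 (zero_lt_two.trans_le (F.two_le_N _)))

theorem IFSFamily.Bounds.hi_pos (ω : VTree J V) : 0 < hi := hF.lo_pos.trans_le (hF.lo_le_hi ω)

theorem IFSFamily.Bounds.lo_sq_le (j : J) {i : ℕ} (hi' : i < F.N j) :
    lo ^ 2 ≤ F.m j i * F.r j i := by
  rw [sq]
  exact mul_le_mul (hF.lo_le_m j i hi') (hF.lo_le_r j i hi') hF.lo_pos.le (F.m_pos j i hi').le

theorem IFSFamily.Bounds.le_hi_sq (j : J) {i : ℕ} (hi' : i < F.N j) :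
    F.m j i * F.r j i ≤ hi ^ 2 := by
  rw [sq]
  exact mul_le_mul (hF.m_le_hi j i hi') (hF.r_le_hi j i hi') (F.r_mem j i hi').1.le
    ((F.m_pos j i hi').le.trans (hF.m_le_hi j i hi'))

theorem IFSFamily.Bounds.mul_lt_one (j : J) {i : ℕ} (hi' : i < F.N j) :
    F.m j i * F.r j i < 1 := by
  have h1 := (hF.m_le_hi j i hi').trans_lt hF.hi_lt
  exact mul_lt_one_of_nonneg_of_lt_one_left (F.m_pos j i hi').le h1
    (F.r_mem j i hi').2.le

theorem levelSum_le_pow {x : ℝ} (hx : 0 ≤ x) (n : ℕ) :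
    ∀ ω : VTree J V, levelSum F x n ω ≤ (M : ℝ) ^ n := by
  induction n with
  | zero => intro ω; simp
  | succ n ih =>
    intro ω
    rw [levelSum_succ, pow_succ']
    calc _ ≤ ∑ i ∈ Finset.range (F.N ω.index), (1 : ℝ) * (M : ℝ) ^ n := by
          refine Finset.sum_le_sum fun i hi => ?_
          have hi := Finset.mem_range.1 hi
          exact mul_le_mul (Real.rpow_le_one (F.mul_pos _ hi).le (hF.mul_lt_one _ hi).le hx) (ih _)
            (levelSum_pos F x n _).le zero_le_one
      _ = F.N ω.index * (M : ℝ) ^ n := by simp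
      _ ≤ M * (M : ℝ) ^ n := by
          gcongr
          exact hF.N_le _

theorem levelSum_add_le {x : ℝ} (hx : 0 ≤ x) (p n : ℕ) (ω : VTree J V) :
    levelSum F x (p + n) ω ≤ (M : ℝ) ^ n * levelSum F x p ω := by
  rw [levelSum_add, levelSum, Finset.mul_sum]
  refine Finset.sum_le_sum fun w hw => ?_
  rw [mul_comm]
  exact mul_le_mul_of_nonneg_right (levelSum_le_pow hF hx n _)
    (Real.rpow_nonneg (weight_pos F hw).le _)

/-- Each generation contributes at most the factor `(hi ^ 2) ^ (y - x)`. The gain, exponential in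
`n`, gives strict monotonicity of the exponent function and makes sums over all generations
converge. -/
theorem levelSum_le_of_le {x y : ℝ} (hxy : x ≤ y) (n : ℕ) : ∀ ω : VTree J V,
    levelSum F y n ω ≤ ((hi ^ 2) ^ (y - x)) ^ n * levelSum F x n ω := by
  induction n with
  | zero => intro ω; simp
  | succ n ih =>
    intro ω
    rw [levelSum_succ, levelSum_succ, Finset.mul_sum]
    refine Finset.sum_le_sum fun i hi' => ?_
    have hi' := Finset.mem_range.1 hi'
    have h1 : (F.m ω.index i * F.r ω.index i) ^ y ≤
        (hi ^ 2) ^ (y - x) * (F.m ω.index i * F.r ω.index i) ^ x := by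
      have : y = (y - x) + x := by ring
      conv_lhs => rw [this, Real.rpow_add (F.mul_pos _ hi')]
      exact mul_le_mul_of_nonneg_right (Real.rpow_le_rpow (F.mul_pos _ hi').le (hF.le_hi_sq _ hi')
        (sub_nonneg.2 hxy)) (Real.rpow_nonneg (F.mul_pos _ hi').le _)
    refine (mul_le_mul h1 (ih _) (levelSum_pos F y n _).le ?_).trans_eq (by ring)
    exact mul_nonneg (Real.rpow_nonneg (sq_nonneg _) _) (Real.rpow_nonneg (F.mul_pos _ hi').le _)

theorem le_levelSum_of_le {x y : ℝ} (hxy : x ≤ y) (n : ℕ) : ∀ ω : VTree J V,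
    ((lo ^ 2) ^ (y - x)) ^ n * levelSum F x n ω ≤ levelSum F y n ω := by
  induction n with
  | zero => intro ω; simp
  | succ n ih =>
    intro ω
    rw [levelSum_succ, levelSum_succ, Finset.mul_sum]
    refine Finset.sum_le_sum fun i hi => ?_
    have hi := Finset.mem_range.1 hi
    have h1 : (lo ^ 2) ^ (y - x) * (F.m ω.index i * F.r ω.index i) ^ x ≤
        (F.m ω.index i * F.r ω.index i) ^ y := by
      have : y = (y - x) + x := by ring
      conv_rhs => rw [this, Real.rpow_add (F.mul_pos _ hi)]
      exact mul_le_mul_of_nonneg_right (Real.rpow_le_rpow (sq_nonneg _) (hF.lo_sq_le _ hi)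
        (sub_nonneg.2 hxy)) (Real.rpow_nonneg (F.mul_pos _ hi).le _)
    refine Eq.trans_le (by ring) (mul_le_mul h1 (ih _) ?_ ?_)
    · exact mul_nonneg (pow_nonneg (Real.rpow_nonneg (sq_nonneg _) _) _) (levelSum_pos F x n _).le
    · exact Real.rpow_nonneg (F.mul_pos _ hi).le _

/-- At exponent one the numbers `m` sum to one and only the contraction by `r` remains. This makes
the exponent function negative at one. -/
theorem levelSum_one_le (n : ℕ) : ∀ ω : VTree J V, levelSum F 1 n ω ≤ hi ^ n := by
  induction n with
  | zero => intro ω; simp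
  | succ n ih =>
    intro ω
    have hpos := hF.hi_pos ω
    rw [levelSum_succ, pow_succ']
    calc _ ≤ ∑ i ∈ Finset.range (F.N ω.index), F.m ω.index i * (hi * hi ^ n) := by
          refine Finset.sum_le_sum fun i hi' => ?_
          have hi' := Finset.mem_range.1 hi'
          rw [Real.rpow_one, mul_assoc]
          refine mul_le_mul_of_nonneg_left ?_ (F.m_pos _ _ hi').le
          exact mul_le_mul (hF.r_le_hi _ _ hi') (ih _) (levelSum_pos F 1 n _).le hpos.le
      _ = hi * hi ^ n := by rw [← Finset.sum_mul, F.m_sum, one_mul]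

end Bounds

/-- At exponent zero the sum counts individuals. This makes the exponent function positive near
zero. -/
theorem two_pow_le_levelSum_zero (n : ℕ) : ∀ ω : VTree J V, 2 ^ n ≤ levelSum F 0 n ω := by
  induction n with
  | zero => intro ω; simp
  | succ n ih =>
    intro ω
    rw [levelSum_succ, pow_succ']
    calc (2 : ℝ) * 2 ^ n ≤ F.N ω.index * 2 ^ n := by
          gcongr
          exact_mod_cast F.two_le_N _
      _ = ∑ i ∈ Finset.range (F.N ω.index), (2 : ℝ) ^ n := by simp
      _ ≤ _ := by
          refine Finset.sum_le_sum fun i _ => ?_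
          rw [Real.rpow_zero, one_mul]
          exact ih _

/-! ### Cuts -/

/-- The sets of individuals which are the leaves of a finite subtree in which every individual has
all or none of its children. -/
inductive IsCut : VTree J V → Finset (List ℕ) → Prop
  | root (ω : VTree J V) : IsCut ω {[]}
  | node (ω : VTree J V) (A : ℕ → Finset (List ℕ))
      (h : ∀ i < F.N ω.index, IsCut (ω.sub i) (A i)) :
      IsCut ω ((Finset.range (F.N ω.index)).biUnion fun i =>
        (A i).map ⟨List.cons i, List.cons_injective⟩)

theorem sum_biUnion_map_cons {R : Type*} [AddCommMonoid R] (n : ℕ) (A : ℕ → Finset (List ℕ))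
    (h : List ℕ → R) :
    ∑ w ∈ (Finset.range n).biUnion fun i => (A i).map ⟨List.cons i, List.cons_injective⟩, h w =
      ∑ i ∈ Finset.range n, ∑ w ∈ A i, h (i :: w) := by
  rw [Finset.sum_biUnion]
  · simp
  · intro i _ k _ hik
    rw [Function.onFun, Finset.disjoint_left]
    intro w hw hw'
    simp only [Finset.mem_map, Function.Embedding.coeFn_mk] at hw hw'
    obtain ⟨u, -, rfl⟩ := hw
    obtain ⟨u', -, h'⟩ := hw'
    simp only [List.cons.injEq] at h'
    exact hik h'.1.symm

theorem mem_biUnion_map_cons {n : ℕ} {A : ℕ → Finset (List ℕ)} {w : List ℕ} :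
    w ∈ ((Finset.range n).biUnion fun i => (A i).map ⟨List.cons i, List.cons_injective⟩) ↔
      ∃ i < n, ∃ u ∈ A i, i :: u = w := by
  simp

variable {F}

theorem IsCut.nonempty {ω : VTree J V} {A : Finset (List ℕ)} (hA : IsCut F ω A) : A.Nonempty := by
  induction hA with
  | root ω => exact Finset.singleton_nonempty _
  | node ω A h ih =>
    have h0 : 0 < F.N ω.index := zero_lt_two.trans_le (F.two_le_N _)
    obtain ⟨u, hu⟩ := ih 0 h0
    exact ⟨0 :: u, mem_biUnion_map_cons.2 ⟨0, h0, u, hu, rfl⟩⟩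

theorem IsCut.mem_generation {ω : VTree J V} {A : Finset (List ℕ)} (hA : IsCut F ω A) :
    ∀ w ∈ A, w ∈ generation F ω w.length := by
  induction hA with
  | root ω => intro w hw; rw [Finset.mem_singleton] at hw; simp [hw, generation]
  | node ω A h ih =>
    intro w hw
    obtain ⟨i, hi, u, hu, rfl⟩ := mem_biUnion_map_cons.1 hw
    exact (mem_generation_succ F).2 ⟨i, hi, u, ih i hi u hu, rfl⟩

/-- Sorted by generation, the cut is a union of subsets of generations, and all terms are
nonnegative. -/
theorem IsCut.sum_rpow_le {ω : VTree J V} {A : Finset (List ℕ)} (hA : IsCut F ω A) (x : ℝ) :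
    ∃ K, ∑ w ∈ A, weight F ω w ^ x ≤ ∑ k ∈ Finset.range K, levelSum F x k ω := by
  obtain ⟨K, hK⟩ : ∃ K, ∀ w ∈ A, w.length < K :=
    ⟨A.sup List.length + 1, fun w hw => Nat.lt_succ_of_le (Finset.le_sup (f := List.length) hw)⟩
  refine ⟨K, ?_⟩
  rw [← Finset.sum_fiberwise_of_maps_to (t := Finset.range K) (g := List.length)
    (fun w hw => Finset.mem_range.2 (hK w hw))]
  refine Finset.sum_le_sum fun k _ => ?_
  rw [levelSum]
  refine Finset.sum_le_sum_of_subset_of_nonneg (fun w hw => ?_)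
    fun w hw _ => Real.rpow_nonneg (weight_pos F hw).le _
  obtain ⟨hwA, rfl⟩ := Finset.mem_filter.1 hw
  exact hA.mem_generation w hwA

/-- Each individual of generation `n` descends from exactly one member of a cut that does not go
beyond generation `n`. -/
theorem IsCut.sum_mul_levelSum {ω : VTree J V} {A : Finset (List ℕ)} (hA : IsCut F ω A) (x : ℝ) :
    ∀ n, (∀ w ∈ A, w.length ≤ n) →
      ∑ w ∈ A, weight F ω w ^ x * levelSum F x (n - w.length) (subAlong ω w) =
        levelSum F x n ω := by
  induction hA with
  | root ω => intro n _; simp [subAlong]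
  | node ω A h ih =>
    intro n hn
    obtain ⟨u, hu⟩ := (IsCut.node ω A h).nonempty
    obtain ⟨n, rfl⟩ : ∃ n', n = n' + 1 := by
      have := hn u hu
      obtain ⟨i, hi, v, hv, rfl⟩ := mem_biUnion_map_cons.1 hu
      exact Nat.exists_eq_add_one_of_ne_zero (by simp at this; omega)
    rw [sum_biUnion_map_cons, levelSum_succ]
    refine Finset.sum_congr rfl fun i hi => ?_
    have hi := Finset.mem_range.1 hi
    rw [← ih i hi n fun w hw => by
      simpa using hn (i :: w) (mem_biUnion_map_cons.2 ⟨i, hi, w, hw, rfl⟩), Finset.mul_sum]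
    refine Finset.sum_congr rfl fun w hw => ?_
    rw [weight_cons, Real.mul_rpow (F.mul_pos _ hi).le
      (weight_pos F ((h i hi).mem_generation w hw)).le, List.length_cons, Nat.add_sub_add_right,
      subAlong, mul_assoc]

/-- For every threshold there is a cut whose weights are comparable with it. -/
theorem exists_isCut {M : ℕ} {lo hi : ℝ} (hF : F.Bounds M lo hi) (n : ℕ) :
    ∀ (ω : VTree J V) (s : ℝ), (hi ^ 2) ^ n < s → lo ^ 2 * s ≤ 1 →
      ∃ A, IsCut F ω A ∧ ∀ w ∈ A, weight F ω w < s ∧ lo ^ 2 * s ≤ weight F ω w := by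
  induction n with
  | zero =>
    intro ω s hs hs'
    refine ⟨{[]}, .root ω, fun w hw => ?_⟩
    rw [Finset.mem_singleton.1 hw, weight_nil]
    exact ⟨by simpa using hs, hs'⟩
  | succ n ih =>
    intro ω s hs hs'
    have hhi : 0 < hi := hF.hi_pos ω
    -- In the recursion `s` is divided by the weight of the path so far, and a path stops once `s`
    -- exceeds one. The last step lowers the weight by at most the factor `lo ^ 2`, whence the lower
    -- bound.
    by_cases h1 : 1 < s
    · refine ⟨{[]}, .root ω, fun w hw => ?_⟩
      rw [Finset.mem_singleton.1 hw, weight_nil]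
      exact ⟨h1, hs'⟩
    push Not at h1
    have hs0 : 0 < s := lt_of_le_of_lt (by positivity) hs
    have key : ∀ i, ∃ A, i < F.N ω.index → IsCut F (ω.sub i) A ∧ ∀ w ∈ A,
        weight F (ω.sub i) w < s / (F.m ω.index i * F.r ω.index i) ∧
        lo ^ 2 * (s / (F.m ω.index i * F.r ω.index i)) ≤ weight F (ω.sub i) w := by
      intro i
      by_cases hi' : i < F.N ω.index
      · have hq := F.mul_pos _ hi'
        obtain ⟨A, hA⟩ := ih (ω.sub i) (s / (F.m ω.index i * F.r ω.index i)) (by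
          rw [lt_div_iff₀ hq]
          refine lt_of_le_of_lt ?_ hs
          rw [pow_succ]
          exact mul_le_mul_of_nonneg_left (hF.le_hi_sq _ hi') (by positivity)) (by
          rw [← mul_div_assoc, div_le_one hq]
          have := hF.lo_sq_le _ hi'
          nlinarith [sq_nonneg lo])
        exact ⟨A, fun _ => hA⟩
      · exact ⟨∅, fun h => absurd h hi'⟩
    choose A hA using key
    refine ⟨_, .node ω A fun i hi' => (hA i hi').1, fun w hw => ?_⟩
    obtain ⟨i, hi', u, hu, rfl⟩ := mem_biUnion_map_cons.1 hw
    have hq := F.mul_pos _ hi'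
    have := (hA i hi').2 u hu
    rw [weight_cons]
    rw [lt_div_iff₀ hq, ← mul_div_assoc, div_le_iff₀ hq] at this
    exact ⟨by linarith [this.1], by linarith [this.2]⟩

/-! ### Geometry of the cells -/

theorem IFSFamily.map_mono (F : IFSFamily J a b) (j : J) {i : ℕ} (hi : i < F.N j) {x y : ℝ}
    (hxy : x ≤ y) : F.r j i * x + F.c j i ≤ F.r j i * y + F.c j i := by
  have := (F.r_mem j i hi).1
  nlinarith

theorem IFSFamily.map_right_le_map_left (F : IFSFamily J a b) (j : J) {i k : ℕ} (hik : i < k)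
    (hk : k < F.N j) : F.r j i * b + F.c j i ≤ F.r j k * a + F.c j k := by
  induction k, hik using Nat.le_induction with
  | base => exact F.ordered j i hk
  | succ k hik ih =>
    refine (ih (by omega)).trans ?_
    refine (F.map_mono j (by omega) F.a_lt_b.le).trans ?_
    exact F.ordered j k hk

theorem IFSFamily.le_map (F : IFSFamily J a b) (j : J) {i : ℕ} (hi : i < F.N j) :
    a ≤ F.r j i * a + F.c j i := by
  rcases Nat.eq_zero_or_pos i with rfl | h
  · exact (F.first_left j).ge
  · have h0 : 0 < F.N j := zero_lt_two.trans_le (F.two_le_N _)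
    calc a = F.r j 0 * a + F.c j 0 := (F.first_left j).symm
      _ ≤ F.r j 0 * b + F.c j 0 := F.map_mono j h0 F.a_lt_b.le
      _ ≤ _ := F.map_right_le_map_left j h hi

theorem IFSFamily.map_le (F : IFSFamily J a b) (j : J) {i : ℕ} (hi : i < F.N j) :
    F.r j i * b + F.c j i ≤ b := by
  rcases (Nat.le_sub_one_of_lt hi).eq_or_lt with h | h
  · rw [h]; exact (F.last_right j).le
  · have h0 : F.N j - 1 < F.N j := by omega
    calc _ ≤ F.r j (F.N j - 1) * a + F.c j (F.N j - 1) := F.map_right_le_map_left j h h0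
      _ ≤ F.r j (F.N j - 1) * b + F.c j (F.N j - 1) := F.map_mono j h0 F.a_lt_b.le
      _ = b := F.last_right j

theorem IFSFamily.map_mem (F : IFSFamily J a b) (j : J) {i : ℕ} (hi : i < F.N j) {x : ℝ}
    (hx : x ∈ Icc a b) : F.r j i * x + F.c j i ∈ Icc a b :=
  ⟨(F.le_map j hi).trans (F.map_mono j hi hx.1), (F.map_mono j hi hx.2).trans (F.map_le j hi)⟩

theorem mapAlong_sub (w : List ℕ) : ∀ (ω : VTree J V) (x y : ℝ),
    mapAlong F ω w y - mapAlong F ω w x = prodAlong F.r ω w * (y - x) := by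
  induction w with
  | nil => intro ω x y; simp [mapAlong, prodAlong]
  | cons i w ih =>
    intro ω x y
    simp only [mapAlong, prodAlong]
    rw [mul_assoc, ← ih]; ring

theorem prodAlong_r_pos {n : ℕ} : ∀ {ω : VTree J V} {w : List ℕ},
    w ∈ generation F ω n → 0 < prodAlong F.r ω w := by
  induction n with
  | zero => intro ω w hw; simp [generation] at hw; simp [hw, prodAlong]
  | succ n ih =>
    intro ω w hw
    obtain ⟨i, hi, u, hu, rfl⟩ := (mem_generation_succ F).1 hw
    exact _root_.mul_pos (F.r_mem _ _ hi).1 (ih hu)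

theorem mapAlong_mem {n : ℕ} : ∀ {ω : VTree J V} {w : List ℕ}, w ∈ generation F ω n →
    ∀ {x : ℝ}, x ∈ Icc a b → mapAlong F ω w x ∈ Icc a b := by
  induction n with
  | zero => intro ω w hw x hx; simp [generation] at hw; simpa [hw, mapAlong] using hx
  | succ n ih =>
    intro ω w hw x hx
    obtain ⟨i, hi, u, hu, rfl⟩ := (mem_generation_succ F).1 hw
    exact F.map_mem _ hi (ih hu hx)

/-- Two members of a cut separate at some letter; there their cells lie in the ordered cells of two
different children, and the increasing maps along the common path keep the order. -/
theorem IsCut.ordered {ω : VTree J V} {A : Finset (List ℕ)} (hA : IsCut F ω A) :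
    ∀ w ∈ A, ∀ w' ∈ A, w ≠ w' → mapAlong F ω w b ≤ mapAlong F ω w' a ∨
      mapAlong F ω w' b ≤ mapAlong F ω w a := by
  have ha : a ∈ Icc a b := left_mem_Icc.2 F.a_lt_b.le
  have hb : b ∈ Icc a b := right_mem_Icc.2 F.a_lt_b.le
  induction hA with
  | root ω =>
    intro w hw w' hw' hne
    rw [Finset.mem_singleton] at hw hw'
    exact absurd (hw.trans hw'.symm) hne
  | node ω A h ih =>
    intro w hw w' hw' hne
    obtain ⟨i, hi, u, hu, rfl⟩ := mem_biUnion_map_cons.1 hw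
    obtain ⟨i', hi', u', hu', rfl⟩ := mem_biUnion_map_cons.1 hw'
    have hg := (h i hi).mem_generation u hu
    have hg' := (h i' hi').mem_generation u' hu'
    simp only [mapAlong]
    rcases lt_trichotomy i i' with hlt | rfl | hlt
    · left
      calc _ ≤ F.r ω.index i * b + F.c ω.index i := F.map_mono _ hi (mapAlong_mem hg hb).2
        _ ≤ F.r ω.index i' * a + F.c ω.index i' := F.map_right_le_map_left _ hlt hi'
        _ ≤ _ := F.map_mono _ hi' (mapAlong_mem hg' ha).1
    · rcases ih i hi u hu u' hu' (fun he => hne (by rw [he])) with h' | h'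
      · exact Or.inl (F.map_mono _ hi h')
      · exact Or.inr (F.map_mono _ hi h')
    · right
      calc _ ≤ F.r ω.index i' * b + F.c ω.index i' := F.map_mono _ hi' (mapAlong_mem hg' hb).2
        _ ≤ F.r ω.index i * a + F.c ω.index i := F.map_right_le_map_left _ hlt hi
        _ ≤ _ := F.map_mono _ hi (mapAlong_mem hg ha).1

theorem IsCut.disjoint {ω : VTree J V} {A : Finset (List ℕ)} (hA : IsCut F ω A) :
    Pairwise fun w w' : A => Disjoint (Ioo (mapAlong F ω w a) (mapAlong F ω w b))
      (Ioo (mapAlong F ω w' a) (mapAlong F ω w' b)) := by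
  intro w w' hne
  rw [Set.disjoint_left]
  intro x hx hx'
  rcases hA.ordered w w.2 w' w'.2 (fun h => hne (Subtype.ext h)) with h | h
  · linarith [hx.2, hx'.1]
  · linarith [hx.1, hx'.2]

/-- A self-similar family of measures is decomposed by a cut. -/
theorem IsCut.measure_eq {ν : VTree J V → Measure ℝ}
    (hν : ∀ ω (s : Set ℝ), MeasurableSet s → ν ω s = ∑ i ∈ Finset.range (F.N ω.index),
      ENNReal.ofReal (F.m ω.index i) *
        ν (ω.sub i) ((fun x => F.r ω.index i * x + F.c ω.index i) ⁻¹' s))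
    {ω : VTree J V} {A : Finset (List ℕ)} (hA : IsCut F ω A) : ∀ s : Set ℝ, MeasurableSet s →
      ν ω s = ∑ w ∈ A, ENNReal.ofReal (prodAlong F.m ω w) *
        ν (subAlong ω w) (mapAlong F ω w ⁻¹' s) := by
  induction hA with
  | root ω =>
    intro s _
    have : mapAlong F ω [] ⁻¹' s = s := rfl
    simp [prodAlong, subAlong, this]
  | node ω A h ih =>
    intro s hs
    rw [hν ω s hs, sum_biUnion_map_cons]
    refine Finset.sum_congr rfl fun i hi => ?_
    have hi := Finset.mem_range.1 hi
    have hm : Measurable fun x => F.r ω.index i * x + F.c ω.index i := by fun_prop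
    rw [ih i hi _ (hm hs), Finset.mul_sum]
    refine Finset.sum_congr rfl fun w _ => ?_
    rw [← mul_assoc, ← ENNReal.ofReal_mul (F.m_pos _ _ hi).le]
    rfl

end TreeSums
end VCantor
end

noncomputable section

namespace VCantor

/-! ### The Cantor measure: existence, self-similarity, absence of atoms -/

section CantorMeasure

open BoundedContinuousFunction

variable {J : Type*} {V : ℕ} {a b : ℝ} (F : IFSFamily J a b)

theorem approxMeasure_apply (ω : VTree J V) (n : ℕ) {s : Set ℝ} (hs : MeasurableSet s) :
    approxMeasure F ω n s = ∑ w ∈ generation F ω n,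
      ENNReal.ofReal (prodAlong F.m ω w) * unifInterval a b (mapAlong F ω w ⁻¹' s) := by
  rw [approxMeasure, Measure.finsetSum_apply]
  refine Finset.sum_congr rfl fun w _ => ?_
  rw [Measure.smul_apply, Measure.map_apply (measurable_mapAlong F w ω) hs, smul_eq_mul]

/-- The self-similar combination of a family of measures. -/
def selfSimilarSum (ω : VTree J V) (ν : VTree J V → Measure ℝ) : Measure ℝ :=
  ∑ i ∈ Finset.range (F.N ω.index), ENNReal.ofReal (F.m ω.index i) •
    (ν (ω.sub i)).map fun x => F.r ω.index i * x + F.c ω.index i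

theorem selfSimilarSum_apply (ω : VTree J V) (ν : VTree J V → Measure ℝ) {s : Set ℝ}
    (hs : MeasurableSet s) :
    selfSimilarSum F ω ν s = ∑ i ∈ Finset.range (F.N ω.index),
      ENNReal.ofReal (F.m ω.index i) *
        ν (ω.sub i) ((fun x => F.r ω.index i * x + F.c ω.index i) ⁻¹' s) := by
  rw [selfSimilarSum, Measure.finsetSum_apply]
  refine Finset.sum_congr rfl fun w _ => ?_
  rw [Measure.smul_apply, Measure.map_apply (by fun_prop) hs, smul_eq_mul]

theorem approxMeasure_succ (ω : VTree J V) (n : ℕ) :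
    approxMeasure F ω (n + 1) = selfSimilarSum F ω fun ω' => approxMeasure F ω' n := by
  ext s hs
  rw [approxMeasure_apply F ω _ hs, selfSimilarSum_apply F ω _ hs, sum_generation_succ]
  refine Finset.sum_congr rfl fun i hi => ?_
  have hi := Finset.mem_range.1 hi
  have hm : Measurable fun x => F.r ω.index i * x + F.c ω.index i := by fun_prop
  rw [approxMeasure_apply F _ n (hm hs), Finset.mul_sum]
  refine Finset.sum_congr rfl fun w _ => ?_
  rw [← mul_assoc, ← ENNReal.ofReal_mul (F.m_pos _ _ hi).le]
  rfl

theorem integral_selfSimilarSum (ω : VTree J V) (ν : VTree J V → Measure ℝ)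
    [∀ ω, IsProbabilityMeasure (ν ω)] (f : ℝ →ᵇ ℝ) :
    ∫ x, f x ∂(selfSimilarSum F ω ν) = ∑ i ∈ Finset.range (F.N ω.index),
      F.m ω.index i * ∫ x, f (F.r ω.index i * x + F.c ω.index i) ∂(ν (ω.sub i)) := by
  have hm : ∀ i, Measurable fun x => F.r ω.index i * x + F.c ω.index i := fun i => by fun_prop
  rw [selfSimilarSum, integral_finsetSum_measure]
  · refine Finset.sum_congr rfl fun i hi => ?_
    rw [integral_smul_measure, ENNReal.toReal_ofReal (F.m_pos _ _ (Finset.mem_range.1 hi)).le,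
      integral_map (hm i).aemeasurable f.continuous.aestronglyMeasurable, smul_eq_mul]
  · intro i _
    have : IsProbabilityMeasure ((ν (ω.sub i)).map
      fun x => F.r ω.index i * x + F.c ω.index i) :=
      Measure.isProbabilityMeasure_map (hm i).aemeasurable
    exact (f.integrable _).smul_measure ENNReal.ofReal_ne_top

instance (ω : VTree J V) (n : ℕ) : IsProbabilityMeasure (approxMeasure F ω n) :=
  isProbabilityMeasure_approx F ω n

theorem approxMeasure_compl_Icc (ω : VTree J V) (n : ℕ) :
    approxMeasure F ω n (Icc a b)ᶜ = 0 := by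
  rw [approxMeasure_apply F ω n measurableSet_Icc.compl]
  refine Finset.sum_eq_zero fun w hw => ?_
  have h0 : unifInterval a b (Icc a b)ᶜ = 0 := by
    rw [unifInterval, Measure.smul_apply, Measure.restrict_apply measurableSet_Icc.compl]
    simp
  have : unifInterval a b (mapAlong F ω w ⁻¹' (Icc a b)ᶜ) = 0 := by
    refine measure_mono_null (fun x hx => ?_) h0
    exact fun hx' => hx (mapAlong_mem hw hx')
  rw [this, mul_zero]

theorem abs_integral_sub_le {μ : Measure ℝ} [IsProbabilityMeasure μ] (hμ : μ (Icc a b)ᶜ = 0)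
    (f : ℝ →ᵇ ℝ) {c ε : ℝ} (hf : ∀ x ∈ Icc a b, |f x - c| ≤ ε) : |∫ x, f x ∂μ - c| ≤ ε := by
  have h1 : ∫ x, f x ∂μ - c = ∫ x, (f x - c) ∂μ := by
    rw [integral_sub (f.integrable _) (integrable_const _)]; simp
  rw [h1, ← Real.norm_eq_abs]
  have hae : ∀ᵐ x ∂μ, ‖f x - c‖ ≤ ε := by
    have : ∀ᵐ x ∂μ, x ∈ Icc a b := by rw [ae_iff]; exact hμ
    exact this.mono hf
  simpa using norm_integral_le_of_norm_le_const hae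

variable {F} {M : ℕ} {lo hi : ℝ} (hF : F.Bounds M lo hi)
include hF

/-- From generation `m` on, the approximants distribute the same masses over cells of length at most
`hi ^ m * (b - a)`, so only the oscillation of `f` on such cells matters. The induction composes `f`
with the maps of the ancestor. -/
theorem abs_integral_approx_sub_le (m : ℕ) : ∀ (ω : VTree J V) (f : ℝ →ᵇ ℝ) (ε : ℝ),
    (∀ x ∈ Icc a b, ∀ y ∈ Icc a b, |x - y| ≤ hi ^ m * (b - a) → |f x - f y| ≤ ε) →
    ∀ n ≥ m, ∀ n' ≥ m,
      |∫ x, f x ∂(approxMeasure F ω n) - ∫ x, f x ∂(approxMeasure F ω n')| ≤ 2 * ε := by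
  have hab := F.a_lt_b
  induction m with
  | zero =>
    intro ω f ε hf n _ n' _
    have h1 : ∀ x ∈ Icc a b, |f x - f a| ≤ ε := fun x hx =>
      hf x hx a (left_mem_Icc.2 hab.le) (by
        rw [abs_of_nonneg (sub_nonneg.2 hx.1)]; linarith [hx.2])
    have h2 := abs_integral_sub_le (approxMeasure_compl_Icc F ω n) f h1
    have h3 := abs_integral_sub_le (approxMeasure_compl_Icc F ω n') f h1
    rw [abs_le] at *
    constructor <;> linarith [h2.1, h2.2, h3.1, h3.2]
  | succ m ih =>
    intro ω f ε hf n hn n' hn'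
    obtain ⟨n, rfl⟩ : ∃ k, n = k + 1 := ⟨n - 1, by omega⟩
    obtain ⟨n', rfl⟩ : ∃ k, n' = k + 1 := ⟨n' - 1, by omega⟩
    rw [approxMeasure_succ, approxMeasure_succ, integral_selfSimilarSum, integral_selfSimilarSum,
      ← Finset.sum_sub_distrib]
    refine (Finset.abs_sum_le_sum_abs _ _).trans ?_
    calc _ ≤ ∑ i ∈ Finset.range (F.N ω.index), F.m ω.index i * (2 * ε) := by
          refine Finset.sum_le_sum fun i hi' => ?_
          have hi' := Finset.mem_range.1 hi'
          have hm := (F.m_pos _ _ hi').le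
          rw [← mul_sub, abs_mul, abs_of_nonneg hm]
          refine mul_le_mul_of_nonneg_left ?_ hm
          refine ih (ω.sub i) (f.compContinuous
            ⟨fun x => F.r ω.index i * x + F.c ω.index i, by fun_prop⟩) ε ?_ n (by omega) n'
            (by omega)
          intro x hx y hy hxy
          refine hf _ (F.map_mem _ hi' hx) _ (F.map_mem _ hi' hy) ?_
          have hr := (F.r_mem _ _ hi').1
          have : F.r ω.index i * x + F.c ω.index i - (F.r ω.index i * y + F.c ω.index i) =
              F.r ω.index i * (x - y) := by ring
          simp only [ContinuousMap.coe_mk]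
          rw [this, abs_mul, abs_of_pos hr, pow_succ', mul_assoc]
          exact mul_le_mul (hF.r_le_hi _ _ hi') hxy (abs_nonneg _) (hF.hi_pos ω).le
      _ = 2 * ε := by rw [← Finset.sum_mul, F.m_sum, one_mul]

/-- The `V`-variable Cantor measure exists for every tree. -/
theorem exists_isCantorMeasure (ω : VTree J V) :
    ∃ μ : ProbabilityMeasure ℝ, IsCantorMeasure F ω μ ∧ (μ : Measure ℝ) (Icc a b)ᶜ = 0 := by
  have hab := F.a_lt_b
  have hcauchy : ∀ f : ℝ →ᵇ ℝ, CauchySeq fun n => ∫ x, f x ∂(approxMeasure F ω n) := by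
    intro f
    have huc : UniformContinuousOn f (Icc a b) :=
      isCompact_Icc.uniformContinuousOn_of_continuous f.continuous.continuousOn
    rw [Metric.cauchySeq_iff]
    intro ε hε
    obtain ⟨δ, hδ, hδf⟩ := Metric.uniformContinuousOn_iff.1 huc (ε / 3) (by linarith)
    obtain ⟨m, hm⟩ : ∃ m : ℕ, hi ^ m * (b - a) < δ := by
      have := (tendsto_pow_atTop_nhds_zero_of_lt_one (hF.hi_pos ω).le hF.hi_lt).mul_const (b - a)
      rw [zero_mul] at this
      exact (this.eventually (gt_mem_nhds hδ)).exists
    refine ⟨m, fun n hn n' hn' => ?_⟩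
    have := abs_integral_approx_sub_le hF m ω f (ε / 3) (fun x hx y hy hxy =>
      (hδf x hx y hy (hxy.trans_lt hm)).le) n hn n' hn'
    rw [Real.dist_eq]
    linarith
  -- All approximants live on one compact interval, so an ultrafilter finer than the sequence has a
  -- limit. Integrals of bounded continuous functions converge along the sequence, hence to the
  -- integrals of this limit.
  have hK : IsCompact {μ : ProbabilityMeasure ℝ | ∀ _ : ℕ, μ (Icc a b)ᶜ ≤ 0} :=
    isCompact_setOfPred_probabilityMeasure_mass_eq_compl_isCompact_le (u := fun _ => 0)
      tendsto_const_nhds (fun _ => isCompact_Icc) (Or.inr monotone_const)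
  let U : Ultrafilter (ProbabilityMeasure ℝ) := Ultrafilter.of (map (approxProb F ω) atTop)
  have hU : (U : Filter (ProbabilityMeasure ℝ)) ≤ map (approxProb F ω) atTop :=
    Ultrafilter.of_le _
  obtain ⟨μ, hμK, hμ⟩ := isCompact_iff_ultrafilter_le_nhds.1 hK U (by
    rw [le_principal_iff]
    refine hU (Filter.eventually_map.2 (.of_forall fun n k => ?_))
    have := approxMeasure_compl_Icc F ω n
    rw [le_zero_iff, ProbabilityMeasure.null_iff_toMeasure_null]
    exact this)
  refine ⟨μ, ?_, by
    have := hμK 0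
    rwa [le_zero_iff, ProbabilityMeasure.null_iff_toMeasure_null] at this⟩
  rw [IsCantorMeasure, ProbabilityMeasure.tendsto_iff_forall_integral_tendsto]
  intro f
  obtain ⟨l, hl⟩ := cauchySeq_tendsto_of_complete (hcauchy f)
  have h1 : Tendsto (fun ν : ProbabilityMeasure ℝ => ∫ x, f x ∂(ν : Measure ℝ)) U
      (𝓝 (∫ x, f x ∂(μ : Measure ℝ))) :=
    (ProbabilityMeasure.tendsto_iff_forall_integral_tendsto.1
      (show Tendsto id (U : Filter (ProbabilityMeasure ℝ)) (𝓝 μ) from hμ)) f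
  have h2 : Tendsto (fun ν : ProbabilityMeasure ℝ => ∫ x, f x ∂(ν : Measure ℝ)) U (𝓝 l) :=
    Tendsto.mono_left (tendsto_map'_iff.2 hl) hU
  rw [tendsto_nhds_unique h1 h2]
  exact hl

/-- The `V`-variable Cantor measure of a tree. -/
def cantorMeasure (ω : VTree J V) : ProbabilityMeasure ℝ :=
  (exists_isCantorMeasure hF ω).choose

theorem isCantorMeasure_cantorMeasure (ω : VTree J V) :
    IsCantorMeasure F ω (cantorMeasure hF ω) :=
  (exists_isCantorMeasure hF ω).choose_spec.1

theorem cantorMeasure_compl_Icc (ω : VTree J V) :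
    (cantorMeasure hF ω : Measure ℝ) (Icc a b)ᶜ = 0 :=
  (exists_isCantorMeasure hF ω).choose_spec.2

/-- The recursion `approxMeasure_succ` passes to the limit, and integrals of bounded continuous
functions determine a finite measure. -/
theorem cantorMeasure_eq_selfSimilarSum (ω : VTree J V) :
    (cantorMeasure hF ω : Measure ℝ) =
      selfSimilarSum F ω fun ω' => (cantorMeasure hF ω' : Measure ℝ) := by
  have : IsFiniteMeasure (selfSimilarSum F ω fun ω' => (cantorMeasure hF ω' : Measure ℝ)) := by
    refine ⟨?_⟩
    rw [selfSimilarSum_apply F ω _ MeasurableSet.univ]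
    exact ENNReal.sum_lt_top.2 fun i _ => ENNReal.mul_lt_top ENNReal.ofReal_lt_top
      (measure_lt_top _ _)
  refine ext_of_forall_integral_eq_of_IsFiniteMeasure fun f => ?_
  rw [integral_selfSimilarSum]
  have h1 := ((ProbabilityMeasure.tendsto_iff_forall_integral_tendsto.1
    (isCantorMeasure_cantorMeasure hF ω)) f).comp (tendsto_add_atTop_nat 1)
  have h2 : Tendsto (fun n => ∑ i ∈ Finset.range (F.N ω.index), F.m ω.index i *
      ∫ x, f (F.r ω.index i * x + F.c ω.index i) ∂(approxMeasure F (ω.sub i) n)) atTop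
      (𝓝 (∑ i ∈ Finset.range (F.N ω.index), F.m ω.index i *
      ∫ x, f (F.r ω.index i * x + F.c ω.index i) ∂(cantorMeasure hF (ω.sub i) : Measure ℝ))) := by
    refine tendsto_finsetSum _ fun i _ => Tendsto.const_mul _ ?_
    exact (ProbabilityMeasure.tendsto_iff_forall_integral_tendsto.1
      (isCantorMeasure_cantorMeasure hF (ω.sub i)))
      (f.compContinuous ⟨fun x => F.r ω.index i * x + F.c ω.index i, by fun_prop⟩)
  refine tendsto_nhds_unique h1 (h2.congr fun n => ?_)
  simp only [Function.comp, approxProb, ProbabilityMeasure.coe_mk]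
  rw [approxMeasure_succ, integral_selfSimilarSum]

theorem cantorMeasure_apply (ω : VTree J V) (s : Set ℝ) (hs : MeasurableSet s) :
    (cantorMeasure hF ω : Measure ℝ) s = ∑ i ∈ Finset.range (F.N ω.index),
      ENNReal.ofReal (F.m ω.index i) *
        (cantorMeasure hF (ω.sub i) : Measure ℝ)
          ((fun x => F.r ω.index i * x + F.c ω.index i) ⁻¹' s) := by
  conv_lhs => rw [cantorMeasure_eq_selfSimilarSum]
  rw [selfSimilarSum_apply F ω _ hs]

/-- A measure of a singleton which only one of the maps reaches from a single point. -/
theorem cantorMeasure_singleton_le {ω : VTree J V} {x y : ℝ} {i : ℕ} {ε : ℝ≥0∞}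
    (hi' : i < F.N ω.index) (hy : F.r ω.index i * y + F.c ω.index i = x)
    (h : ∀ k < F.N ω.index, k ≠ i → ∀ z ∈ Icc a b, F.r ω.index k * z + F.c ω.index k ≠ x)
    (hε : (cantorMeasure hF (ω.sub i) : Measure ℝ) {y} ≤ ε) :
    (cantorMeasure hF ω : Measure ℝ) {x} ≤ ENNReal.ofReal hi * ε := by
  rw [cantorMeasure_apply hF ω _ (measurableSet_singleton x),
    Finset.sum_eq_single_of_mem i (Finset.mem_range.2 hi')]
  · refine mul_le_mul' (ENNReal.ofReal_le_ofReal (hF.m_le_hi _ _ hi')) (le_trans ?_ hε)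
    refine measure_mono fun z hz => ?_
    have hz : F.r ω.index i * z + F.c ω.index i = x := hz
    rw [mem_singleton_iff]
    exact mul_left_cancel₀ (F.r_mem _ _ hi').1.ne' (by linarith)
  · intro k hk hki
    have : (cantorMeasure hF (ω.sub k) : Measure ℝ)
        ((fun x => F.r ω.index k * x + F.c ω.index k) ⁻¹' {x}) = 0 :=
      measure_mono_null (fun z hz hz' => h k (Finset.mem_range.1 hk) hki z hz' hz)
        (cantorMeasure_compl_Icc hF _)
    rw [this, mul_zero]

theorem eq_zero_of_forall_le_pow {ε : ℝ≥0∞}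
    (h : ∀ n : ℕ, ε ≤ ENNReal.ofReal hi ^ n) : ε = 0 := by
  have h1 : ENNReal.ofReal hi < 1 := ENNReal.ofReal_lt_one.2 hF.hi_lt
  exact le_antisymm (ge_of_tendsto' (ENNReal.tendsto_pow_atTop_nhds_zero_of_lt_one h1) h) zero_le

/-- Only the first map reaches `a` from the interval, and only from `a` itself, so every generation
contributes a factor at most `hi`. -/
theorem cantorMeasure_singleton_left (ω : VTree J V) :
    (cantorMeasure hF ω : Measure ℝ) {a} = 0 := by
  refine eq_zero_of_forall_le_pow hF fun n => ?_
  induction n generalizing ω with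
  | zero => simpa using prob_le_one
  | succ n ih =>
    have h0 : 0 < F.N ω.index := zero_lt_two.trans_le (F.two_le_N _)
    rw [pow_succ']
    refine cantorMeasure_singleton_le hF h0 (F.first_left _) (fun k hk hk0 z hz => ne_of_gt ?_)
      (ih _)
    have h1 := F.map_right_le_map_left ω.index (Nat.pos_of_ne_zero hk0) hk
    have h2 := F.map_mono ω.index hk hz.1
    have h3 := (F.r_mem ω.index 0 h0).1
    have h4 := F.first_left ω.index
    have := mul_lt_mul_of_pos_left F.a_lt_b h3
    linarith

theorem cantorMeasure_singleton_right (ω : VTree J V) :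
    (cantorMeasure hF ω : Measure ℝ) {b} = 0 := by
  refine eq_zero_of_forall_le_pow hF fun n => ?_
  induction n generalizing ω with
  | zero => simpa using prob_le_one
  | succ n ih =>
    have h0 : F.N ω.index - 1 < F.N ω.index := by have := F.two_le_N ω.index; omega
    rw [pow_succ']
    refine cantorMeasure_singleton_le hF h0 (F.last_right _) (fun k hk hk0 z hz => ne_of_lt ?_)
      (ih _)
    have h1 := F.map_right_le_map_left ω.index (show k < F.N ω.index - 1 by omega) h0
    have h2 := F.map_mono ω.index hk hz.2
    have h3 := (F.r_mem ω.index _ h0).1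
    have h4 := F.last_right ω.index
    have := mul_lt_mul_of_pos_left F.a_lt_b h3
    linarith

/-- If a map reaches `x` from an interior point, no other map reaches it and a factor `hi` is
gained. Otherwise `x` is reached from end points only, and these are null sets. -/
theorem cantorMeasure_singleton (ω : VTree J V) (x : ℝ) :
    (cantorMeasure hF ω : Measure ℝ) {x} = 0 := by
  refine eq_zero_of_forall_le_pow hF fun n => ?_
  induction n generalizing ω x with
  | zero => simpa using prob_le_one
  | succ n ih =>
    by_cases hex : ∃ i < F.N ω.index, ∃ y ∈ Ioo a b, F.r ω.index i * y + F.c ω.index i = x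
    · obtain ⟨i, hi', y, hy, hyx⟩ := hex
      rw [pow_succ']
      refine cantorMeasure_singleton_le hF hi' hyx (fun k hk hki z hz hzx => ?_) (ih _ _)
      have hr := (F.r_mem ω.index i hi').1
      have h1 := mul_lt_mul_of_pos_left hy.1 hr
      have h2 := mul_lt_mul_of_pos_left hy.2 hr
      have h3 := F.map_mono ω.index hk hz.1
      have h4 := F.map_mono ω.index hk hz.2
      rcases lt_or_gt_of_ne hki with h | h
      · have := F.map_right_le_map_left ω.index h hi'
        linarith
      · have := F.map_right_le_map_left ω.index h hk
        linarith
    · push Not at hex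
      refine le_of_eq_of_le ?_ zero_le
      rw [cantorMeasure_apply hF ω _ (measurableSet_singleton x)]
      refine Finset.sum_eq_zero fun i hi' => ?_
      have hi' := Finset.mem_range.1 hi'
      have : (cantorMeasure hF (ω.sub i) : Measure ℝ)
          ((fun x => F.r ω.index i * x + F.c ω.index i) ⁻¹' {x}) = 0 := by
        refine measure_mono_null (t := (Icc a b)ᶜ ∪ ({a} ∪ {b})) (fun z hz => ?_) ?_
        · by_cases hz' : z ∈ Icc a b
          · right
            by_contra hne
            simp only [mem_union, mem_singleton_iff, not_or] at hne
            exact hex i hi' z ⟨lt_of_le_of_ne hz'.1 (Ne.symm hne.1), lt_of_le_of_ne hz'.2 hne.2⟩ hz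
          · exact Or.inl hz'
        · rw [measure_union_null_iff, measure_union_null_iff]
          exact ⟨cantorMeasure_compl_Icc hF _, cantorMeasure_singleton_left hF _,
            cantorMeasure_singleton_right hF _⟩
      rw [this, mul_zero]

instance nullSingletonClass_cantorMeasure (ω : VTree J V) :
    NullSingletonClass (cantorMeasure hF ω : Measure ℝ) :=
  ⟨cantorMeasure_singleton hF ω⟩

/-! ### Eigenvalue counting by cuts -/

/-- The cells of the cut have length r_w (b - a) and carry the parts of mass m_w of the measure, so
the mass-length condition becomes one on `weight`. -/
theorem IsCut.eigenCount_le {ω : VTree J V} {A : Finset (List ℕ)} (hA : IsCut F ω A)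
    {BC : (ℝ → ℝ) → Prop} (hBC : IsSymmetricBC a b BC) {t : ℝ} (ht : 0 < t)
    (hAt : ∀ w ∈ A, weight F ω w * (b - a) * t < 1) :
    FiniteDimensional ℝ (Submodule.span ℝ {φ : Lp ℝ 2 (cantorMeasure hF ω : Measure ℝ) |
      ∃ lam ≤ t, SolvesEigen a b BC (cantorMeasure hF ω) lam φ}) ∧
    eigenCount a b BC (cantorMeasure hF ω) t ≤ A.card := by
  have hab := F.a_lt_b
  have ha : a ∈ Icc a b := left_mem_Icc.2 hab.le
  have hb : b ∈ Icc a b := right_mem_Icc.2 hab.le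
  have hr : ∀ w : A, 0 < prodAlong F.r ω w := fun w => prodAlong_r_pos (hA.mem_generation w w.2)
  have hm : ∀ w : A, 0 ≤ prodAlong F.m ω w := fun w =>
    prodAlong_m_nonneg F _ ω w (hA.mem_generation w w.2)
  let ν : A → Measure ℝ := fun w => ENNReal.ofReal (prodAlong F.m ω w) •
    (cantorMeasure hF (subAlong ω w) : Measure ℝ).map (mapAlong F ω w)
  have hν : ∀ w (s : Set ℝ), MeasurableSet s → ν w s = ENNReal.ofReal (prodAlong F.m ω w) *
      (cantorMeasure hF (subAlong ω w) : Measure ℝ) (mapAlong F ω w ⁻¹' s) := fun w s hs => by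
    simp only [ν]
    rw [Measure.smul_apply, Measure.map_apply (measurable_mapAlong F w ω) hs, smul_eq_mul]
  have hνu : ∀ w, ν w univ = ENNReal.ofReal (prodAlong F.m ω w) := fun w => by
    rw [hν w _ MeasurableSet.univ]; simp
  have hfin : ∀ w, IsFiniteMeasure (ν w) := fun w => ⟨by rw [hνu]; exact ENNReal.ofReal_lt_top⟩
  have hmono : ∀ (w : A) {x y : ℝ}, x ≤ y → mapAlong F ω w x ≤ mapAlong F ω w y := by
    intro w x y hxy
    have := mapAlong_sub (F := F) w ω x y
    have := mul_nonneg (hr w).le (sub_nonneg.2 hxy)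
    linarith
  have key := eigenCount_le_card (μ := (cantorMeasure hF ω : Measure ℝ)) hab
    (cantorMeasure_compl_Icc hF ω) (cantorMeasure_singleton hF ω a) hBC (ι := A)
    (p := fun w => mapAlong F ω w a) (q := fun w => mapAlong F ω w b) (ν := ν)
    (fun w => (mapAlong_mem (hA.mem_generation w w.2) ha).1) (fun w => hmono w hab.le)
    (fun w => (mapAlong_mem (hA.mem_generation w w.2) hb).2) hA.disjoint ?_ ?_ ht ?_
  · simpa using key
  · intro w
    rw [hν w _ measurableSet_Icc.compl]
    have : (cantorMeasure hF (subAlong ω w) : Measure ℝ)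
        (mapAlong F ω w ⁻¹' (Icc (mapAlong F ω w a) (mapAlong F ω w b))ᶜ) = 0 :=
      measure_mono_null (t := (Icc a b)ᶜ) (fun x hx hx' => hx ⟨hmono w hx'.1, hmono w hx'.2⟩)
        (cantorMeasure_compl_Icc hF _)
    rw [this, mul_zero]
  · ext s hs
    rw [hA.measure_eq (ν := fun ω => (cantorMeasure hF ω : Measure ℝ))
      (cantorMeasure_apply hF) s hs, Measure.finsetSum_apply, ← Finset.sum_coe_sort A]
    exact Finset.sum_congr rfl fun w _ => (hν w s hs).symm
  · intro w
    rw [mapAlong_sub, measureReal_def, hνu, ENNReal.toReal_ofReal (hm w)]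
    refine lt_of_eq_of_lt ?_ (hAt w w.2)
    rw [weight]; ring

/-- Any sufficiently fine cut bounds the dimension. The lower bounds need this beforehand, since
`finrank` is zero on infinite-dimensional spaces. -/
theorem finiteDimensional_eigen (ω : VTree J V) {BC : (ℝ → ℝ) → Prop}
    (hBC : IsSymmetricBC a b BC) {t : ℝ} (ht : 0 < t) :
    FiniteDimensional ℝ (Submodule.span ℝ {φ : Lp ℝ 2 (cantorMeasure hF ω : Measure ℝ) |
      ∃ lam ≤ t, SolvesEigen a b BC (cantorMeasure hF ω) lam φ}) := by
  have hL : 0 < b - a := sub_pos.2 F.a_lt_b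
  have hhi := hF.hi_pos ω
  have hlo := hF.lo_pos
  -- The minimum with one secures `lo ^ 2 * s ≤ 1`, also for small `t`.
  set s := min ((b - a) * t)⁻¹ 1
  have hs : 0 < s := lt_min (inv_pos.2 (_root_.mul_pos hL ht)) one_pos
  obtain ⟨n, hn⟩ := exists_pow_lt_of_lt_one hs
    (show hi ^ 2 < 1 by nlinarith [hF.hi_lt])
  obtain ⟨A, hA, hAw⟩ := exists_isCut hF n ω s hn (by
    have h1 : s ≤ 1 := min_le_right _ _
    have h2 : lo < 1 := (hF.lo_le_hi ω).trans_lt hF.hi_lt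
    have h3 : lo ^ 2 ≤ 1 := by nlinarith
    nlinarith [sq_nonneg lo])
  refine (hA.eigenCount_le hF hBC ht fun w hw => ?_).1
  have h1 := (hAw w hw).1.trans_le (min_le_left _ _)
  rw [mul_assoc]
  calc _ < ((b - a) * t)⁻¹ * ((b - a) * t) :=
        mul_lt_mul_of_pos_right h1 (_root_.mul_pos hL ht)
    _ = 1 := inv_mul_cancel₀ (_root_.mul_pos hL ht).ne'

theorem IFSFamily.Bounds.lo_mul_le_map_one (j : J) :
    a + lo * (b - a) ≤ F.r j 1 * a + F.c j 1 := by
  have h0 : 0 < F.N j := zero_lt_two.trans_le (F.two_le_N _)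
  have h1 := F.map_right_le_map_left j zero_lt_one (one_lt_two.trans_le (F.two_le_N _))
  have h2 := F.first_left j
  have h3 := hF.lo_le_r j 0 h0
  have h4 := F.a_lt_b
  nlinarith

/-- The core of a cell: a cell of the second generation in the interior. -/
theorem exists_core (ω : VTree J V) : ∃ x₀ x₁ : ℝ, x₀ ≤ x₁ ∧ lo ^ 2 * (b - a) ≤ x₀ - a ∧
    lo ^ 2 * (b - a) ≤ b - x₁ ∧
    ENNReal.ofReal (lo ^ 2) ≤ (cantorMeasure hF ω : Measure ℝ) (Icc x₀ x₁) := by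
  have hab := F.a_lt_b
  have hlo := hF.lo_pos
  have hlo1 : lo < 1 := (hF.lo_le_hi ω).trans_lt hF.hi_lt
  set j := ω.index
  set j' := (ω.sub 0).index
  have h0 : 0 < F.N j := zero_lt_two.trans_le (F.two_le_N _)
  have h1 : 1 < F.N j := one_lt_two.trans_le (F.two_le_N _)
  have h1' : 1 < F.N j' := one_lt_two.trans_le (F.two_le_N _)
  have hb : b ∈ Icc a b := right_mem_Icc.2 hab.le
  -- The core is the second child of the first child: its elder sibling separates it from `a`, and
  -- the second child of the ancestor separates it from `b`.
  refine ⟨F.r j 0 * (F.r j' 1 * a + F.c j' 1) + F.c j 0,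
    F.r j 0 * (F.r j' 1 * b + F.c j' 1) + F.c j 0, ?_, ?_, ?_, ?_⟩
  · exact F.map_mono j h0 (F.map_mono j' h1' hab.le)
  · have h2 := hF.lo_mul_le_map_one j'
    have h3 := F.first_left j
    have h4 := hF.lo_le_r j 0 h0
    have h5 : F.r j 0 * (lo * (b - a)) ≤ F.r j 0 * (F.r j' 1 * a + F.c j' 1 - a) :=
      mul_le_mul_of_nonneg_left (by linarith) (hlo.le.trans h4)
    have h6 : lo * (lo * (b - a)) ≤ F.r j 0 * (lo * (b - a)) :=
      mul_le_mul_of_nonneg_right h4 (mul_nonneg hlo.le (sub_nonneg.2 hab.le))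
    nlinarith
  · have h2 := F.map_mono j h0 (F.map_mem j' h1' hb).2
    have h3 := F.map_right_le_map_left j zero_lt_one h1
    have h4 := F.map_le j h1
    have h5 := hF.lo_le_r j 1 h1
    have h6 : lo * (b - a) ≤ F.r j 1 * (b - a) :=
      mul_le_mul_of_nonneg_right h5 (sub_nonneg.2 hab.le)
    have h7 : lo ^ 2 * (b - a) ≤ lo * (b - a) :=
      mul_le_mul_of_nonneg_right (by nlinarith) (sub_nonneg.2 hab.le)
    nlinarith
  · rw [cantorMeasure_apply hF ω _ measurableSet_Icc]
    refine le_trans ?_ (Finset.single_le_sum (fun _ _ => zero_le) (Finset.mem_range.2 h0))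
    have hm : Measurable fun x => F.r j 0 * x + F.c j 0 := by fun_prop
    rw [cantorMeasure_apply hF (ω.sub 0) _ (hm measurableSet_Icc)]
    rw [sq, ENNReal.ofReal_mul hlo.le]
    refine mul_le_mul' (ENNReal.ofReal_le_ofReal (hF.lo_le_m _ _ h0)) ?_
    refine le_trans ?_ (Finset.single_le_sum (fun _ _ => zero_le) (Finset.mem_range.2 h1'))
    have h2 : (cantorMeasure hF ((ω.sub 0).sub 1) : Measure ℝ)
        ((fun x => F.r j' 1 * x + F.c j' 1) ⁻¹' ((fun x => F.r j 0 * x + F.c j 0) ⁻¹'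
          Icc (F.r j 0 * (F.r j' 1 * a + F.c j' 1) + F.c j 0)
            (F.r j 0 * (F.r j' 1 * b + F.c j' 1) + F.c j 0))) = 1 := by
      refine (prob_compl_eq_zero_iff ?_).1 ?_
      · exact (show Measurable fun x => F.r j' 1 * x + F.c j' 1 by fun_prop) (hm measurableSet_Icc)
      · refine measure_mono_null (t := (Icc a b)ᶜ) (fun x hx hx' => hx ?_) (cantorMeasure_compl_Icc hF _)
        exact ⟨F.map_mono j h0 (F.map_mono j' h1' hx'.1), F.map_mono j h0 (F.map_mono j' h1' hx'.2)⟩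
    rw [h2, mul_one]
    exact ENNReal.ofReal_le_ofReal (hF.lo_le_m _ _ h1')

/-- In each cell a trapezoid has its plateau on the core. Its flanks have width at least r_w lo² (b
- a) and the plateau has mass at least m_w lo², so `hAt` forces its energy below t times the mass of
the plateau. -/
theorem IsCut.le_count {ω : VTree J V} {A : Finset (List ℕ)} (hA : IsCut F ω A) {t : ℝ}
    (ht : 0 < t) (hAt : ∀ w ∈ A, 2 < t * (weight F ω w * (lo ^ 4 * (b - a)))) :
    A.card ≤ countD a b (cantorMeasure hF ω) t ∧
    A.card ≤ countN a b (cantorMeasure hF ω) t + 1 := by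
  have hab := F.a_lt_b
  have hL : 0 < b - a := sub_pos.2 hab
  have hlo := hF.lo_pos
  have ha : a ∈ Icc a b := left_mem_Icc.2 hab.le
  have hb : b ∈ Icc a b := right_mem_Icc.2 hab.le
  have hr : ∀ w : A, 0 < prodAlong F.r ω w := fun w => prodAlong_r_pos (hA.mem_generation w w.2)
  have hm : ∀ w : A, 0 ≤ prodAlong F.m ω w := fun w =>
    prodAlong_m_nonneg F _ ω w (hA.mem_generation w w.2)
  choose x₀ x₁ h01 hx₀ hx₁ hcore using fun w : A => exists_core hF (subAlong ω w)
  have hpos : 0 < lo ^ 2 * (b - a) := by positivity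
  have hmono : ∀ (w : A) {x y : ℝ}, x ≤ y → mapAlong F ω w x ≤ mapAlong F ω w y := by
    intro w x y hxy
    have := mapAlong_sub (F := F) w ω x y
    have := mul_nonneg (hr w).le (sub_nonneg.2 hxy)
    linarith
  have hpp : ∀ w : A, prodAlong F.r ω w * (lo ^ 2 * (b - a)) ≤
      mapAlong F ω w (x₀ w) - mapAlong F ω w a := fun w => by
    rw [mapAlong_sub]; exact mul_le_mul_of_nonneg_left (hx₀ w) (hr w).le
  have hqq : ∀ w : A, prodAlong F.r ω w * (lo ^ 2 * (b - a)) ≤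
      mapAlong F ω w b - mapAlong F ω w (x₁ w) := fun w => by
    rw [mapAlong_sub]; exact mul_le_mul_of_nonneg_left (hx₁ w) (hr w).le
  have hrpos : ∀ w : A, 0 < prodAlong F.r ω w * (lo ^ 2 * (b - a)) := fun w =>
    _root_.mul_pos (hr w) hpos
  have hE : ∀ w : A, (mapAlong F ω w (x₀ w) - mapAlong F ω w a)⁻¹ +
      (mapAlong F ω w b - mapAlong F ω w (x₁ w))⁻¹ < t * (cantorMeasure hF ω : Measure ℝ).real
        (Icc (mapAlong F ω w (x₀ w)) (mapAlong F ω w (x₁ w))) := by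
    intro w
    have h1 : prodAlong F.m ω w * lo ^ 2 ≤ (cantorMeasure hF ω : Measure ℝ).real
        (Icc (mapAlong F ω w (x₀ w)) (mapAlong F ω w (x₁ w))) := by
      rw [measureReal_def, ← ENNReal.ofReal_le_iff_le_toReal (measure_ne_top _ _),
        ENNReal.ofReal_mul (hm w)]
      rw [hA.measure_eq (ν := fun ω => (cantorMeasure hF ω : Measure ℝ))
        (cantorMeasure_apply hF) _ measurableSet_Icc]
      refine le_trans ?_ (Finset.single_le_sum (fun _ _ => zero_le) w.2)
      refine mul_le_mul' le_rfl ((hcore w).trans (measure_mono fun x hx => ?_))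
      exact ⟨hmono w hx.1, hmono w hx.2⟩
    have h2 : (mapAlong F ω w (x₀ w) - mapAlong F ω w a)⁻¹ +
        (mapAlong F ω w b - mapAlong F ω w (x₁ w))⁻¹ ≤
        2 * (prodAlong F.r ω w * (lo ^ 2 * (b - a)))⁻¹ := by
      rw [two_mul]
      exact add_le_add (inv_anti₀ (hrpos w) (hpp w)) (inv_anti₀ (hrpos w) (hqq w))
    refine h2.trans_lt (lt_of_lt_of_le ?_ (mul_le_mul_of_nonneg_left h1 ht.le))
    rw [← div_eq_mul_inv, div_lt_iff₀ (hrpos w)]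
    refine (hAt w w.2).trans_eq ?_
    rw [weight]; ring
  have hfD := finiteDimensional_eigen hF ω (isSymmetricBC_dirichlet (a := a) (b := b)) ht
  have hfN := finiteDimensional_eigen hF ω (isSymmetricBC_neumann (a := a) (b := b)) ht
  have hp : ∀ w : A, a ≤ mapAlong F ω w a := fun w =>
    (mapAlong_mem (hA.mem_generation w w.2) ha).1
  have hq : ∀ w : A, mapAlong F ω w b ≤ b := fun w =>
    (mapAlong_mem (hA.mem_generation w w.2) hb).2
  have hpp' : ∀ w : A, mapAlong F ω w a < mapAlong F ω w (x₀ w) := fun w => by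
    linarith [hpp w, hrpos w]
  have hqq' : ∀ w : A, mapAlong F ω w (x₁ w) < mapAlong F ω w b := fun w => by
    linarith [hqq w, hrpos w]
  constructor
  · have := card_le_countD hab (cantorMeasure_compl_Icc hF ω) hp hpp' (fun w => hmono w (h01 w))
      hqq' hq hA.disjoint ht hE
    simpa using this
  · have := card_le_countN hab (cantorMeasure_compl_Icc hF ω) hp hpp' (fun w => hmono w (h01 w))
      hqq' hq hA.disjoint ht hE
    simpa using this

end CantorMeasure
end VCantor
end

noncomputable section

namespace VCantor

/-! ### Splicing and coordinate changes in product measures -/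

section ProductMeasure

variable {X : Type*} [MeasurableSpace X]

/-- The sequence that follows `x` up to time `n` and `y` afterwards. -/
def spliceSeq (n : ℕ) (z : (ℕ → X) × (ℕ → X)) : ℕ → X := fun i => if i < n then z.1 i else z.2 (i - n)

/-- A finite cylinder splits into conditions on the first `n` coordinates and conditions on the
shifted remaining ones. This is the independence of past and future at a fixed level. -/
theorem measurePreserving_spliceSeq (μ : Measure X) [IsProbabilityMeasure μ] (n : ℕ) :
    MeasurePreserving (spliceSeq n)
      ((Measure.infinitePi fun _ : ℕ => μ).prod (Measure.infinitePi fun _ : ℕ => μ))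
      (Measure.infinitePi fun _ : ℕ => μ) := by
  have hm : Measurable (spliceSeq n : (ℕ → X) × (ℕ → X) → ℕ → X) := by
    refine measurable_pi_lambda _ fun i => ?_
    by_cases h : i < n
    · simp only [spliceSeq, h, if_true]
      fun_prop
    · simp only [spliceSeq, h, if_false]
      fun_prop
  refine ⟨hm, Measure.eq_infinitePi _ fun s t ht => ?_⟩
  rw [Measure.map_apply hm (.pi s.countable_toSet fun i _ => ht i)]
  have hinj : Set.InjOn (fun i => i - n) (s.filter fun i => ¬ i < n : Finset ℕ) := by
    intro i hi k hk hik
    have hi := (Finset.mem_filter.1 hi).2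
    have hk := (Finset.mem_filter.1 hk).2
    simp only at hik
    omega
  have hpre : spliceSeq n ⁻¹' (Set.pi s t) =
      (Set.pi (s.filter fun i => i < n : Finset ℕ) t) ×ˢ
      (Set.pi ((s.filter fun i => ¬ i < n).image fun i => i - n : Finset ℕ)
        fun i => t (i + n)) := by
    ext ⟨x, y⟩
    simp only [mem_preimage, Set.mem_pi, mem_prod, Finset.mem_coe, Finset.mem_filter,
      Finset.mem_image, spliceSeq]
    constructor
    · intro h
      refine ⟨fun i hi => by simpa [hi.2] using h i hi.1, ?_⟩
      rintro _ ⟨i, hi, rfl⟩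
      have := h i hi.1
      rw [if_neg hi.2] at this
      rwa [Nat.sub_add_cancel (not_lt.1 hi.2)]
    · intro h i hi
      by_cases hin : i < n
      · rw [if_pos hin]; exact h.1 i ⟨hi, hin⟩
      · rw [if_neg hin]
        have := h.2 (i - n) ⟨i, ⟨hi, hin⟩, rfl⟩
        rwa [Nat.sub_add_cancel (not_lt.1 hin)] at this
  rw [hpre, Measure.prod_prod, Measure.infinitePi_pi _ fun i _ => ht i,
    Measure.infinitePi_pi _ fun i _ => ht _, Finset.prod_image hinj,
    ← Finset.prod_filter_mul_prod_filter_not s (fun i => i < n)]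
  congr 1
  refine Finset.prod_congr rfl fun i hi => ?_
  rw [Nat.sub_add_cancel (not_lt.1 (Finset.mem_filter.1 hi).2)]

/-- Applying a measure preserving map to one coordinate preserves the product measure. -/
theorem measurePreserving_apply_at {μ : Measure X} [IsProbabilityMeasure μ] {φ : X → X}
    (hφ : MeasurePreserving φ μ μ) (n : ℕ) :
    MeasurePreserving (fun (e : ℕ → X) i => (if i = n then φ else id) (e i))
      (Measure.infinitePi fun _ : ℕ => μ) (Measure.infinitePi fun _ : ℕ => μ) := by
  have hmeas : ∀ i, Measurable (if i = n then φ else id) := fun i => by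
    split_ifs
    · exact hφ.measurable
    · exact measurable_id
  refine ⟨measurable_pi_lambda _ fun i => (hmeas i).comp (measurable_pi_apply i), ?_⟩
  rw [Measure.infinitePi_map_pi (fun _ => μ) hmeas]
  congr 1
  funext i
  split_ifs
  · exact hφ.map_eq
  · exact Measure.map_id

end ProductMeasure

/-! ### Uniform types and their permutations -/

section Types

variable (V : ℕ) [NeZero V]

theorem unifType_singleton (v : Fin V) : unifType V {v} = (V : ℝ≥0∞)⁻¹ := by
  rw [unifType, PMF.toMeasure_apply_singleton _ _ (measurableSet_singleton v),
    PMF.uniformOfFintype_apply]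
  simp

theorem lintegral_unifType (f : Fin V → ℝ≥0∞) :
    ∫⁻ v, f v ∂(unifType V) = ∑ v, f v * (V : ℝ≥0∞)⁻¹ := by
  rw [lintegral_fintype]
  simp_rw [unifType_singleton]

theorem measurePreserving_unifType (σ : Equiv.Perm (Fin V)) :
    MeasurePreserving σ (unifType V) (unifType V) := by
  refine ⟨measurable_from_top, Measure.ext_of_singleton fun v => ?_⟩
  rw [Measure.map_apply measurable_from_top (measurableSet_singleton v)]
  have : (σ ⁻¹' {v} : Set (Fin V)) = {σ.symm v} := by
    ext u; simp [Equiv.eq_symm_apply]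
  rw [this, unifType_singleton, unifType_singleton]

variable {V} {J : Type*} [MeasurableSpace J]

/-- The environment in which all types are permuted. -/
def permTypes (σ : Equiv.Perm (Fin V)) (E : Env J V) : Env J V :=
  fun v => Prod.map id (fun s i => σ (s i)) (E v)

theorem measurePreserving_permTypes (P : Measure J) [IsProbabilityMeasure P]
    (σ : Equiv.Perm (Fin V)) : MeasurePreserving (permTypes σ) (envLaw P V) (envLaw P V) := by
  have h1 : MeasurePreserving (fun (s : ℕ → Fin V) i => σ (s i))
      (Measure.infinitePi fun _ : ℕ => unifType V) (Measure.infinitePi fun _ : ℕ => unifType V) := by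
    refine ⟨by fun_prop, ?_⟩
    rw [Measure.infinitePi_map_pi (fun _ => unifType V) fun _ => measurable_from_top]
    congr 1
    funext i
    exact (measurePreserving_unifType V σ).map_eq
  exact measurePreserving_pi _ _ fun _ => (MeasurePreserving.id P).prod h1

end Types

/-! ### Necks and the factorisation of level sums -/

section Necks

variable {J : Type*} {V : ℕ} {a b : ℝ} (F : IFSFamily J a b)

/-- The sequences of environments whose first neck has index `n`, that is, level `n + 1`. -/
def firstNeckAt (n : ℕ) : Set (ℕ → Env J V) := {e | IsNeck F (e n) ∧ ∀ k < n, ¬ IsNeck F (e k)}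

theorem firstNeck_of_mem {n : ℕ} {τ : Fin V} {e : ℕ → Env J V} (he : e ∈ firstNeckAt F n) :
    firstNeck F (τ, e) = n + 1 := by
  refine le_antisymm (Nat.sInf_le ⟨n, rfl, he.1⟩) (le_csInf ⟨n + 1, n, rfl, he.1⟩ ?_)
  rintro m ⟨k, rfl, hk⟩
  by_contra! hlt
  exact he.2 k (by omega) hk

theorem mem_firstNeckAt_iff {n : ℕ} {ω : VTree J V} :
    ω.2 ∈ firstNeckAt F n ↔ firstNeck F ω = n + 1 := by
  refine ⟨fun h => firstNeck_of_mem F h, fun h => ?_⟩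
  have hne : {n | IsNeckLevel F ω n}.Nonempty := by
    by_contra hemp
    rw [not_nonempty_iff_eq_empty] at hemp
    -- `sInf ∅ = 0`, so without a neck `firstNeck` cannot have the value `n + 1`.
    rw [firstNeck, hemp, Nat.sInf_empty] at h
    omega
  obtain ⟨k, hk, hneck⟩ := Nat.sInf_mem hne
  have hk' : k = n := by
    have : firstNeck F ω = k + 1 := hk
    omega
  subst hk'
  refine ⟨hneck, fun l hl hl' => ?_⟩
  have : firstNeck F ω ≤ l + 1 := Nat.sInf_le ⟨l, rfl, hl'⟩
  omega

theorem exists_mem_firstNeckAt {e : ℕ → Env J V} (h : ∃ k, IsNeck F (e k)) :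
    ∃ n, e ∈ firstNeckAt F n := by
  classical
  exact ⟨Nat.find h, Nat.find_spec h, fun k hk => Nat.find_min h hk⟩

theorem firstNeckAt_disjoint :
    Pairwise (Function.onFun Disjoint (firstNeckAt F : ℕ → Set (ℕ → Env J V))) := by
  intro n m hnm
  rw [Function.onFun, Set.disjoint_left]
  intro e hn hm
  rcases lt_or_gt_of_ne hnm with h | h
  · exact hm.2 n h hn.1
  · exact hn.2 m h hm.1

variable [NeZero V]

/-- The tree above the first neck. -/
def regen (ω : VTree J V) : VTree J V :=
  ((ω.2 (firstNeck F ω - 1) 0).2 0, fun k => ω.2 (firstNeck F ω + k))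

/-- Child 0 of an individual of type 0 always exists, so its type can stand for the common type, as
it does in `regen`. -/
theorem IsNeck.eq {E : Env J V} (h : IsNeck F E) (v : Fin V) {i : ℕ} (hi : i < F.N (E v).1) :
    (E v).2 i = (E 0).2 0 := by
  obtain ⟨u, hu⟩ := h
  rw [hu v i hi, hu 0 0 (zero_lt_two.trans_le (F.two_le_N _))]

/-- All subtrees rooted at a neck are equal. -/
theorem subAlong_eq_of_isNeck (n : ℕ) : ∀ {ω : VTree J V}, IsNeck F (ω.2 n) →
    ∀ w ∈ generation F ω (n + 1), subAlong ω w = ((ω.2 n 0).2 0, fun k => ω.2 (n + 1 + k)) := by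
  induction n with
  | zero =>
    intro ω hneck w hw
    obtain ⟨i, hi, u, hu, rfl⟩ := (mem_generation_succ F).1 hw
    simp only [generation, Finset.mem_singleton] at hu
    subst hu
    simp only [subAlong, VTree.sub]
    refine Prod.ext (hneck.eq F ω.1 hi) ?_
    funext k
    simp [add_comm]
  | succ n ih =>
    intro ω hneck w hw
    obtain ⟨i, hi, u, hu, rfl⟩ := (mem_generation_succ F).1 hw
    have : IsNeck F ((ω.sub i).2 n) := hneck
    rw [subAlong, ih this u hu]
    refine Prod.ext rfl ?_
    funext k
    change ω.2 (n + 1 + k + 1) = ω.2 (n + 1 + 1 + k)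
    rw [show n + 1 + k + 1 = n + 1 + 1 + k by omega]

/-- All individuals at a neck carry the same subtree, so its level sum comes out of the sum. This
makes the logarithm additive along necks. -/
theorem levelSum_add_of_isNeck (x : ℝ) {n : ℕ} {ω : VTree J V} (h : IsNeck F (ω.2 n)) (k : ℕ) :
    levelSum F x (n + 1 + k) ω =
      levelSum F x (n + 1) ω * levelSum F x k ((ω.2 n 0).2 0, fun k => ω.2 (n + 1 + k)) := by
  rw [levelSum_add, levelSum, Finset.sum_mul]
  exact Finset.sum_congr rfl fun w hw => by rw [subAlong_eq_of_isNeck F n h w hw]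

omit [NeZero V] in
/-- The level sum at level `n + 1` does not depend on the types chosen by the last environment. -/
theorem levelSum_congr (x : ℝ) (n : ℕ) : ∀ {τ : Fin V} {e e' : ℕ → Env J V},
    (∀ k < n, e k = e' k) → (∀ v, (e n v).1 = (e' n v).1) →
      levelSum F x (n + 1) (τ, e) = levelSum F x (n + 1) (τ, e') := by
  induction n with
  | zero =>
    intro τ e e' _ h
    rw [levelSum_succ, levelSum_succ]
    simp only [VTree.index, h τ, levelSum_zero]
  | succ n ih =>
    intro τ e e' h h'
    rw [levelSum_succ, levelSum_succ]
    have h0 := h 0 (Nat.succ_pos _)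
    simp only [VTree.index, VTree.sub, h0]
    refine Finset.sum_congr rfl fun i _ => ?_
    rw [ih (e := fun k => e (k + 1)) (e' := fun k => e' (k + 1))
      (fun k hk => h (k + 1) (by omega)) h']

/-! ### Measurability of the neck functionals -/

section Measurability

variable [MeasurableSpace J] {F} (hN : Measurable F.N)
include hN

omit [NeZero V] in
theorem measurableSet_isNeck : MeasurableSet {E : Env J V | IsNeck F E} := by
  have : {E : Env J V | IsNeck F E} =
      ⋃ u : Fin V, ⋂ v : Fin V, ⋂ i : ℕ, {E | F.N (E v).1 ≤ i} ∪ {E | (E v).2 i = u} := by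
    ext E
    simp only [IsNeck, mem_ofPred_eq, mem_iUnion, mem_iInter, mem_union]
    refine exists_congr fun u => forall_congr' fun v => forall_congr' fun i => ?_
    rw [← not_lt, imp_iff_not_or]
  rw [this]
  refine MeasurableSet.iUnion fun u => MeasurableSet.iInter fun v => MeasurableSet.iInter fun i =>
    MeasurableSet.union ?_ ?_
  · have h : Measurable fun E : Env J V => F.N (E v).1 := by fun_prop
    exact h measurableSet_Iic
  · have h : Measurable fun E : Env J V => (E v).2 i := by fun_prop
    exact h (measurableSet_singleton u)

omit [NeZero V] in
theorem measurableSet_firstNeckAt (n : ℕ) :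
    MeasurableSet (firstNeckAt F n : Set (ℕ → Env J V)) := by
  have : (firstNeckAt F n : Set (ℕ → Env J V)) =
      {e | IsNeck F (e n)} ∩ ⋂ k, ⋂ (_ : k < n), {e | IsNeck F (e k)}ᶜ := by
    ext e; simp [firstNeckAt]
  have he : ∀ k, Measurable fun e : ℕ → Env J V => e k := fun k => measurable_pi_apply k
  rw [this]
  exact (he n (measurableSet_isNeck hN)).inter
    (MeasurableSet.iInter fun k => MeasurableSet.iInter fun _ =>
      (he k (measurableSet_isNeck hN)).compl)

omit [NeZero V] in
theorem measurable_firstNeck : Measurable (firstNeck F : VTree J V → ℕ) := by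
  have hpos : ∀ n, MeasurableSet ((firstNeck F : VTree J V → ℕ) ⁻¹' {n + 1}) := fun n => by
    have : (firstNeck F : VTree J V → ℕ) ⁻¹' {n + 1} = Prod.snd ⁻¹' firstNeckAt F n := by
      ext ω; exact (mem_firstNeckAt_iff F).symm
    rw [this]
    exact measurable_snd (measurableSet_firstNeckAt hN n)
  refine measurable_to_countable' fun n => ?_
  rcases n with _ | n
  · have : (firstNeck F : VTree J V → ℕ) ⁻¹' {0} =
        (⋃ n, (firstNeck F : VTree J V → ℕ) ⁻¹' {n + 1})ᶜ := by
      ext ω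
      simp only [mem_preimage, mem_singleton_iff, mem_compl_iff, mem_iUnion, not_exists]
      constructor
      · intro h n; omega
      · intro h
        by_contra h0
        exact h (firstNeck F ω - 1) (by omega)
    rw [this]
    exact (MeasurableSet.iUnion hpos).compl
  · exact hpos n

/-- The shift is by a random number of levels; as a separate variable with countably many values, it
can be fixed. -/
theorem measurable_regen : Measurable (regen F : VTree J V → VTree J V) := by
  have h1 : Measurable fun z : VTree J V × ℕ =>
      (((z.1.2 (z.2 - 1) 0).2 0, fun k => z.1.2 (z.2 + k)) : VTree J V) := by
    refine measurable_from_prod_countable_left fun n => Measurable.prodMk ?_ ?_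
    · exact (measurable_pi_apply 0).comp (measurable_snd.comp
        ((measurable_pi_apply 0).comp ((measurable_pi_apply (n - 1)).comp measurable_snd)))
    · exact measurable_pi_lambda _ fun k => (measurable_pi_apply (n + k)).comp measurable_snd
  exact h1.comp (measurable_id.prodMk (measurable_firstNeck hN))

omit hN [NeZero V] in
theorem measurable_index : Measurable (VTree.index : VTree J V → J) := by
  refine measurable_from_prod_countable_right fun v => ?_
  exact measurable_fst.comp ((measurable_pi_apply v).comp (measurable_pi_apply 0))

omit hN [NeZero V] in
theorem measurable_sub (i : ℕ) : Measurable fun ω : VTree J V => ω.sub i := by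
  refine Measurable.prodMk ?_ ?_
  · refine measurable_from_prod_countable_right fun v => ?_
    exact (measurable_pi_apply i).comp (measurable_snd.comp
      ((measurable_pi_apply v).comp (measurable_pi_apply 0)))
  · exact measurable_pi_lambda _ fun k => (measurable_pi_apply (k + 1)).comp measurable_snd

omit [NeZero V] in
theorem measurable_levelSum (hr : ∀ i, Measurable fun j => F.r j i)
    (hm : ∀ i, Measurable fun j => F.m j i) {M : ℕ} (hM : ∀ j, F.N j ≤ M) (x : ℝ) (n : ℕ) :
    Measurable (levelSum F x n : VTree J V → ℝ) := by
  induction n with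
  | zero =>
    have : (levelSum F x 0 : VTree J V → ℝ) = fun _ => 1 := funext (levelSum_zero F x)
    rw [this]
    exact measurable_const
  | succ n ih =>
    -- The number of children depends on the tree; indicators extend the sum to the fixed range `M`.
    have : (levelSum F x (n + 1) : VTree J V → ℝ) = fun ω => ∑ i ∈ Finset.range M,
        {ω : VTree J V | i < F.N ω.index}.indicator (fun ω =>
          (F.m ω.index i * F.r ω.index i) ^ x * levelSum F x n (ω.sub i)) ω := by
      funext ω
      rw [levelSum_succ, ← Finset.sum_subset (Finset.range_subset_range.2 (hM ω.index))]
      · refine Finset.sum_congr rfl fun i hi => ?_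
        have hi : ω ∈ {ω : VTree J V | i < F.N ω.index} := Finset.mem_range.1 hi
        rw [indicator_of_mem hi]
      · intro i _ hi
        have hi : ω ∉ {ω : VTree J V | i < F.N ω.index} := fun h => hi (Finset.mem_range.2 h)
        rw [indicator_of_notMem hi]
    rw [this]
    refine Finset.measurable_sum _ fun i _ => Measurable.indicator ?_ ?_
    · exact ((((hm i).comp measurable_index).mul ((hr i).comp measurable_index)).pow_const x).mul
        (ih.comp (measurable_sub i))
    · exact (hN.comp measurable_index) measurableSet_Ioi

omit [NeZero V] in
theorem measurable_logNeckSum (hr : ∀ i, Measurable fun j => F.r j i)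
    (hm : ∀ i, Measurable fun j => F.m j i) {M : ℕ} (hM : ∀ j, F.N j ≤ M) (x : ℝ) :
    Measurable (logNeckSum F x : VTree J V → ℝ) := by
  have h1 : Measurable fun z : VTree J V × ℕ => levelSum F x z.2 z.1 :=
    measurable_from_prod_countable_left fun n => measurable_levelSum hN hr hm hM x n
  exact Real.measurable_log.comp (h1.comp (measurable_id.prodMk (measurable_firstNeck hN)))

end Measurability

end Necks
end VCantor
end

noncomputable section

namespace VCantor

/-! ### Regeneration at the first neck and the law of large numbers -/

section Regeneration

variable {J : Type*} {V : ℕ} {a b : ℝ} {F : IFSFamily J a b} [NeZero V] [MeasurableSpace J]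
  (hN : Measurable F.N) (P : Measure J) [IsProbabilityMeasure P]
include hN

omit hN in
-- Only the first `M` types of each sequence matter, and with positive probability they are all 0.
theorem envLaw_isNeck_pos {M : ℕ} (hM : ∀ j, F.N j ≤ M) :
    0 < envLaw P V {E | IsNeck F E} := by
  have hsub : (Set.univ.pi fun _ : Fin V => (univ : Set J) ×ˢ
      (Set.pi (Finset.range M : Set ℕ) fun _ => ({0} : Set (Fin V)))) ⊆
      {E : Env J V | IsNeck F E} := fun E hE => by
    refine ⟨0, fun v i hi => ?_⟩
    have h := (hE v (mem_univ v)).2 i (Finset.mem_coe.2 (Finset.mem_range.2 (hi.trans_le (hM _))))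
    exact h
  refine lt_of_lt_of_le ?_ (measure_mono hsub)
  rw [envLaw, Measure.pi_pi]
  simp only [Measure.prod_prod, measure_univ, one_mul]
  rw [Measure.infinitePi_pi _ fun _ _ => measurableSet_singleton _]
  simp only [unifType_singleton, Finset.prod_const]
  refine pos_iff_ne_zero.2 (pow_ne_zero _ (pow_ne_zero _ ?_))
  simp

theorem envLaw_not_isNeck_lt_one {M : ℕ} (hM : ∀ j, F.N j ≤ M) :
    envLaw P V {E | IsNeck F E}ᶜ < 1 := by
  rw [prob_compl_eq_one_sub (measurableSet_isNeck hN)]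
  exact ENNReal.sub_lt_self ENNReal.one_ne_top one_ne_zero (envLaw_isNeck_pos P hM).ne'

theorem treeLaw_forall_not_isNeck (n : ℕ) :
    treeLaw P V {ω | ∀ k < n, ¬ IsNeck F (ω.2 k)} = envLaw P V {E | IsNeck F E}ᶜ ^ n := by
  have hpre : {ω : VTree J V | ∀ k < n, ¬ IsNeck F (ω.2 k)} =
      Prod.snd ⁻¹' (Set.pi (Finset.range n : Set ℕ) fun _ => {E : Env J V | IsNeck F E}ᶜ) := by
    ext ω
    simp [Set.mem_pi]
  have hmeas : MeasurableSet
      (Set.pi (Finset.range n : Set ℕ) fun _ => {E : Env J V | IsNeck F E}ᶜ) :=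
    .pi (Finset.range n).countable_toSet fun _ _ => (measurableSet_isNeck hN).compl
  rw [hpre, treeLaw, measurePreserving_snd.measure_preimage hmeas.nullMeasurableSet,
    Measure.infinitePi_pi _ fun _ _ => (measurableSet_isNeck hN).compl]
  simp

theorem ae_exists_isNeck {M : ℕ} (hM : ∀ j, F.N j ≤ M) :
    ∀ᵐ ω ∂(treeLaw P V), ∃ k, IsNeck F (ω.2 k) := by
  rw [ae_iff]
  have hle : ∀ n, treeLaw P V {ω | ¬ ∃ k, IsNeck F (ω.2 k)} ≤
      envLaw P V {E | IsNeck F E}ᶜ ^ n := fun n => by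
    rw [← treeLaw_forall_not_isNeck hN P n]
    exact measure_mono fun ω h k _ hk => h ⟨k, hk⟩
  exact le_antisymm (ge_of_tendsto' (ENNReal.tendsto_pow_atTop_nhds_zero_of_lt_one
    (envLaw_not_isNeck_lt_one hN P hM)) hle) zero_le

/-- The expectation is the sum of the tail probabilities, which are dominated by a geometric series.
-/
theorem integrable_firstNeck {M : ℕ} (hM : ∀ j, F.N j ≤ M) :
    Integrable (fun ω => (firstNeck F ω : ℝ)) (treeLaw P V) := by
  have hmeas : Measurable fun ω : VTree J V => (firstNeck F ω : ℝ) :=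
    measurable_from_top.comp (measurable_firstNeck hN)
  refine ⟨hmeas.aestronglyMeasurable, ?_⟩
  rw [hasFiniteIntegral_iff_enorm]
  have hsum : ∀ ω : VTree J V, ‖(firstNeck F ω : ℝ)‖ₑ =
      ∑' n, {ω : VTree J V | n < firstNeck F ω}.indicator (fun _ => (1 : ℝ≥0∞)) ω := fun ω => by
    have h0 : ∀ n ∉ Finset.range (firstNeck F ω),
        {ω : VTree J V | n < firstNeck F ω}.indicator (fun _ => (1 : ℝ≥0∞)) ω = 0 := fun n hn => by
      have : ω ∉ {ω : VTree J V | n < firstNeck F ω} := fun h => hn (Finset.mem_range.2 h)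
      exact indicator_of_notMem this _
    have h1 : ∀ n ∈ Finset.range (firstNeck F ω),
        {ω : VTree J V | n < firstNeck F ω}.indicator (fun _ => (1 : ℝ≥0∞)) ω = 1 := fun n hn => by
      have : ω ∈ {ω : VTree J V | n < firstNeck F ω} := Finset.mem_range.1 hn
      exact indicator_of_mem this _
    rw [tsum_eq_sum h0, Finset.sum_congr rfl h1]
    simp
  have hset : ∀ n : ℕ, MeasurableSet {ω : VTree J V | n < firstNeck F ω} := fun n =>
    measurable_firstNeck hN measurableSet_Ioi
  simp_rw [hsum]
  rw [lintegral_tsum fun n => (measurable_const.indicator (hset n)).aemeasurable]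
  simp_rw [lintegral_indicator_const (hset _), one_mul]
  calc ∑' n, treeLaw P V {ω | n < firstNeck F ω}
      ≤ ∑' n, envLaw P V {E | IsNeck F E}ᶜ ^ n := by
        refine ENNReal.tsum_le_tsum fun n => ?_
        rw [← treeLaw_forall_not_isNeck hN P n]
        refine measure_mono fun ω h k hk hneck => ?_
        have : firstNeck F ω ≤ k + 1 := Nat.sInf_le ⟨k, rfl, hneck⟩
        have h : n < firstNeck F ω := h
        omega
    _ < ⊤ := by
        rw [ENNReal.tsum_geometric, ENNReal.inv_lt_top]
        exact tsub_pos_of_lt (envLaw_not_isNeck_lt_one hN P hM)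

omit hN [NeZero V] [MeasurableSpace J] in
theorem firstNeck_pos {ω : VTree J V} (h : ∃ k, IsNeck F (ω.2 k)) : 1 ≤ firstNeck F ω := by
  obtain ⟨n, hn⟩ := exists_mem_firstNeckAt F h
  rw [(mem_firstNeckAt_iff F).1 hn]
  omega

/-- Sets of sequences of environments that are determined by what happens up to the first neck,
apart from the common type that the neck assigns. -/
def IsBlockSet (F : IFSFamily J a b) (n : ℕ) (D : Set (ℕ → Env J V)) : Prop :=
  ∀ e e' : ℕ → Env J V, e ∈ D → (∀ k < n, e k = e' k) → (∀ v, (e n v).1 = (e' n v).1) →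
    IsNeck F (e' n) → e' ∈ D

omit hN [NeZero V] [MeasurableSpace J] in
theorem isNeck_permTypes {σ : Equiv.Perm (Fin V)} {E : Env J V} (h : IsNeck F E) :
    IsNeck F (permTypes σ E) := by
  obtain ⟨u, hu⟩ := h
  exact ⟨σ u, fun v i hi => congrArg σ (hu v i hi)⟩

omit hN [NeZero V] in
theorem measure_eq_sum_inter {D : Set (ℕ → Env J V)} (hD : MeasurableSet D) {u : (ℕ → Env J V) → Fin V}
    (hu : Measurable u) (μ : Measure (ℕ → Env J V)) : μ D = ∑ v, μ (D ∩ u ⁻¹' {v}) := by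
  have : D = ⋃ v, D ∩ u ⁻¹' {v} := by ext e; simp
  conv_lhs => rw [this]
  rw [measure_iUnion, tsum_fintype]
  · intro v w hvw
    rw [Function.onFun, Set.disjoint_left]
    rintro e ⟨-, h⟩ ⟨-, h'⟩
    exact hvw (h.symm.trans h')
  · exact fun v => hD.inter (hu (measurableSet_singleton v))

omit hN in
/-- The common type that a neck assigns is uniform and independent of the block below it. -/
theorem IsBlockSet.measure_inter_type {n : ℕ} {D : Set (ℕ → Env J V)} (hD : MeasurableSet D)
    (hneck : ∀ e ∈ D, IsNeck F (e n)) (hblock : IsBlockSet F n D) (v : Fin V) :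
    Measure.infinitePi (fun _ => envLaw P V) (D ∩ {e | (e n 0).2 0 = v}) =
      Measure.infinitePi (fun _ => envLaw P V) D * (V : ℝ≥0∞)⁻¹ := by
  have hu : Measurable fun e : ℕ → Env J V => (e n 0).2 0 := by fun_prop
  have heq : ∀ w, Measure.infinitePi (fun _ => envLaw P V) (D ∩ {e | (e n 0).2 0 = w}) =
      Measure.infinitePi (fun _ => envLaw P V) (D ∩ {e | (e n 0).2 0 = v}) := fun w => by
    -- Swapping the types `v` and `w` in environment `n` alone preserves the law and the set `D` and
    -- pulls one event back to the other; hence all common types are equally likely.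
    have hg := measurePreserving_apply_at (measurePreserving_permTypes P (Equiv.swap v w)) n
    have hDv : MeasurableSet (D ∩ {e | (e n 0).2 0 = v}) :=
      hD.inter (hu (measurableSet_singleton v))
    rw [← hg.measure_preimage hDv.nullMeasurableSet]
    congr 1
    ext e
    simp only [mem_inter_iff, mem_preimage, mem_ofPred_eq, if_true]
    have hmem : ∀ (σ : Equiv.Perm (Fin V)) {e : ℕ → Env J V}, e ∈ D →
        (fun i => (if i = n then permTypes σ else id) (e i)) ∈ D := fun σ e he => by
      refine hblock e _ he (fun k hk => by rw [if_neg hk.ne]; rfl) (fun v => ?_) ?_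
      · simp only [if_true]; rfl
      · simp only [if_true]; exact isNeck_permTypes (hneck e he)
    refine and_congr ⟨hmem _, fun h => ?_⟩ ?_
    · have := hmem (Equiv.swap v w) h
      convert this using 1
      funext i
      by_cases hi : i = n
      · simp only [hi, if_true]
        funext u
        refine Prod.ext rfl ?_
        funext k
        simp [permTypes]
      · simp [hi]
    · change _ ↔ Equiv.swap v w ((e n 0).2 0) = v
      rw [Equiv.swap_apply_eq_iff, Equiv.swap_apply_left]
  have hsum := measure_eq_sum_inter hD hu (Measure.infinitePi fun _ => envLaw P V)
  have hV : (V : ℝ≥0∞) ≠ 0 := by simp [NeZero.ne V]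
  have hsum' : Measure.infinitePi (fun _ => envLaw P V) D =
      V * Measure.infinitePi (fun _ => envLaw P V) (D ∩ {e | (e n 0).2 0 = v}) := by
    rw [hsum]
    refine (Finset.sum_congr rfl fun w _ => heq w).trans ?_
    simp
  rw [hsum', mul_comm, ← mul_assoc, ENNReal.inv_mul_cancel hV (ENNReal.natCast_ne_top V), one_mul]

omit hN in
-- For a fixed common type the event becomes, after splicing at `n + 1`, a product of conditions on
-- earlier and later environments. The factor 1/V of the type matches the uniform ancestor in
-- `treeLaw`.
theorem IsBlockSet.measure_inter_shift {n : ℕ} {D : Set (ℕ → Env J V)} (hD : MeasurableSet D)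
    (hneck : ∀ e ∈ D, IsNeck F (e n)) (hblock : IsBlockSet F n D) {B : Set (VTree J V)}
    (hB : MeasurableSet B) :
    Measure.infinitePi (fun _ => envLaw P V)
        (D ∩ {e | (((e n 0).2 0, fun k => e (n + 1 + k)) : VTree J V) ∈ B}) =
      Measure.infinitePi (fun _ => envLaw P V) D * treeLaw P V B := by
  have hu : Measurable fun e : ℕ → Env J V => (e n 0).2 0 := by fun_prop
  have hs : Measurable fun e : ℕ → Env J V => (fun k => e (n + 1 + k) : ℕ → Env J V) := by fun_prop
  have hDB : MeasurableSet
      (D ∩ {e | (((e n 0).2 0, fun k => e (n + 1 + k)) : VTree J V) ∈ B}) :=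
    hD.inter ((hu.prodMk hs) hB)
  rw [measure_eq_sum_inter hDB hu, treeLaw, Measure.prod_apply hB, lintegral_unifType,
    Finset.mul_sum]
  refine Finset.sum_congr rfl fun v _ => ?_
  have hg := measurePreserving_spliceSeq (envLaw P V) (n + 1)
  have hpre : spliceSeq (n + 1) ⁻¹'
      (D ∩ {e | (((e n 0).2 0, fun k => e (n + 1 + k)) : VTree J V) ∈ B} ∩
        (fun e : ℕ → Env J V => (e n 0).2 0) ⁻¹' {v}) =
      (D ∩ {e | (e n 0).2 0 = v}) ×ˢ (Prod.mk v ⁻¹' B) := by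
    ext ⟨x, y⟩
    have hlt : ∀ k < n + 1, spliceSeq (n + 1) (x, y) k = x k := fun k hk => if_pos hk
    have hge : (fun k => spliceSeq (n + 1) (x, y) (n + 1 + k)) = y := by
      funext k
      simp only [spliceSeq]
      rw [if_neg (by omega), Nat.add_sub_cancel_left]
    have hDiff : spliceSeq (n + 1) (x, y) ∈ D ↔ x ∈ D := by
      constructor
      · intro h
        refine hblock _ _ h (fun k hk => hlt k (by omega)) (fun v => by rw [hlt n (by omega)]) ?_
        rw [← hlt n (by omega)]
        exact hneck _ h
      · intro h
        refine hblock _ _ h (fun k hk => (hlt k (by omega)).symm)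
          (fun v => by rw [hlt n (by omega)]) ?_
        rw [hlt n (by omega)]
        exact hneck _ h
    simp only [mem_preimage, mem_inter_iff, mem_ofPred_eq, mem_prod, mem_singleton_iff, hge,
      hlt n (by omega), hDiff]
    constructor
    · rintro ⟨⟨h1, h2⟩, rfl⟩
      exact ⟨⟨h1, rfl⟩, h2⟩
    · rintro ⟨⟨h1, rfl⟩, h2⟩
      exact ⟨⟨h1, h2⟩, rfl⟩
  rw [← hg.measure_preimage (hDB.inter (hu (measurableSet_singleton v))).nullMeasurableSet, hpre,
    Measure.prod_prod, hblock.measure_inter_type P hD hneck v]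
  ring

/-- The tree above the first neck has the law of the whole tree and is independent of the block
below it. -/
theorem treeLaw_inter_regen {M : ℕ} (hM : ∀ j, F.N j ≤ M) {A B : Set (VTree J V)}
    (hA : MeasurableSet A) (hB : MeasurableSet B)
    (hblock : ∀ τ n, IsBlockSet F n (firstNeckAt F n ∩ {e | (τ, e) ∈ A})) :
    treeLaw P V (A ∩ regen F ⁻¹' B) = treeLaw P V A * treeLaw P V B := by
  have hAn : ∀ n, MeasurableSet (A ∩ Prod.snd ⁻¹' firstNeckAt F n) := fun n =>
    hA.inter (measurable_snd (measurableSet_firstNeckAt hN n))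
  have hBm : MeasurableSet (regen F ⁻¹' B : Set (VTree J V)) := measurable_regen hN hB
  have hdisj : ∀ S : Set (VTree J V), Pairwise
      (Function.onFun Disjoint fun n => S ∩ Prod.snd ⁻¹' firstNeckAt F n) := fun S n m hnm =>
    ((firstNeckAt_disjoint F hnm).preimage _).mono inter_subset_right inter_subset_right
  -- Almost every tree has exactly one first neck, so events split over its position, and at a fixed
  -- position `IsBlockSet.measure_inter_shift` applies.
  have hunion : ∀ S : Set (VTree J V), MeasurableSet S →
      treeLaw P V S = ∑' n, treeLaw P V (S ∩ Prod.snd ⁻¹' firstNeckAt F n) := fun S hS => by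
    rw [← measure_iUnion (hdisj S)
      fun n => hS.inter (measurable_snd (measurableSet_firstNeckAt hN n))]
    refine measure_congr ?_
    filter_upwards [ae_exists_isNeck hN P hM] with ω hω
    refine propext ⟨fun h => ?_, fun h => ?_⟩
    · obtain ⟨n, hn⟩ := exists_mem_firstNeckAt F hω
      exact mem_iUnion.2 ⟨n, h, hn⟩
    · obtain ⟨n, hn⟩ := mem_iUnion.1 h
      exact hn.1
  rw [hunion _ (hA.inter hBm), hunion A hA, ← ENNReal.tsum_mul_right]
  refine tsum_congr fun n => ?_
  rw [treeLaw, Measure.prod_apply ((hA.inter hBm).inter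
    (measurable_snd (measurableSet_firstNeckAt hN n))), Measure.prod_apply (hAn n),
    ← lintegral_mul_const _ (measurable_measure_prodMk_left (hAn n))]
  refine lintegral_congr fun τ => ?_
  have h1 : Prod.mk τ ⁻¹' (A ∩ Prod.snd ⁻¹' firstNeckAt F n) =
      firstNeckAt F n ∩ {e | (τ, e) ∈ A} := by
    ext e; exact and_comm
  have h2 : Prod.mk τ ⁻¹' (A ∩ regen F ⁻¹' B ∩ Prod.snd ⁻¹' firstNeckAt F n) =
      firstNeckAt F n ∩ {e | (τ, e) ∈ A} ∩
        {e | (((e n 0).2 0, fun k => e (n + 1 + k)) : VTree J V) ∈ B} := by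
    ext e
    have h3 : e ∈ firstNeckAt F n →
        regen F (τ, e) = ((e n 0).2 0, fun k => e (n + 1 + k)) := fun he => by
      simp only [regen, firstNeck_of_mem F he, Nat.add_sub_cancel]
    constructor
    · rintro ⟨⟨hA', hB'⟩, hn⟩
      refine ⟨⟨hn, hA'⟩, ?_⟩
      have hB' : regen F (τ, e) ∈ B := hB'
      rwa [h3 hn] at hB'
    · rintro ⟨⟨hn, hA'⟩, hB'⟩
      refine ⟨⟨hA', ?_⟩, hn⟩
      change regen F (τ, e) ∈ B
      rwa [h3 hn]
  rw [h1, h2]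
  refine (hblock τ n).measure_inter_shift P ?_ (fun e he => he.1.1) hB
  exact (measurableSet_firstNeckAt hN n).inter (measurable_prodMk_left hA)

omit hN [NeZero V] [MeasurableSpace J] in
theorem mem_firstNeckAt_of_agree {n : ℕ} {e e' : ℕ → Env J V} (he : e ∈ firstNeckAt F n)
    (h : ∀ k < n, e k = e' k) (h' : IsNeck F (e' n)) : e' ∈ firstNeckAt F n :=
  ⟨h', fun k hk => h k hk ▸ he.2 k hk⟩

/-- This is `treeLaw_inter_regen` with the trivial event for the block. -/
theorem measurePreserving_regen {M : ℕ} (hM : ∀ j, F.N j ≤ M) :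
    MeasurePreserving (regen F) (treeLaw P V) (treeLaw P V) := by
  refine ⟨measurable_regen hN, Measure.ext fun B hB => ?_⟩
  rw [Measure.map_apply (measurable_regen hN) hB]
  have := treeLaw_inter_regen hN P hM MeasurableSet.univ hB fun τ n e e' he h _ h' =>
    ⟨mem_firstNeckAt_of_agree he.1 h h', mem_univ _⟩
  rwa [univ_inter, measure_univ, one_mul] at this

/-- The law of large numbers for functionals of the block below the first neck. -/
theorem ae_tendsto_average {M : ℕ} (hM : ∀ j, F.N j ≤ M) {G : VTree J V → ℝ} (hG : Measurable G)
    (hint : Integrable G (treeLaw P V))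
    (hblock : ∀ (τ : Fin V) (n : ℕ) (e e' : ℕ → Env J V), e ∈ firstNeckAt F n →
      e' ∈ firstNeckAt F n → (∀ k < n, e k = e' k) → (∀ v, (e n v).1 = (e' n v).1) →
        G (τ, e) = G (τ, e')) :
    ∀ᵐ ω ∂(treeLaw P V), Tendsto (fun n : ℕ => (∑ l ∈ Finset.range n, G ((regen F)^[l] ω)) / n)
      atTop (𝓝 (∫ ω, G ω ∂(treeLaw P V))) := by
  have hR := measurePreserving_regen hN P (V := V) hM
  -- The strong law needs pairwise independence only. Since the iterates of `regen` preserve the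
  -- law, the earlier index may be moved to 0, where a block functional meets a functional of the
  -- tree above the first neck.
  have hindep : ∀ i j, i < j → ProbabilityTheory.IndepFun (fun ω => G ((regen F)^[i] ω))
      (fun ω => G ((regen F)^[j] ω)) (treeLaw P V) := fun i j hij => by
    rw [ProbabilityTheory.indepFun_iff_measure_inter_preimage_eq_mul]
    intro s t hs ht
    have hi := hR.iterate i
    have ht' : MeasurableSet ((fun ω => G ((regen F)^[j - i - 1] ω)) ⁻¹' t) :=
      (hG.comp (hR.iterate _).measurable) ht
    have hj : (fun ω => G ((regen F)^[j] ω)) ⁻¹' t = (regen F)^[i] ⁻¹'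
        (regen F ⁻¹' ((fun ω => G ((regen F)^[j - i - 1] ω)) ⁻¹' t)) := by
      ext ω
      simp only [mem_preimage]
      rw [← Function.iterate_succ_apply, ← Function.iterate_add_apply,
        show (j - i - 1).succ + i = j by omega]
    have hi' : (fun ω => G ((regen F)^[i] ω)) ⁻¹' s = (regen F)^[i] ⁻¹' (G ⁻¹' s) := rfl
    rw [hj, hi', ← preimage_inter,
      hi.measure_preimage ((hG hs).inter (hR.measurable ht')).nullMeasurableSet,
      hi.measure_preimage (hG hs).nullMeasurableSet,
      hi.measure_preimage (hR.measurable ht').nullMeasurableSet,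
      hR.measure_preimage ht'.nullMeasurableSet]
    refine treeLaw_inter_regen hN P hM (hG hs) ht' fun τ n e e' he h hi h' => ?_
    have he' := mem_firstNeckAt_of_agree he.1 h h'
    refine ⟨he', ?_⟩
    change G (τ, e') ∈ s
    rw [← hblock τ n e e' he.1 he' h hi]
    exact he.2
  refine ProbabilityTheory.strong_law_ae_real (fun l ω => G ((regen F)^[l] ω)) hint
    (fun i j hij => ?_) fun i => ?_
  · rcases lt_or_gt_of_ne hij with h | h
    · exact hindep i j h
    · exact (hindep j i h).symm
  · refine ⟨(hG.comp (hR.iterate i).measurable).aemeasurable, hG.aemeasurable, ?_⟩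
    have : (fun ω => G ((regen F)^[i] ω)) = G ∘ (regen F)^[i] := rfl
    rw [this, ← Measure.map_map hG (hR.iterate i).measurable, (hR.iterate i).map_eq]
    rfl

end Regeneration

end VCantor
end

noncomputable section

namespace VCantor

/-! ### Logarithms of level sums -/

section LogLevelSum

variable {J : Type*} {V : ℕ} {a b : ℝ} {F : IFSFamily J a b} {M : ℕ} {lo hi : ℝ}
  (hF : F.Bounds M lo hi)
include hF

theorem IFSFamily.Bounds.two_le (ω : VTree J V) : 2 ≤ M :=
  (F.two_le_N ω.index).trans (hF.N_le _)

theorem IFSFamily.Bounds.lo_lt_one (ω : VTree J V) : lo < 1 := (hF.lo_le_hi ω).trans_lt hF.hi_lt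

theorem log_levelSum_le_of_le {x y : ℝ} (hxy : x ≤ y) (n : ℕ) (ω : VTree J V) :
    Real.log (levelSum F y n ω) ≤
      Real.log (levelSum F x n ω) - n * ((y - x) * -Real.log (hi ^ 2)) := by
  have hpos : (0 : ℝ) < hi ^ 2 := pow_pos (hF.hi_pos ω) 2
  have hρ : 0 < ((hi ^ 2) ^ (y - x)) ^ n := pow_pos (Real.rpow_pos_of_pos hpos _) _
  have h := Real.log_le_log (levelSum_pos F y n ω) (levelSum_le_of_le hF hxy n ω)
  rw [Real.log_mul hρ.ne' (levelSum_pos F x n ω).ne', Real.log_pow, Real.log_rpow hpos] at h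
  linarith

theorem le_log_levelSum_of_le {x y : ℝ} (hxy : x ≤ y) (n : ℕ) (ω : VTree J V) :
    Real.log (levelSum F x n ω) - n * ((y - x) * -Real.log (lo ^ 2)) ≤
      Real.log (levelSum F y n ω) := by
  have hpos : (0 : ℝ) < lo ^ 2 := pow_pos hF.lo_pos 2
  have hρ : 0 < ((lo ^ 2) ^ (y - x)) ^ n := pow_pos (Real.rpow_pos_of_pos hpos _) _
  have h := Real.log_le_log (mul_pos hρ (levelSum_pos F x n ω)) (le_levelSum_of_le hF hxy n ω)
  rw [Real.log_mul hρ.ne' (levelSum_pos F x n ω).ne', Real.log_pow, Real.log_rpow hpos] at h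
  linarith

theorem log_levelSum_le {x : ℝ} (hx : 0 ≤ x) (n : ℕ) (ω : VTree J V) :
    Real.log (levelSum F x n ω) ≤ n * Real.log M := by
  rw [← Real.log_pow]
  exact Real.log_le_log (levelSum_pos F x n ω) (levelSum_le_pow hF hx n ω)

theorem log_levelSum_one_le (n : ℕ) (ω : VTree J V) :
    Real.log (levelSum F 1 n ω) ≤ n * Real.log hi := by
  rw [← Real.log_pow]
  exact Real.log_le_log (levelSum_pos F 1 n ω) (levelSum_one_le hF n ω)

theorem le_log_levelSum {x : ℝ} (hx : 0 ≤ x) (n : ℕ) (ω : VTree J V) :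
    n * (Real.log 2 - x * -Real.log (lo ^ 2)) ≤ Real.log (levelSum F x n ω) := by
  have h1 := le_log_levelSum_of_le hF hx n ω
  have h2 := Real.log_le_log (by positivity) (two_pow_le_levelSum_zero F n ω)
  rw [Real.log_pow] at h2
  rw [sub_zero] at h1
  linarith

end LogLevelSum

/-! ### The exponent function and its zero -/

section Exponent

variable {J : Type*} {V : ℕ} {a b : ℝ} {F : IFSFamily J a b} {M : ℕ} {lo hi : ℝ}
  [NeZero V] [MeasurableSpace J]
  (hF : F.Bounds M lo hi) (hN : Measurable F.N) (hr : ∀ i, Measurable fun j => F.r j i)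
  (hm : ∀ i, Measurable fun j => F.m j i) (P : Measure J) [IsProbabilityMeasure P]
include hF hN hr hm

/-- The logarithm of a level sum is bounded by a multiple of the level, and `firstNeck` is
integrable. -/
theorem integrable_logNeckSum {x : ℝ} (hx : 0 ≤ x) :
    Integrable (logNeckSum F x) (treeLaw P V) := by
  refine ((integrable_firstNeck hN P hF.N_le).mul_const
    (Real.log M + x * -Real.log (lo ^ 2))).mono'
    (measurable_logNeckSum hN hr hm hF.N_le x).aestronglyMeasurable (.of_forall fun ω => ?_)
  have h1 : logNeckSum F x ω ≤ firstNeck F ω * Real.log M := log_levelSum_le hF hx _ ω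
  have h2 : firstNeck F ω * (Real.log 2 - x * -Real.log (lo ^ 2)) ≤ logNeckSum F x ω :=
    le_log_levelSum hF hx _ ω
  have hM : (1 : ℝ) ≤ M := by exact_mod_cast one_le_two.trans (hF.two_le ω)
  have h3 : 0 ≤ firstNeck F ω * Real.log M := mul_nonneg (Nat.cast_nonneg _) (Real.log_nonneg hM)
  have h4 : 0 ≤ firstNeck F ω * (x * -Real.log (lo ^ 2)) := by
    refine mul_nonneg (Nat.cast_nonneg _) (mul_nonneg hx (neg_nonneg.2 ?_))
    exact Real.log_nonpos (sq_nonneg _) (pow_le_one₀ hF.lo_pos.le (hF.lo_lt_one ω).le)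
  have h5 : 0 ≤ firstNeck F ω * Real.log 2 :=
    mul_nonneg (Nat.cast_nonneg _) (Real.log_nonneg one_le_two)
  rw [Real.norm_eq_abs, abs_le]
  constructor <;> nlinarith

/-- Integrating the bounds for `levelSum` over the first block shows that f decreases with slope
between two negative constants, is positive near 0 and negative at 1; the intermediate value theorem
gives the zero. -/
theorem exists_exponent : ∃ γ : ℝ, 0 < γ ∧ (∫ ω, logNeckSum F γ ω ∂(treeLaw P V)) = 0 ∧
    (∀ x, 0 < x → x < γ → 0 < ∫ ω, logNeckSum F x ω ∂(treeLaw P V)) ∧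
    ∀ x, γ < x → (∫ ω, logNeckSum F x ω ∂(treeLaw P V)) < 0 := by
  have := nonempty_of_isProbabilityMeasure P
  -- Some tree is needed to deduce `0 < hi` and `lo < 1` from the bounds, which are void for empty
  -- `J`.
  let ω₀ : VTree J V := ⟨0, fun _ _ => (Classical.arbitrary J, 0)⟩
  have hint : ∀ {x : ℝ}, 0 ≤ x → Integrable (logNeckSum F x) (treeLaw P V) := fun hx =>
    integrable_logNeckSum hF hN hr hm P hx
  have hn := integrable_firstNeck hN P hF.N_le (V := V)
  set f : ℝ → ℝ := fun x => ∫ ω, logNeckSum F x ω ∂(treeLaw P V) with hf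
  set E : ℝ := ∫ ω, (firstNeck F ω : ℝ) ∂(treeLaw P V) with hE
  have hE1 : 1 ≤ E := by
    have : ∫ _, (1 : ℝ) ∂(treeLaw P V) ≤ E := by
      refine integral_mono_ae (integrable_const _) hn ?_
      filter_upwards [ae_exists_isNeck hN P hF.N_le] with ω hω
      exact_mod_cast firstNeck_pos hω
    simpa using this
  set c := -Real.log (hi ^ 2) with hc
  set C := -Real.log (lo ^ 2) with hC
  have hcpos : 0 < c := by
    refine neg_pos.2 (Real.log_neg (pow_pos (hF.hi_pos ω₀) 2) ?_)
    exact pow_lt_one₀ (hF.hi_pos ω₀).le hF.hi_lt two_ne_zero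
  have hCpos : 0 < C := by
    refine neg_pos.2 (Real.log_neg (pow_pos hF.lo_pos 2) ?_)
    exact pow_lt_one₀ hF.lo_pos.le (hF.lo_lt_one ω₀) two_ne_zero
  have hupper : ∀ x y, 0 ≤ x → x ≤ y → f y ≤ f x - E * ((y - x) * c) := fun x y hx hxy => by
    rw [hE, ← integral_mul_const, ← integral_sub (hint hx) (hn.mul_const _)]
    exact integral_mono (hint (hx.trans hxy)) ((hint hx).sub (hn.mul_const _))
      fun ω => log_levelSum_le_of_le hF hxy _ ω
  have hlower : ∀ x y, 0 ≤ x → x ≤ y → f x - E * ((y - x) * C) ≤ f y := fun x y hx hxy => by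
    rw [hE, ← integral_mul_const, ← integral_sub (hint hx) (hn.mul_const _)]
    exact integral_mono ((hint hx).sub (hn.mul_const _)) (hint (hx.trans hxy))
      fun ω => le_log_levelSum_of_le hF hxy _ ω
  have hpos : ∀ x, 0 ≤ x → E * (Real.log 2 - x * C) ≤ f x := fun x hx => by
    rw [hE, ← integral_mul_const]
    exact integral_mono (hn.mul_const _) (hint hx) fun ω => le_log_levelSum hF hx _ ω
  have hone : f 1 < 0 := by
    have : f 1 ≤ E * Real.log hi := by
      rw [hE, ← integral_mul_const]
      exact integral_mono (hint zero_le_one) (hn.mul_const _) fun ω => log_levelSum_one_le hF _ ω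
    refine this.trans_lt (mul_neg_of_pos_of_neg (by linarith) ?_)
    exact Real.log_neg (hF.hi_pos ω₀) hF.hi_lt
  have hanti : ∀ x y, 0 ≤ x → x < y → f y < f x := fun x y hx hxy => by
    have h1 := hupper x y hx hxy.le
    have h2 : 0 < E * ((y - x) * c) := mul_pos (by linarith) (mul_pos (by linarith) hcpos)
    linarith
  have hlog2 : 0 < Real.log 2 := Real.log_pos one_lt_two
  -- With this choice `x₀ * C` is at most half of `Real.log 2`, so the lower bound in `hpos` is
  -- positive.
  set x₀ : ℝ := min 1 (Real.log 2 / (2 * C)) with hx₀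
  have hx₀pos : 0 < x₀ := lt_min one_pos (by positivity)
  have hfx₀ : 0 < f x₀ := by
    refine lt_of_lt_of_le (mul_pos (by linarith) ?_) (hpos x₀ hx₀pos.le)
    have h1 : x₀ * C ≤ Real.log 2 / (2 * C) * C :=
      mul_le_mul_of_nonneg_right (min_le_right _ _) hCpos.le
    have h2 : Real.log 2 / (2 * C) * C = Real.log 2 / 2 := by field_simp
    linarith
  have hcont : ContinuousOn f (Icc x₀ 1) := by
    have hlip : ∀ x ∈ Icc x₀ 1, ∀ y ∈ Icc x₀ 1, x ≤ y → dist (f x) (f y) ≤ E * C * dist x y := by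
      intro x hx y hy hxy
      have h1 := hlower x y (hx₀pos.le.trans hx.1) hxy
      have h2 := hupper x y (hx₀pos.le.trans hx.1) hxy
      have h3 : 0 ≤ E * ((y - x) * c) :=
        mul_nonneg (by linarith) (mul_nonneg (by linarith) hcpos.le)
      rw [Real.dist_eq, Real.dist_eq, abs_of_nonneg (by linarith), abs_sub_comm,
        abs_of_nonneg (by linarith)]
      linarith
    have hEC : 0 ≤ E * C := mul_nonneg (by linarith) hCpos.le
    refine (LipschitzOnWith.of_dist_le_mul (K := ⟨E * C, hEC⟩) fun x hx y hy => ?_).continuousOn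
    rcases le_total x y with h | h
    · exact hlip x hx y hy h
    · rw [dist_comm, dist_comm x]
      exact hlip y hy x hx h
  obtain ⟨γ, hγ, hγ0⟩ := intermediate_value_Icc' (min_le_left _ _) hcont ⟨hone.le, hfx₀.le⟩
  have hγpos := hx₀pos.trans_le hγ.1
  exact ⟨γ, hγpos, hγ0, fun x hx hxγ => hγ0 ▸ hanti x γ hx.le hxγ,
    fun x hxγ => hγ0 ▸ hanti γ x hγpos.le hxγ⟩

end Exponent

/-! ### Growth of level sums along the necks -/

section NeckLevels

variable {J : Type*} {V : ℕ} {a b : ℝ} {F : IFSFamily J a b} {M : ℕ} {lo hi : ℝ}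

theorem exists_le_lt_succ {p : ℕ → ℕ} (hp : StrictMono p) (h0 : p 0 = 0) (n : ℕ) :
    ∃ k, p k ≤ n ∧ n < p (k + 1) := by
  induction n with
  | zero => exact ⟨0, h0.le, h0.symm.trans_lt (hp (Nat.lt_succ_self 0))⟩
  | succ n ih =>
    obtain ⟨k, hk, hk'⟩ := ih
    rcases (Nat.succ_le_of_lt hk').lt_or_eq with h | h
    · exact ⟨k, hk.trans n.le_succ, h⟩
    · exact ⟨k + 1, h.ge, h.trans_lt (hp (Nat.lt_succ_self _))⟩

/-- From the last level `p k` at or before `n`, the sum grows by at most the factor `M` per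
generation. -/
theorem levelSum_le_of_levels (hF : F.Bounds M lo hi) {x C : ℝ} (hx : 0 ≤ x) {ω : VTree J V}
    {p : ℕ → ℕ} (hp : StrictMono p) (h0 : p 0 = 0)
    (hC : ∀ k, (M : ℝ) ^ (p (k + 1) - p k) * levelSum F x (p k) ω ≤ C) (n : ℕ) :
    levelSum F x n ω ≤ C := by
  obtain ⟨k, hk, hk'⟩ := exists_le_lt_succ hp h0 n
  have hM : (1 : ℝ) ≤ M := by exact_mod_cast one_le_two.trans (hF.two_le ω)
  have h := levelSum_add_le hF hx (p k) (n - p k) ω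
  rw [Nat.add_sub_cancel' hk] at h
  refine h.trans (le_trans ?_ (hC k))
  exact mul_le_mul_of_nonneg_right (pow_le_pow_right₀ hM (by omega)) (levelSum_pos F x _ ω).le

/-- From the first chosen neck beyond w on, the subtree of w and the whole tree have the same
continuation, which cancels in the ratio of their level sums. What remains is at most M^gap over the
level sum at that neck, hence at most `C`. Inserting this into `IsCut.sum_mul_levelSum` gives the
claim. -/
theorem IsCut.one_le_sum_rpow [NeZero V] (hF : F.Bounds M lo hi) {x C : ℝ} (hx : 0 ≤ x)
    {ω : VTree J V} {p : ℕ → ℕ} (hp : StrictMono p) (h0 : p 0 = 0)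
    (hneck : ∀ k, IsNeckLevel F ω (p (k + 1)))
    (hC : ∀ k, (M : ℝ) ^ (p (k + 1) - p k) ≤ C * levelSum F x (p (k + 1)) ω)
    {A : Finset (List ℕ)} (hA : IsCut F ω A) : 1 ≤ C * ∑ w ∈ A, weight F ω w ^ x := by
  have hM : (1 : ℝ) ≤ M := by exact_mod_cast one_le_two.trans (hF.two_le ω)
  choose k hk hk' using fun w : List ℕ => exists_le_lt_succ hp h0 w.length
  -- Any level not before the next chosen neck of every member of the cut would do.
  set n := ∑ w ∈ A, p (k w + 1)
  have hpn : ∀ w ∈ A, p (k w + 1) ≤ n := fun w hw =>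
    Finset.single_le_sum (f := fun w => p (k w + 1)) (fun _ _ => Nat.zero_le _) hw
  have hsum := hA.sum_mul_levelSum x n fun w hw => (hk' w).le.trans (hpn w hw)
  have hbound : ∀ w ∈ A, levelSum F x (n - w.length) (subAlong ω w) ≤ C * levelSum F x n ω := by
    intro w hw
    obtain ⟨q, hq, hqneck⟩ := hneck (k w)
    have hlt := hk' w
    have hle := hk w
    have hqn := hpn w hw
    obtain ⟨d, hd⟩ : ∃ d, q = w.length + d := ⟨q - w.length, by omega⟩
    obtain ⟨l, hl⟩ : ∃ l, n = q + 1 + l := ⟨n - (q + 1), by omega⟩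
    have hsnd : ∀ i, (subAlong ω w).2 i = ω.2 (w.length + i) := fun i => by
      rw [subAlong_snd, add_comm]
    have hneck' : IsNeck F ((subAlong ω w).2 d) := by rwa [hsnd, ← hd]
    have h1 := levelSum_add_of_isNeck F x hqneck l
    have h2 := levelSum_add_of_isNeck F x hneck' l
    have htree : ((((subAlong ω w).2 d 0).2 0, fun k => (subAlong ω w).2 (d + 1 + k)) : VTree J V) =
        ((ω.2 q 0).2 0, fun k => ω.2 (q + 1 + k)) := by
      refine Prod.ext ?_ ?_
      · simp only [hsnd, ← hd]
      · funext i
        simp only [hsnd]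
        rw [show w.length + (d + 1 + i) = q + 1 + i by omega]
    rw [htree] at h2
    rw [show n - w.length = d + 1 + l by omega, h2, hl, h1, ← mul_assoc]
    refine mul_le_mul_of_nonneg_right ?_ (levelSum_pos F x l _).le
    refine (levelSum_le_pow hF hx (d + 1) _).trans (le_trans ?_ (hq ▸ hC (k w)))
    exact pow_le_pow_right₀ hM (by omega)
  have hpos := levelSum_pos F x n ω
  have h : levelSum F x n ω ≤ (∑ w ∈ A, weight F ω w ^ x) * (C * levelSum F x n ω) := by
    conv_lhs => rw [← hsum]
    rw [Finset.sum_mul]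
    refine Finset.sum_le_sum fun w hw => mul_le_mul_of_nonneg_left (hbound w hw) ?_
    exact Real.rpow_nonneg (weight_pos F (hA.mem_generation w hw)).le _
  refine le_of_mul_le_mul_right ?_ hpos
  linarith

variable [NeZero V]

/-- The level of the `k`-th neck. -/
def neckLevel (F : IFSFamily J a b) (ω : VTree J V) (k : ℕ) : ℕ :=
  ∑ l ∈ Finset.range k, firstNeck F ((regen F)^[l] ω)

theorem neckLevel_succ (ω : VTree J V) (k : ℕ) :
    neckLevel F ω (k + 1) = firstNeck F ω + neckLevel F (regen F ω) k := by
  rw [neckLevel, Finset.sum_range_succ', add_comm]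
  rfl

omit [NeZero V] in
theorem isNeckLevel_firstNeck {ω : VTree J V} (h : ∃ k, IsNeck F (ω.2 k)) :
    IsNeckLevel F ω (firstNeck F ω) := by
  obtain ⟨k, hk⟩ := h
  exact Nat.sInf_mem (s := {n | IsNeckLevel F ω n}) ⟨k + 1, k, rfl, hk⟩

theorem isNeckLevel_neckLevel (k : ℕ) : ∀ {ω : VTree J V},
    (∀ l, ∃ k, IsNeck F (((regen F)^[l] ω).2 k)) → IsNeckLevel F ω (neckLevel F ω (k + 1)) := by
  induction k with
  | zero =>
    intro ω h
    simpa [neckLevel] using isNeckLevel_firstNeck (h 0)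
  | succ k ih =>
    intro ω h
    obtain ⟨q, hq, hneck⟩ := ih (ω := regen F ω) fun l => h (l + 1)
    rw [neckLevel_succ, hq]
    exact ⟨firstNeck F ω + q, rfl, hneck⟩

/-- The level sum factorises at each neck, so the logarithm is an orbit sum of `regen`, ready for
the law of large numbers. -/
theorem log_levelSum_neckLevel (x : ℝ) (k : ℕ) : ∀ {ω : VTree J V},
    (∀ l, ∃ k, IsNeck F (((regen F)^[l] ω).2 k)) →
    Real.log (levelSum F x (neckLevel F ω k) ω) =
      ∑ l ∈ Finset.range k, logNeckSum F x ((regen F)^[l] ω) := by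
  induction k with
  | zero => intro ω _; simp [neckLevel]
  | succ k ih =>
    intro ω h
    obtain ⟨q, hq, hneck⟩ := isNeckLevel_firstNeck (h 0)
    have hq : firstNeck F ω = q + 1 := hq
    have hneck : IsNeck F (ω.2 q) := hneck
    have hregen : (((ω.2 q 0).2 0, fun k => ω.2 (q + 1 + k)) : VTree J V) = regen F ω := by
      rw [regen, hq, Nat.add_sub_cancel]
    rw [neckLevel_succ, hq, levelSum_add_of_isNeck F x hneck, hregen,
      Real.log_mul (levelSum_pos F x _ _).ne' (levelSum_pos F x _ _).ne',
      ih (ω := regen F ω) fun l => h (l + 1), Finset.sum_range_succ', add_comm, ← hq]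
    rfl

theorem strictMono_neckLevel {ω : VTree J V} (h : ∀ l, ∃ k, IsNeck F (((regen F)^[l] ω).2 k)) :
    StrictMono (neckLevel F ω) := by
  refine strictMono_nat_of_lt_succ fun k => ?_
  rw [neckLevel, neckLevel, Finset.sum_range_succ]
  have := firstNeck_pos (h k)
  omega

/-- Sequences of linear growth have increments o(k). Applied to neck levels, this makes the factors
M^gap subexponential in k. -/
theorem tendsto_gap {u : ℕ → ℝ} {E : ℝ} (h : Tendsto (fun k : ℕ => u k / k) atTop (𝓝 E)) :
    Tendsto (fun k : ℕ => (u (k + 1) - u k) / k) atTop (𝓝 0) := by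
  have h1 : Tendsto (fun k : ℕ => u (k + 1) / ((k + 1 : ℕ) : ℝ)) atTop (𝓝 E) :=
    h.comp (tendsto_add_atTop_nat 1)
  have h2 : Tendsto (fun k : ℕ => 1 + 1 / (k : ℝ)) atTop (𝓝 (1 + 0)) :=
    tendsto_const_nhds.add tendsto_one_div_atTop_nhds_zero_nat
  have h3 := (h1.mul h2).sub h
  rw [add_zero, mul_one, sub_self] at h3
  refine h3.congr' ?_
  filter_upwards [eventually_gt_atTop 0] with k hk
  have : (k : ℝ) ≠ 0 := by exact_mod_cast hk.ne'
  push_cast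
  field_simp

theorem exists_le_of_eventually_le {u : ℕ → ℝ} {c : ℝ} (h : ∀ᶠ k in atTop, u k ≤ c) :
    ∃ C, ∀ k, u k ≤ C := by
  obtain ⟨C, hC⟩ := (isBoundedUnder_of_eventually_le h).bddAbove_range
  exact ⟨C, fun k => hC (mem_range_self k)⟩

/-- The facts about a tree that are provided by the law of large numbers. -/
structure HasAverages (F : IFSFamily J a b) (ω : VTree J V) (x L : ℝ) : Prop where
  necks : ∀ l, ∃ k, IsNeck F (((regen F)^[l] ω).2 k)
  level : ∃ E, Tendsto (fun k : ℕ => (neckLevel F ω k : ℝ) / k) atTop (𝓝 E)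
  sums : Tendsto (fun k : ℕ => Real.log (levelSum F x (neckLevel F ω k) ω) / k) atTop (𝓝 L)

theorem HasAverages.gap_mul {ω : VTree J V} {x L : ℝ} (h : HasAverages F ω x L) (K : ℝ) :
    Tendsto (fun k : ℕ => ((neckLevel F ω (k + 1) - neckLevel F ω k : ℕ) : ℝ) * K / k)
      atTop (𝓝 0) := by
  obtain ⟨E, hE⟩ := h.level
  have h1 := (tendsto_gap (u := fun k => (neckLevel F ω k : ℝ)) hE).mul_const K
  rw [zero_mul] at h1
  refine h1.congr fun k => ?_
  rw [Nat.cast_sub ((strictMono_neckLevel h.necks).monotone k.le_succ)]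
  ring

/-- At the k-th neck the level sum decays like exp(L k), which beats the factor M^gap for the
generations up to the next neck. -/
theorem HasAverages.exists_levelSum_le (hF : F.Bounds M lo hi) {x L : ℝ} (hx : 0 ≤ x)
    {ω : VTree J V} (h : HasAverages F ω x L) (hL : L < 0) : ∃ C, ∀ n, levelSum F x n ω ≤ C := by
  have hM : (0 : ℝ) < M := by exact_mod_cast zero_lt_two.trans_le (hF.two_le ω)
  have h1 := (h.gap_mul (Real.log M)).add h.sums
  rw [zero_add] at h1
  obtain ⟨C, hC⟩ : ∃ C, ∀ k, (M : ℝ) ^ (neckLevel F ω (k + 1) - neckLevel F ω k) *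
      levelSum F x (neckLevel F ω k) ω ≤ C := by
    refine exists_le_of_eventually_le (c := 1) ?_
    filter_upwards [h1.eventually_lt_const hL, eventually_gt_atTop 0] with k hk hk0
    have hk0 : (0 : ℝ) < k := by exact_mod_cast hk0
    have hp := pow_pos hM (neckLevel F ω (k + 1) - neckLevel F ω k)
    have hY := levelSum_pos F x (neckLevel F ω k) ω
    rw [← Real.log_nonpos_iff (mul_pos hp hY).le, Real.log_mul hp.ne' hY.ne', Real.log_pow]
    rw [← add_div, div_lt_iff₀ hk0, zero_mul] at hk
    exact hk.le
  exact ⟨C, levelSum_le_of_levels hF hx (strictMono_neckLevel h.necks) (by simp [neckLevel]) hC⟩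

/-- Growth like exp(L k) at the necks beats M^gap, which is the input for `IsCut.one_le_sum_rpow`.
Passing from the k-th to the next neck changes the logarithm by o(k) only. -/
theorem HasAverages.exists_one_le_sum (hF : F.Bounds M lo hi) {x L : ℝ} (hx : 0 ≤ x)
    {ω : VTree J V} (h : HasAverages F ω x L) (hL : 0 < L) :
    ∃ C, ∀ A, IsCut F ω A → 1 ≤ C * ∑ w ∈ A, weight F ω w ^ x := by
  have hM : (0 : ℝ) < M := by exact_mod_cast zero_lt_two.trans_le (hF.two_le ω)
  have hgap := tendsto_gap (u := fun k => Real.log (levelSum F x (neckLevel F ω k) ω)) h.sums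
  have h1 := (h.gap_mul (Real.log M)).sub (hgap.add h.sums)
  rw [zero_add, zero_sub] at h1
  obtain ⟨C, hC⟩ : ∃ C, ∀ k, (M : ℝ) ^ (neckLevel F ω (k + 1) - neckLevel F ω k) /
      levelSum F x (neckLevel F ω (k + 1)) ω ≤ C := by
    refine exists_le_of_eventually_le (c := 1) ?_
    filter_upwards [h1.eventually_lt_const (neg_lt_zero.2 hL), eventually_gt_atTop 0] with k hk hk0
    have hk0 : (0 : ℝ) < k := by exact_mod_cast hk0
    have hp := pow_pos hM (neckLevel F ω (k + 1) - neckLevel F ω k)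
    have hY := levelSum_pos F x (neckLevel F ω (k + 1)) ω
    rw [← Real.log_nonpos_iff (div_pos hp hY).le, Real.log_div hp.ne' hY.ne', Real.log_pow]
    rw [← add_div, ← sub_div, div_lt_iff₀ hk0, zero_mul] at hk
    linarith
  refine ⟨C, fun A hA => hA.one_le_sum_rpow hF hx (strictMono_neckLevel h.necks)
    (by simp [neckLevel]) (fun k => isNeckLevel_neckLevel k h.necks) fun k => ?_⟩
  rw [← div_le_iff₀ (levelSum_pos F x _ ω)]
  exact hC k

omit [NeZero V] in
-- A cut may meet all generations, so bounded level sums do not suffice at the same exponent;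
-- raising it gains a geometric factor per generation.
theorem IsCut.sum_rpow_le_of_levelSum_le (hF : F.Bounds M lo hi) {x y C : ℝ} (hxy : x < y)
    {ω : VTree J V} (hC : ∀ n, levelSum F x n ω ≤ C) {A : Finset (List ℕ)} (hA : IsCut F ω A) :
    ∑ w ∈ A, weight F ω w ^ y ≤ (1 - (hi ^ 2) ^ (y - x))⁻¹ * C := by
  obtain ⟨K, hK⟩ := hA.sum_rpow_le y
  have hρ0 : 0 ≤ (hi ^ 2) ^ (y - x) := Real.rpow_nonneg (sq_nonneg _) _
  have hρ1 : (hi ^ 2) ^ (y - x) < 1 := by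
    refine Real.rpow_lt_one (sq_nonneg _) ?_ (sub_pos.2 hxy)
    exact pow_lt_one₀ (hF.hi_pos ω).le hF.hi_lt two_ne_zero
  have hC0 : 0 ≤ C := (levelSum_pos F x 0 ω).le.trans (hC 0)
  refine hK.trans ?_
  calc _ ≤ ∑ k ∈ Finset.range K, ((hi ^ 2) ^ (y - x)) ^ k * C :=
        Finset.sum_le_sum fun k _ => (levelSum_le_of_le hF hxy.le k ω).trans
          (mul_le_mul_of_nonneg_left (hC k) (pow_nonneg hρ0 _))
    _ ≤ _ := by
        rw [← Finset.sum_mul]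
        refine mul_le_mul_of_nonneg_right ?_ hC0
        rw [← tsum_geometric_of_lt_one hρ0 hρ1]
        exact (summable_geometric_of_lt_one hρ0 hρ1).sum_le_tsum _ fun _ _ => pow_nonneg hρ0 _

end NeckLevels

end VCantor
end

noncomputable section

namespace VCantor

/-! ### From power bounds to logarithmic growth rates -/

theorem tendsto_log_div_log {N : ℝ → ℕ} {γ : ℝ} (hγ : 0 < γ)
    (hupper : ∀ y, γ < y → ∃ x C, 0 ≤ x ∧ x < y ∧ ∀ᶠ t in atTop, (N t : ℝ) ≤ C * t ^ x)
    (hlower : ∀ y, 0 < y → y < γ → ∃ x c, y < x ∧ 0 < c ∧ ∀ᶠ t in atTop, c * t ^ x ≤ N t) :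
    Tendsto (fun t : ℝ => Real.log (N t) / Real.log t) atTop (𝓝 γ) := by
  have hlim : ∀ K x : ℝ, Tendsto (fun t : ℝ => K / Real.log t + x) atTop (𝓝 x) := fun K x => by
    have := (tendsto_const_nhds (x := K)).div_atTop Real.tendsto_log_atTop
    simpa using this.add_const x
  rw [tendsto_order]
  constructor
  · intro y hy
    -- `y` need not be positive, so it is replaced by a positive number still below `γ`.
    obtain ⟨x, c, hyx, hc, h⟩ := hlower (max y (γ / 2)) (lt_max_of_lt_right (by linarith))
      (max_lt hy (by linarith))
    filter_upwards [h, (hlim (Real.log c) x).eventually_const_lt ((le_max_left _ _).trans_lt hyx),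
      eventually_gt_atTop 1] with t ht hlt h1
    have hlog := Real.log_pos h1
    have ht0 : 0 < t := by linarith
    have hpos : 0 < c * t ^ x := mul_pos hc (Real.rpow_pos_of_pos ht0 _)
    have h2 := Real.log_le_log hpos ht
    rw [Real.log_mul hc.ne' (Real.rpow_pos_of_pos ht0 _).ne', Real.log_rpow ht0] at h2
    refine hlt.trans_le ?_
    rw [le_div_iff₀ hlog, add_mul, div_mul_cancel₀ _ hlog.ne']
    exact h2
  · intro y hy
    obtain ⟨x, C, hx, hxy, h⟩ := hupper y hy
    -- `D ≥ 1` makes the logarithm of the bound nonnegative, which covers `N t = 0`, where `Real.log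
    -- 0 = 0`.
    set D := max C 1 with hD
    have hD1 : 1 ≤ D := le_max_right _ _
    filter_upwards [h, (hlim (Real.log D) x).eventually_lt_const hxy, eventually_gt_atTop 1]
      with t ht hlt h1
    have hlog := Real.log_pos h1
    have ht0 : 0 < t := by linarith
    have hDpos : 0 < D := by linarith
    have hle : (N t : ℝ) ≤ D * t ^ x := ht.trans
      (mul_le_mul_of_nonneg_right (le_max_left _ _) (Real.rpow_nonneg ht0.le _))
    refine lt_of_le_of_lt ?_ hlt
    rw [div_le_iff₀ hlog, add_mul, div_mul_cancel₀ _ hlog.ne', ← Real.log_rpow ht0,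
      ← Real.log_mul hDpos.ne' (Real.rpow_pos_of_pos ht0 _).ne']
    rcases Nat.eq_zero_or_pos (N t) with h0 | h0
    · rw [h0, Nat.cast_zero, Real.log_zero]
      refine Real.log_nonneg ?_
      have := Real.one_le_rpow h1.le hx
      nlinarith
    · exact Real.log_le_log (by exact_mod_cast h0) hle

/-! ### Counting functions from sums over cuts -/

section Counting

variable {J : Type*} {V : ℕ} {a b : ℝ} {F : IFSFamily J a b} {M : ℕ} {lo hi : ℝ}
  (hF : F.Bounds M lo hi)
include hF

theorem exists_isCut_of_pos (ω : VTree J V) {s : ℝ} (hs : 0 < s) (hs1 : s ≤ 1) :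
    ∃ A, IsCut F ω A ∧ ∀ w ∈ A, weight F ω w < s ∧ lo ^ 2 * s ≤ weight F ω w := by
  have hhi : hi ^ 2 < 1 := pow_lt_one₀ (hF.hi_pos ω).le hF.hi_lt two_ne_zero
  obtain ⟨n, hn⟩ := exists_pow_lt_of_lt_one hs hhi
  refine exists_isCut hF n ω s hn ?_
  exact mul_le_one₀ (pow_le_one₀ hF.lo_pos.le (hF.lo_lt_one ω).le) hs.le hs1

/-- Cutting at s = 1/((b - a) t) makes the upper eigenvalue bound applicable. All weights are at
least lo² s, so the cut has at most C (lo² s)^(-x) members. -/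
theorem eventually_eigenCount_le {BC : (ℝ → ℝ) → Prop} (hBC : IsSymmetricBC a b BC) {x C : ℝ}
    (hx : 0 ≤ x) {ω : VTree J V} (hC : ∀ A, IsCut F ω A → ∑ w ∈ A, weight F ω w ^ x ≤ C) :
    ∀ᶠ t in atTop, (eigenCount a b BC (cantorMeasure hF ω) t : ℝ) ≤
      C * ((b - a) / lo ^ 2) ^ x * t ^ x := by
  have hL : 0 < b - a := sub_pos.2 F.a_lt_b
  have hlo : 0 < lo ^ 2 := pow_pos hF.lo_pos 2
  filter_upwards [eventually_ge_atTop (b - a)⁻¹] with t ht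
  have ht0 : 0 < t := (inv_pos.2 hL).trans_le ht
  have hs : 0 < ((b - a) * t)⁻¹ := inv_pos.2 (mul_pos hL ht0)
  have hs1 : ((b - a) * t)⁻¹ ≤ 1 := by
    refine inv_le_one_of_one_le₀ ?_
    rwa [mul_comm, ← div_le_iff₀ hL, one_div]
  obtain ⟨A, hA, hAw⟩ := exists_isCut_of_pos hF ω hs hs1
  have h1 : (eigenCount a b BC (cantorMeasure hF ω) t : ℝ) ≤ A.card := by
    refine Nat.cast_le.2 (hA.eigenCount_le hF hBC ht0 fun w hw => ?_).2
    rw [mul_assoc, ← lt_inv_mul_iff₀' (mul_pos hL ht0), mul_one]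
    exact (hAw w hw).1
  have h2 : (A.card : ℝ) * (lo ^ 2 * ((b - a) * t)⁻¹) ^ x ≤ C := by
    refine le_trans ?_ (hC A hA)
    rw [← nsmul_eq_mul]
    refine Finset.card_nsmul_le_sum _ _ _ fun w hw => ?_
    exact Real.rpow_le_rpow (mul_pos hlo hs).le (hAw w hw).2 hx
  have h3 : C * ((b - a) / lo ^ 2) ^ x * t ^ x = C / (lo ^ 2 * ((b - a) * t)⁻¹) ^ x := by
    rw [mul_assoc, ← Real.mul_rpow (by positivity) ht0.le, div_eq_mul_inv C,
      ← Real.inv_rpow (mul_pos hlo hs).le]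
    congr 2
    field_simp
  rw [h3]
  exact h1.trans ((le_div_iff₀ (Real.rpow_pos_of_pos (mul_pos hlo hs) _)).2 h2)

/-- Cutting at K/t keeps the weights large enough for the trapezoids. All weights are below K/t, so
the lower bound for the cut sum forces many members. -/
theorem eventually_le_count {x C : ℝ} (hx : 0 < x) {ω : VTree J V}
    (hC : ∀ A, IsCut F ω A → 1 ≤ C * ∑ w ∈ A, weight F ω w ^ x) :
    ∃ c, 0 < c ∧ ∀ᶠ t in atTop, c * t ^ x ≤ countD a b (cantorMeasure hF ω) t ∧
      c * t ^ x ≤ countN a b (cantorMeasure hF ω) t := by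
  have hL : 0 < b - a := sub_pos.2 F.a_lt_b
  have hlo := hF.lo_pos
  have hCpos : 0 < C := by
    have := hC _ (.root ω)
    simp only [Finset.sum_singleton, weight_nil, Real.one_rpow, mul_one] at this
    linarith
  -- The weights are at least `lo ^ 2 * (K / t)`, so the quantity in `IsCut.le_count` is at least 3,
  -- which exceeds 2.
  set K := 3 / (lo ^ 6 * (b - a)) with hK
  have hKpos : 0 < K := by positivity
  have hc : 0 < (C * K ^ x)⁻¹ := inv_pos.2 (mul_pos hCpos (Real.rpow_pos_of_pos hKpos _))
  -- Half of the constant is given away to absorb the `+ 1` of the Neumann case for large `t`.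
  refine ⟨(C * K ^ x)⁻¹ / 2, half_pos hc, ?_⟩
  have hlim : Tendsto (fun t : ℝ => (C * K ^ x)⁻¹ / 2 * t ^ x) atTop atTop :=
    (tendsto_rpow_atTop hx).const_mul_atTop (half_pos hc)
  filter_upwards [eventually_ge_atTop K, eventually_gt_atTop 0, hlim.eventually_ge_atTop 1]
    with t ht ht0 h1
  have hs : 0 < K / t := div_pos hKpos ht0
  obtain ⟨A, hA, hAw⟩ := exists_isCut_of_pos hF ω hs ((div_le_one ht0).2 ht)
  have hcount := hA.le_count hF ht0 fun w hw => by
    have h3 : t * (lo ^ 2 * (K / t) * (lo ^ 4 * (b - a))) = 3 := by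
      rw [hK]; field_simp
    have h4 : t * (lo ^ 2 * (K / t) * (lo ^ 4 * (b - a))) ≤
        t * (weight F ω w * (lo ^ 4 * (b - a))) := by
      have := (hAw w hw).2
      gcongr
    linarith
  have hcard : (C * K ^ x)⁻¹ * t ^ x ≤ A.card := by
    have h2 : ∑ w ∈ A, weight F ω w ^ x ≤ A.card * (K / t) ^ x := by
      rw [← nsmul_eq_mul]
      refine Finset.sum_le_card_nsmul _ _ _ fun w hw => ?_
      exact Real.rpow_le_rpow (weight_pos F (hA.mem_generation w hw)).le (hAw w hw).1.le hx.le
    have h3 : 1 ≤ C * (A.card * (K / t) ^ x) :=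
      (hC A hA).trans (mul_le_mul_of_nonneg_left h2 hCpos.le)
    have htx := Real.rpow_pos_of_pos ht0 x
    have hKx := Real.rpow_pos_of_pos hKpos x
    rw [Real.div_rpow hKpos.le ht0.le] at h3
    rw [inv_mul_le_iff₀ (mul_pos hCpos hKx), ← one_le_div htx]
    refine h3.trans_eq ?_
    ring
  have hD : (A.card : ℝ) ≤ countD a b (cantorMeasure hF ω) t := by exact_mod_cast hcount.1
  have hN : (A.card : ℝ) ≤ countN a b (cantorMeasure hF ω) t + 1 := by exact_mod_cast hcount.2
  constructor <;> linarith

/-- Bounds for the sums over cuts determine the growth of the counting functions. -/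
theorem tendsto_log_count {γ : ℝ} (hγ : 0 < γ) {ω : VTree J V}
    (hupper : ∀ y, γ < y → ∃ x C, γ ≤ x ∧ x < y ∧
      ∀ A, IsCut F ω A → ∑ w ∈ A, weight F ω w ^ x ≤ C)
    (hlower : ∀ y, 0 < y → y < γ → ∃ x C, y < x ∧
      ∀ A, IsCut F ω A → 1 ≤ C * ∑ w ∈ A, weight F ω w ^ x) :
    Tendsto (fun t : ℝ => Real.log (countD a b (cantorMeasure hF ω) t) / Real.log t)
      atTop (𝓝 γ) ∧
    Tendsto (fun t : ℝ => Real.log (countN a b (cantorMeasure hF ω) t) / Real.log t)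
      atTop (𝓝 γ) := by
  have hup : ∀ BC, IsSymmetricBC a b BC → ∀ y, γ < y → ∃ x C, 0 ≤ x ∧ x < y ∧
      ∀ᶠ t in atTop, (eigenCount a b BC (cantorMeasure hF ω) t : ℝ) ≤ C * t ^ x := by
    intro BC hBC y hy
    obtain ⟨x, C, hx, hxy, hC⟩ := hupper y hy
    exact ⟨x, _, hγ.le.trans hx, hxy, eventually_eigenCount_le hF hBC (hγ.le.trans hx) hC⟩
  refine ⟨tendsto_log_div_log hγ (hup _ isSymmetricBC_dirichlet) fun y hy hyγ => ?_,
    tendsto_log_div_log hγ (hup _ isSymmetricBC_neumann) fun y hy hyγ => ?_⟩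
  all_goals
    obtain ⟨x, C, hyx, hC⟩ := hlower y hy hyγ
    obtain ⟨c, hc, h⟩ := eventually_le_count hF (hy.trans hyx) hC
  · exact ⟨x, c, hyx, hc, h.mono fun t ht => ht.1⟩
  · exact ⟨x, c, hyx, hc, h.mono fun t ht => ht.2⟩

end Counting

/-! ### Almost sure behaviour of random trees -/

section Typical

variable {J : Type*} {V : ℕ} {a b : ℝ} {F : IFSFamily J a b} {M : ℕ} {lo hi : ℝ}
  [NeZero V] [MeasurableSpace J]
  (hF : F.Bounds M lo hi) (hN : Measurable F.N) (hr : ∀ i, Measurable fun j => F.r j i)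
  (hm : ∀ i, Measurable fun j => F.m j i) (P : Measure J) [IsProbabilityMeasure P]
include hF hN hr hm

/-- Both `firstNeck` and `logNeckSum` depend on the block below the first neck only, for the latter
by `levelSum_congr`, so the law of large numbers applies to both. -/
theorem ae_hasAverages {x : ℝ} (hx : 0 ≤ x) : ∀ᵐ ω ∂(treeLaw P V),
    HasAverages F ω x (∫ ω, logNeckSum F x ω ∂(treeLaw P V)) := by
  have hnecks : ∀ᵐ ω ∂(treeLaw P V), ∀ l, ∃ k, IsNeck F (((regen F)^[l] ω).2 k) :=
    ae_all_iff.2 fun l => ((measurePreserving_regen hN P hF.N_le).iterate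
      l).quasiMeasurePreserving.ae (ae_exists_isNeck hN P hF.N_le)
  have hlevel := ae_tendsto_average hN P hF.N_le
    (G := fun ω : VTree J V => (firstNeck F ω : ℝ))
    (measurable_from_top.comp (measurable_firstNeck hN)) (integrable_firstNeck hN P hF.N_le)
    fun τ n e e' he he' _ _ => by rw [firstNeck_of_mem F he, firstNeck_of_mem F he']
  have hsums := ae_tendsto_average hN P hF.N_le (V := V)
    (measurable_logNeckSum hN hr hm hF.N_le x) (integrable_logNeckSum hF hN hr hm P hx)
    fun τ n e e' he he' h h' => by
      change Real.log (levelSum F x _ _) = Real.log (levelSum F x _ _)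
      rw [firstNeck_of_mem F he, firstNeck_of_mem F he', levelSum_congr F x n h h']
  filter_upwards [hnecks, hlevel, hsums] with ω h1 h2 h3
  refine ⟨h1, ⟨_, h2.congr fun k => ?_⟩, h3.congr fun k => ?_⟩
  · simp [neckLevel]
  · rw [log_levelSum_neckLevel x k h1]

theorem ae_tendsto_log_count {γ : ℝ} (hγ : 0 < γ)
    (hpos : ∀ x, 0 < x → x < γ → 0 < ∫ ω, logNeckSum F x ω ∂(treeLaw P V))
    (hneg : ∀ x, γ < x → (∫ ω, logNeckSum F x ω ∂(treeLaw P V)) < 0) :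
    ∀ᵐ ω ∂(treeLaw P V),
      Tendsto (fun t : ℝ => Real.log (countD a b (cantorMeasure hF ω) t) / Real.log t)
        atTop (𝓝 γ) ∧
      Tendsto (fun t : ℝ => Real.log (countN a b (cantorMeasure hF ω) t) / Real.log t)
        atTop (𝓝 γ) := by
  -- The exceptional null set depends on the exponent; rational exponents leave countably many and
  -- are dense enough.
  have hav : ∀ᵐ ω ∂(treeLaw P V), ∀ q : ℚ, (0 : ℝ) ≤ q →
      HasAverages F ω q (∫ ω, logNeckSum F q ω ∂(treeLaw P V)) := by
    refine ae_all_iff.2 fun q => ?_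
    by_cases hq : (0 : ℝ) ≤ q
    · filter_upwards [ae_hasAverages hF hN hr hm P hq] with ω h _ using h
    · exact .of_forall fun _ h => absurd h hq
  filter_upwards [hav] with ω hω
  refine tendsto_log_count hF hγ (fun y hy => ?_) fun y hy hyγ => ?_
  · obtain ⟨q, hγq, hqy⟩ := exists_rat_btwn hy
    obtain ⟨C, hC⟩ := (hω q (hγ.trans hγq).le).exists_levelSum_le hF (hγ.trans hγq).le (hneg q hγq)
    obtain ⟨x, hqx, hxy⟩ := exists_between hqy
    exact ⟨x, _, (hγq.trans hqx).le, hxy, fun A hA => hA.sum_rpow_le_of_levelSum_le hF hqx hC⟩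
  · obtain ⟨q, hyq, hqγ⟩ := exists_rat_btwn hyγ
    have hq := hy.trans hyq
    obtain ⟨C, hC⟩ := (hω q hq.le).exists_one_le_sum hF hq.le (hpos q hq hqγ)
    exact ⟨q, C, hyq, hC⟩

end Typical

end VCantor
end

/-! ### The theorem -/

open VCantor in
theorem theorem4p16 {J : Type*} [MeasurableSpace J] {a b : ℝ} (F : IFSFamily J a b)
    (hN : Measurable F.N) (hr : ∀ i, Measurable fun j => F.r j i)
    (hm : ∀ i, Measurable fun j => F.m j i)
    (hC1 : BddAbove (Set.range F.N))
    (hC2 : ∃ lo hi : ℝ, 0 < lo ∧ hi < 1 ∧ ∀ j, ∀ i < F.N j, lo ≤ F.m j i ∧ F.m j i ≤ hi)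
    (hC3 : ∃ lo hi : ℝ, 0 < lo ∧ hi < 1 ∧ ∀ j, ∀ i < F.N j, lo ≤ F.r j i ∧ F.r j i ≤ hi)
    (P : Measure J) [IsProbabilityMeasure P] (V : ℕ) [NeZero V] :
    -- the function `f` is well defined
    (∀ᵐ ω ∂(treeLaw P V), ∃ n, IsNeckLevel F ω n) ∧
    (∀ x : ℝ, 0 < x → Integrable (logNeckSum F x) (treeLaw P V)) ∧
    -- `γ` is its unique positive zero, and it is almost surely the spectral exponent
    ∃ γ : ℝ, 0 < γ ∧ (∫ ω, logNeckSum F γ ω ∂(treeLaw P V)) = 0 ∧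
      (∀ x : ℝ, 0 < x → (∫ ω, logNeckSum F x ω ∂(treeLaw P V)) = 0 → x = γ) ∧
      ∀ᵐ ω ∂(treeLaw P V), ∃ μ : ProbabilityMeasure ℝ, IsCantorMeasure F ω μ ∧
        Tendsto (fun t : ℝ => Real.log (countD a b (μ : Measure ℝ) t) / Real.log t)
          atTop (𝓝 γ) ∧
        Tendsto (fun t : ℝ => Real.log (countN a b (μ : Measure ℝ) t) / Real.log t)
          atTop (𝓝 γ) := by
  obtain ⟨M, hM⟩ := hC1
  obtain ⟨lo₁, hi₁, hlo₁, hhi₁, h₁⟩ := hC2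
  obtain ⟨lo₂, hi₂, hlo₂, hhi₂, h₂⟩ := hC3
  have hF : F.Bounds M (min lo₁ lo₂) (max hi₁ hi₂) :=
    { lo_pos := lt_min hlo₁ hlo₂
      hi_lt := max_lt hhi₁ hhi₂
      N_le := fun j => hM (Set.mem_range_self j)
      lo_le_m := fun j i hi => (min_le_left _ _).trans (h₁ j i hi).1
      m_le_hi := fun j i hi => (h₁ j i hi).2.trans (le_max_left _ _)
      lo_le_r := fun j i hi => (min_le_right _ _).trans (h₂ j i hi).1
      r_le_hi := fun j i hi => (h₂ j i hi).2.trans (le_max_right _ _) }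
  obtain ⟨γ, hγ, hγ0, hpos, hneg⟩ := exists_exponent (V := V) hF hN hr hm P
  refine ⟨?_, fun x hx => integrable_logNeckSum hF hN hr hm P hx.le, γ, hγ, hγ0,
    fun x hx hx0 => ?_, ?_⟩
  · filter_upwards [ae_exists_isNeck hN P hF.N_le] with ω hω
    exact ⟨_, isNeckLevel_firstNeck hω⟩
  · rcases lt_trichotomy x γ with h | h | h
    · exact absurd hx0 (hpos x hx h).ne'
    · exact h
    · exact absurd hx0 (hneg x h).ne
  · filter_upwards [ae_tendsto_log_count hF hN hr hm P hγ hpos hneg] with ω hω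
    exact ⟨cantorMeasure hF ω, isCantorMeasure_cantorMeasure hF ω, hω.1, hω.2⟩
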